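/- Let $\sigma\in\{1,-1\}$ and $T_0>0$. Let $u_1,u_2:\mathbb R\to\mathbb R$ be continuous and integrable, and put $$\chi(k)=-\frac{i}{2\pi}\int_{\mathbb R}u_1(\eta)e^{ik\eta}\,d\eta,\qquad \kappa(l)=-\frac{i}{2\pi}\int_{\mathbb R}u_2(\xi)e^{il\xi}\,d\xi ,$$ which are assumed integrable (for instance $u_1(\eta)=a\,\cosh^{-2}(\lambda\eta)$, $u_2(\xi)=b\,\cosh^{-2}(\mu\xi)$ with $\lambda,\mu>0$ and $a,b\in\mathbb R$). Let $Q=Q(\xi,\eta,t)$ (complex-valued) and $G_1,G_2$ (real-valued) solve the DS-1 equations for $(\xi,\eta)\in\mathbb R^2$, $t\in[0,T_0]$, $$i\partial_tQ+(\partial_\xi^2+\partial_\eta^2)Q+(G_1+G_2)Q=0,\quad \partial_\xi G_1=-\tfrac{\sigma}{2}\partial_\eta|Q|^2,\quad \partial_\eta G_2=-\tfrac{\sigma}{2}\partial_\xi|Q|^2,$$ with $G_1\to u_1(\eta)$ as $\xi\to-\infty$ and $G_2\to u_2(\xi)$ as $\eta\to-\infty$. Let $U$ (complex-valued), $V_1,V_2$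 (real-valued) solve the linearized equations $$i\partial_tU+(\partial_\xi^2+\partial_\eta^2)U+(G_1+G_2)U+(V_1+V_2)Q=iF,$$ $$\partial_\xi V_1=-\tfrac{\sigma}{2}\partial_\eta(Q\bar U+\bar QU),\quad \partial_\eta V_2=-\tfrac{\sigma}{2}\partial_\xi(Q\bar U+\bar QU),$$ with $V_1\to0$ as $\xi\to-\infty$ and $V_2\to0$ as $\eta\to-\infty$. Assume that for all $t\in[0,T_0]$ one has $\partial^\alpha Q\in L_1\cap C^1$ for $|\alpha|\le3$ and $\partial^\alpha U,\partial^\alpha F\in L_1\cap C^1$ for $|\alpha|\le4$ (derivatives in $\xi,\eta$), these derivatives depending continuously on $t$ in $L_1(\mathbb R^2)$. Then for all real $k,l$ and $t\in[0,T_0]$ there are unique bounded continuous $\psi=(\psi_1,\psi_2)(\xi,\eta,k,t)$ and $\phi=(\phi_1,\phi_2)(\xi,\eta,l,t)$ such that $$\partial_\xi\psi_1=-\tfrac12Q\psi_2,\quad \partial_\eta\psi_2=-\tfrac{\sigma}{2}\bar Q\psi_1,\quad \psi_1\to e^{ik\eta}\ (\xi\to-\infty),\quad \psi_2\to0\ (\eta\to+\infty),$$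 $$\phi_1=e^{il\xi}+\tfrac12\int_{-\infty}^{\eta}Q\phi_2\,d\eta',\qquad \phi_2=-\tfrac{\sigma}{2}\int_\xi^{\infty}\bar Q\phi_1\,d\xi'.$$ With the spectral coefficients $$\hat f(k,l,t)=\frac1{4\pi}\iint_{\mathbb R^2}\big(\sigma\,\psi_1\phi_1\,\bar f+\psi_2\phi_2\,f\big)\,d\xi\,d\eta ,$$ the integrals below converge absolutely, $\hat U$ is differentiable in $t$, and for all $k,l\in\mathbb R$, $t\in[0,T_0]$ $$\partial_t\hat U=i(k^2+l^2)\hat U+\int_{\mathbb R}\hat U(k-k',l,t)\chi(k')\,dk'+\int_{\mathbb R}\hat U(k,l-l',t)\kappa(l')\,dl'+\hat F .$$ Consequently $\tilde U(\xi,\eta,t)=\frac1{2\pi}\int_{\mathbb R^2}\hat U(k,l,t)e^{-ik\eta-il\xi}\,dk\,dl$ and $\tilde F$, defined from $\hat F$ in the same way, satisfy the linear Schrödinger equation $$i\partial_t\tilde U-(\partial_\xi^2+\partial_\eta^2)\tilde U-(u_2(\xi)+u_1(\eta))\tilde U=i\tilde F$$ in the sense of tempered distributions in $(\xi,\eta)$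 for each $t\in[0,T_0]$; and $\tilde U(\cdot,t)\in C^2$ and the equation holds pointwise if $(1+k^2+l^2)|\hat U|$ and $|\hat F|$ are bounded, for all $t\in[0,T_0]$, by one integrable function of $(k,l)$. (At $t=0$ and $t=T_0$ time derivatives are one-sided.) -/

import Mathlib

open MeasureTheory Filter Topology

noncomputable section

namespace DS1

/-- Partial derivative in the first variable `ξ` of a function of `p = (ξ, η)`. -/
def dXi {E : Type*} [NormedAddCommGroup E] [NormedSpace ℝ E] (f : ℝ × ℝ → E) : ℝ × ℝ → E :=
  fun p => deriv (fun x => f (x, p.2)) p.1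

/-- Partial derivative in the second variable `η` of a function of `p = (ξ, η)`. -/
def dEta {E : Type*} [NormedAddCommGroup E] [NormedSpace ℝ E] (f : ℝ × ℝ → E) : ℝ × ℝ → E :=
  fun p => deriv (fun y => f (p.1, y)) p.2

/-- `∂_ξ^a ∂_η^b f`. -/
def dMulti (a b : ℕ) (f : ℝ × ℝ → ℂ) : ℝ × ℝ → ℂ := dXi^[a] (dEta^[b] f)

/-- `(∂_ξ² + ∂_η²) f`. -/
def lap (f : ℝ × ℝ → ℂ) : ℝ × ℝ → ℂ := fun p => dXi (dXi f) p + dEta (dEta f) p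

/-- `∂^α f(·, t) ∈ L₁ ∩ C¹` for all `|α| ≤ n` and `t ∈ [0, T]`, with `t ↦ ∂^α f(·, t)` continuous
in `L₁`. All `∂^α f`, `|α| ≤ n`, are `C¹` exactly if `f` is `C^(n+1)`. -/
structure RegularOn (n : ℕ) (T : ℝ) (f : ℝ → ℝ × ℝ → ℂ) : Prop where
  contDiff : ∀ t ∈ Set.Icc 0 T, ContDiff ℝ ((n + 1 : ℕ) : ℕ∞) (f t)
  integrable : ∀ t ∈ Set.Icc 0 T, ∀ a b : ℕ, a + b ≤ n → Integrable (dMulti a b (f t))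
  continuous_L1 : ∀ t₀ ∈ Set.Icc 0 T, ∀ a b : ℕ, a + b ≤ n →
    Tendsto (fun t => ∫ p, ‖dMulti a b (f t) p - dMulti a b (f t₀) p‖)
      (𝓝[Set.Icc 0 T] t₀) (𝓝 0)

/-- `(Q, G₁, G₂)` solves the DS-1 equations on `[0, T]` with boundary values
`G₁ → u₁(η)` as `ξ → -∞` and `G₂ → u₂(ξ)` as `η → -∞`. -/
structure IsSolution (σ T : ℝ) (u₁ u₂ : ℝ → ℝ) (Q : ℝ → ℝ × ℝ → ℂ)
    (G₁ G₂ : ℝ → ℝ × ℝ → ℝ) : Prop where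
  differentiable_time : ∀ t ∈ Set.Icc 0 T, ∀ p,
    DifferentiableWithinAt ℝ (fun s => Q s p) (Set.Icc 0 T) t
  evolution : ∀ t ∈ Set.Icc 0 T, ∀ p,
    Complex.I * derivWithin (fun s => Q s p) (Set.Icc 0 T) t + lap (Q t) p
      + ((G₁ t p + G₂ t p : ℝ) : ℂ) * Q t p = 0
  differentiable_G₁ : ∀ t ∈ Set.Icc 0 T, ∀ ξ η, DifferentiableAt ℝ (fun x => G₁ t (x, η)) ξ
  differentiable_G₂ : ∀ t ∈ Set.Icc 0 T, ∀ ξ η, DifferentiableAt ℝ (fun y => G₂ t (ξ, y)) η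
  eq_G₁ : ∀ t ∈ Set.Icc 0 T, ∀ p,
    dXi (G₁ t) p = -(σ / 2) * dEta (fun r => ‖Q t r‖ ^ 2) p
  eq_G₂ : ∀ t ∈ Set.Icc 0 T, ∀ p,
    dEta (G₂ t) p = -(σ / 2) * dXi (fun r => ‖Q t r‖ ^ 2) p
  boundary_G₁ : ∀ t ∈ Set.Icc 0 T, ∀ η, Tendsto (fun ξ => G₁ t (ξ, η)) atBot (𝓝 (u₁ η))
  boundary_G₂ : ∀ t ∈ Set.Icc 0 T, ∀ ξ, Tendsto (fun η => G₂ t (ξ, η)) atBot (𝓝 (u₂ ξ))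

/-- `Q Ū + Q̄ U`, a real number. -/
def cross (q u : ℂ) : ℝ := (q * starRingEnd ℂ u + starRingEnd ℂ q * u).re

/-- `(U, V₁, V₂)` solves on `[0, T]` the DS-1 equations linearized at `(Q, G₁, G₂)`, with
right-hand side `iF`. As the boundary values of `G₁, G₂` are prescribed, their variations
`V₁, V₂` vanish as `ξ → -∞` and `η → -∞`, respectively. -/
structure IsLinearizedSolution (σ T : ℝ) (Q : ℝ → ℝ × ℝ → ℂ) (G₁ G₂ : ℝ → ℝ × ℝ → ℝ)
    (F U : ℝ → ℝ × ℝ → ℂ) (V₁ V₂ : ℝ → ℝ × ℝ → ℝ) : Prop where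
  differentiable_time : ∀ t ∈ Set.Icc 0 T, ∀ p,
    DifferentiableWithinAt ℝ (fun s => U s p) (Set.Icc 0 T) t
  evolution : ∀ t ∈ Set.Icc 0 T, ∀ p,
    Complex.I * derivWithin (fun s => U s p) (Set.Icc 0 T) t + lap (U t) p
      + ((G₁ t p + G₂ t p : ℝ) : ℂ) * U t p + ((V₁ t p + V₂ t p : ℝ) : ℂ) * Q t p
      = Complex.I * F t p
  differentiable_V₁ : ∀ t ∈ Set.Icc 0 T, ∀ ξ η, DifferentiableAt ℝ (fun x => V₁ t (x, η)) ξ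
  differentiable_V₂ : ∀ t ∈ Set.Icc 0 T, ∀ ξ η, DifferentiableAt ℝ (fun y => V₂ t (ξ, y)) η
  eq_V₁ : ∀ t ∈ Set.Icc 0 T, ∀ p,
    dXi (V₁ t) p = -(σ / 2) * dEta (fun r => cross (Q t r) (U t r)) p
  eq_V₂ : ∀ t ∈ Set.Icc 0 T, ∀ p,
    dEta (V₂ t) p = -(σ / 2) * dXi (fun r => cross (Q t r) (U t r)) p
  boundary_V₁ : ∀ t ∈ Set.Icc 0 T, ∀ η, Tendsto (fun ξ => V₁ t (ξ, η)) atBot (𝓝 0)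
  boundary_V₂ : ∀ t ∈ Set.Icc 0 T, ∀ ξ, Tendsto (fun η => V₂ t (ξ, η)) atBot (𝓝 0)

/-- `ψ = (ψ₁₁⁺, ψ₂₁⁺)` is the first column of the bounded solution of the Goursat problem for the
Dirac system with potential `q`: `∂_ξ ψ₁ = -½ q ψ₂`, `∂_η ψ₂ = -½ σ q̄ ψ₁`,
`ψ₁ → exp(ikη)` as `ξ → -∞`, `ψ₂ → 0` as `η → +∞`. -/
structure IsPsi (σ : ℝ) (q : ℝ × ℝ → ℂ) (k : ℝ) (ψ : ℝ × ℝ → ℂ × ℂ) : Prop where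
  continuous : Continuous ψ
  bounded : ∃ C : ℝ, ∀ p, ‖ψ p‖ ≤ C
  dirac₁ : ∀ ξ η, HasDerivAt (fun x => (ψ (x, η)).1) (-(1 / 2) * q (ξ, η) * (ψ (ξ, η)).2) ξ
  dirac₂ : ∀ ξ η, HasDerivAt (fun y => (ψ (ξ, y)).2)
    (-(1 / 2) * (σ : ℂ) * starRingEnd ℂ (q (ξ, η)) * (ψ (ξ, η)).1) η
  boundary₁ : ∀ η, Tendsto (fun ξ => (ψ (ξ, η)).1) atBot (𝓝 (Complex.exp (Complex.I * k * η)))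
  boundary₂ : ∀ ξ, Tendsto (fun η => (ψ (ξ, η)).2) atTop (𝓝 0)

/-- `φ = (φ₁₁, φ₂₁)` is the bounded column conjugated to `ψ` with respect to the bilinear form
`pairing`, i.e. the solution of
`φ₁ = exp(ilξ) + ½ ∫_{-∞}^η q φ₂ dη'`, `φ₂ = -½ σ ∫_ξ^∞ q̄ φ₁ dξ'`. -/
structure IsPhi (σ : ℝ) (q : ℝ × ℝ → ℂ) (l : ℝ) (φ : ℝ × ℝ → ℂ × ℂ) : Prop where
  continuous : Continuous φ
  bounded : ∃ C : ℝ, ∀ p, ‖φ p‖ ≤ C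
  eq₁ : ∀ ξ η, (φ (ξ, η)).1 = Complex.exp (Complex.I * l * ξ)
    + (1 / 2) * ∫ y in Set.Iic η, q (ξ, y) * (φ (ξ, y)).2
  eq₂ : ∀ ξ η, (φ (ξ, η)).2 =
    -((σ : ℂ) / 2) * ∫ x in Set.Ioi ξ, starRingEnd ℂ (q (x, η)) * (φ (x, η)).1

/-- The bilinear form `(χ, μ)_f = ∬ (χ₁ μ₁ σ f̄ + χ₂ μ₂ f) dξ dη`. -/
def pairing (σ : ℝ) (f : ℝ × ℝ → ℂ) (χ μ : ℝ × ℝ → ℂ × ℂ) : ℂ :=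
  ∫ p, ((χ p).1 * (μ p).1 * (σ : ℂ) * starRingEnd ℂ (f p) + (χ p).2 * (μ p).2 * f p)

/-- The spectral coefficient `f̂(k, l) = (1/4π) (ψ(k), φ(l))_f`. -/
def hat (σ : ℝ) (ψ φ : ℝ → ℝ × ℝ → ℂ × ℂ) (f : ℝ × ℝ → ℂ) : ℝ × ℝ → ℂ :=
  fun κ => (1 / (4 * Real.pi) : ℂ) * pairing σ f (ψ κ.1) (φ κ.2)

/-- The convolution kernel `-(i/2π) ∫ u(x) exp(ikx) dx` of a boundary value `u`. -/
def kernel (u : ℝ → ℝ) (k : ℝ) : ℂ :=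
  -(Complex.I / (2 * Real.pi)) * ∫ x : ℝ, (u x : ℂ) * Complex.exp (Complex.I * k * x)

/-- `g̃(ξ, η) = (1/2π) ∬ g(k, l) exp(-ikη - ilξ) dk dl`. The kernel is symmetric under
`(ξ, η) ↔ (k, l)`, so the same formula is the transposed transform. -/
def tilde (g : ℝ × ℝ → ℂ) : ℝ × ℝ → ℂ :=
  fun p => (1 / (2 * Real.pi) : ℂ) *
    ∫ κ : ℝ × ℝ, g κ * Complex.exp (-(Complex.I * κ.1 * p.2) - Complex.I * κ.2 * p.1)

/-- The distribution `g̃` (for bounded `g`) applied to the test function `θ`: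
`⟨g̃, θ⟩ = ∬ g θ̃ dk dl`. -/
def tildeDistr (g θ : ℝ × ℝ → ℂ) : ℂ := ∫ κ, g κ * tilde θ κ

end DS1

end

open MeasureTheory Filter Topology
open scoped ENNReal FourierTransform

noncomputable section

namespace DS1

/-! ### The mean value inequality in `L¹` -/

/-! Products of solutions of the Lax pair diagonalise the linearized flow, up to the boundary values
`u₁`, `u₂`.

Integrated, the Dirac problem reads ψ₁ = e^{ikη} + Aψ₂, ψ₂ = Bψ₁, where A integrates over ξ' < ξ and
B over η' > η. The Volterra structure in ξ makes 1 − AB invertible on bounded continuous functions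
without any smallness of Q (`isUnit_one_sub_volterra`), which gives existence and uniqueness. The
operators A and B are additive in Q, with norms controlled by the supremum `lineNorm` of the L¹
norms along coordinate lines. So a family of potentials that is differentiable in that norm has a
differentiable family of solutions (`LineFamily.exists_hasDerivWithinAt`). For the translates of Q
this yields the derivatives of ψ in ξ and η, for t ↦ Q(t) the derivative in t. Exchanging ξ with η
and Q with −Q turns φ into ψ, so only ψ has to be studied.

The second Lax equation (`IsSolution.exists_hasDerivWithinAt_psi`) is ∂_tψ₁ = i(∂_η²ψ₁ + G₁ψ₁ +
½Q∂_ξψ₂ − ½Q_ξψ₂) + ik²ψ₁ + ∫χ(k')ψ₁(k − k')dk', with a similar line for ψ₂. Its right-hand side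
solves the Dirac system differentiated in t: the differential equations hold by computation, and as
ξ → −∞ the field G₁ leaves iu₁(η)e^{ikη}, which the superposition cancels because ∫χ(k')e^{−ik'η}dk'
= −iu₁(η) by Fourier inversion. Uniqueness identifies it with ∂_tψ₁. The superposition is the origin
of the convolutions in the evolution of Û.

Differentiate the pairing of σψ₁φ₁ with Ū and of ψ₂φ₂ with U by the product rule, and insert the
equations for ψ, φ and U. Apart from i(k² + l²) times the density, the superpositions and the
density of F, the integrand is the divergence of a flux. The flux vanishes at infinity: U and its
gradient decay, V₁ tends to 0 at ξ = −∞, and φ₂ tends to 0 at ξ = +∞ (`integral_fluxDeriv`,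
`IsLinearizedSolution.hasDerivWithinAt_specHat`).

Under the Fourier transform, −(k² + l²) becomes the Laplacian and convolution with χ becomes
multiplication by −iu₁. In the weak form the decay comes from the transform of a Schwartz function,
since Û is bounded uniformly in k, l and t; in the pointwise form it comes from the assumed majorant
(`SpectralEvolution.hasDerivWithinAt_tildeDistr`, `SpectralEvolution.hasDerivWithinAt_tilde`).

Spectral functions are kept in two forms: as functions of k as well, where they are superposed over
k or bounded uniformly in k, and at fixed k, where they are differentiated in space, because the
η-derivative of e^{ikη} is not bounded in k. -/

theorem enorm_sub_le_lintegral_of_hasDerivWithinAt {f f' : ℝ → ℂ} {a b : ℝ} (hab : a ≤ b)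
    (h : ∀ r ∈ Set.Icc a b, HasDerivWithinAt f (f' r) (Set.Icc a b) r) :
    ‖f b - f a‖ₑ ≤ ∫⁻ r in Set.Ioo a b, ‖f' r‖ₑ := by
  -- If the right-hand side is finite, `f'` is integrable: it agrees with `deriv f` on the open
  -- interval and is therefore measurable there.
  by_cases hfin : ∫⁻ r in Set.Ioo a b, ‖f' r‖ₑ = ∞
  · rw [hfin]; exact le_top
  have hd : ∀ r ∈ Set.Ioo a b, HasDerivAt f (f' r) r := fun r hr =>
    (h r (Set.Ioo_subset_Icc_self hr)).hasDerivAt (Icc_mem_nhds hr.1 hr.2)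
  have hmeas : AEStronglyMeasurable f' (volume.restrict (Set.Ioo a b)) := by
    refine (aestronglyMeasurable_deriv f _).congr ?_
    filter_upwards [ae_restrict_mem measurableSet_Ioo] with r hr using (hd r hr).deriv
  have hint : IntegrableOn f' (Set.Ioo a b) := ⟨hmeas, lt_top_iff_ne_top.2 hfin⟩
  have hii : IntervalIntegrable f' volume a b :=
    (intervalIntegrable_iff_integrableOn_Ioo_of_le hab).2 hint
  rw [← intervalIntegral.integral_eq_sub_of_hasDeriv_right_of_le hab
    (fun r hr => (h r hr).continuousWithinAt) (fun r hr => (hd r hr).hasDerivWithinAt) hii,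
    intervalIntegral.integral_of_le hab, integral_Ioc_eq_integral_Ioo]
  exact enorm_integral_le_lintegral_enorm _

/-- The fundamental theorem of calculus for each `x`, followed by Tonelli. The joint measurability
of `f'`, which Tonelli needs, is not a hypothesis and has to be derived. -/
theorem lintegral_enorm_sub_le_of_le {α : Type*} [MeasurableSpace α] {μ : Measure α} [SFinite μ]
    {f f' : ℝ → α → ℂ} {a b : ℝ} (hab : a ≤ b) (hm : ∀ r ∈ Set.Icc a b, Measurable (f r))
    (h : ∀ r ∈ Set.Icc a b, ∀ x,
      HasDerivWithinAt (fun s => f s x) (f' r x) (Set.Icc a b) r)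
    {C : ℝ≥0∞} (hC : ∀ r ∈ Set.Icc a b, ∫⁻ x, ‖f' r x‖ₑ ∂μ ≤ C) :
    ∫⁻ x, ‖f b x - f a x‖ₑ ∂μ ≤ C * ENNReal.ofReal (b - a) := by
  have hmeas : AEStronglyMeasurable (Function.uncurry f')
      ((volume.restrict (Set.Ioo a b)).prod μ) := by
    -- Clamping `r` to the interval makes `f` continuous in `r` on the whole line. Continuity in `r`
    -- and measurability in `x` give joint measurability, which passes to `f'` as a limit of
    -- difference quotients.
    let g : ℝ → α → ℂ := fun r x => f (Set.projIcc a b hab r) x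
    have hg : StronglyMeasurable (Function.uncurry g) := by
      refine stronglyMeasurable_uncurry_of_continuous_of_stronglyMeasurable (fun x => ?_)
        (fun r => (hm _ (Set.projIcc a b hab r).2).stronglyMeasurable)
      have hc : ContinuousOn (fun s => f s x) (Set.Icc a b) := fun r hr =>
        (h r hr x).continuousWithinAt
      exact (continuousOn_iff_continuous_domRestrict.1 hc).comp (continuous_projIcc (h := hab))
    let u : ℕ → ℝ × α → ℂ := fun n p =>
      ((n : ℝ) + 1) • (Function.uncurry g (p.1 + ((n : ℝ) + 1)⁻¹, p.2) - Function.uncurry g p)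
    have hu : ∀ n, StronglyMeasurable (u n) := fun n => by
      have h1 : StronglyMeasurable
          fun p : ℝ × α => Function.uncurry g (p.1 + ((n : ℝ) + 1)⁻¹, p.2) :=
        hg.comp_measurable (by fun_prop)
      exact (h1.sub hg).const_smul ((n : ℝ) + 1)
    refine aestronglyMeasurable_of_tendsto_ae (u := atTop) (f := u)
      (fun n => (hu n).aestronglyMeasurable) ?_
    have hmem : ∀ᵐ p ∂((volume.restrict (Set.Ioo a b)).prod μ), p.1 ∈ Set.Ioo a b :=
      Measure.quasiMeasurePreserving_fst.ae (ae_restrict_mem measurableSet_Ioo)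
    filter_upwards [hmem] with p hp
    have hd : HasDerivAt (fun s => f s p.2) (f' p.1 p.2) p.1 :=
      (h p.1 (Set.Ioo_subset_Icc_self hp) p.2).hasDerivAt (Icc_mem_nhds hp.1 hp.2)
    have hd' : HasDerivAt (fun s => g s p.2) (f' p.1 p.2) p.1 := by
      refine hd.congr_of_eventuallyEq ?_
      filter_upwards [Icc_mem_nhds hp.1 hp.2] with s hs
      simp only [g, Set.projIcc_of_mem hab hs]
    have hlim : Tendsto (fun n : ℕ => ((n : ℝ) + 1)⁻¹) atTop (𝓝[≠] 0) := by
      refine tendsto_nhdsWithin_iff.2 ⟨?_, Eventually.of_forall fun n => ?_⟩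
      · simpa [one_div] using tendsto_one_div_add_atTop_nhds_zero_nat (𝕜 := ℝ)
      · simp only [Set.mem_compl_iff, Set.mem_singleton_iff]; positivity
    have := (hasDerivAt_iff_tendsto_slope_zero.1 hd').comp hlim
    refine this.congr fun n => ?_
    simp [u, Function.uncurry, Function.comp]
  calc ∫⁻ x, ‖f b x - f a x‖ₑ ∂μ
      ≤ ∫⁻ x, (∫⁻ r in Set.Ioo a b, ‖f' r x‖ₑ) ∂μ := lintegral_mono fun x =>
        enorm_sub_le_lintegral_of_hasDerivWithinAt (f := fun s => f s x)
          (f' := fun s => f' s x) hab (fun r hr => h r hr x)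
    _ = ∫⁻ r in Set.Ioo a b, ∫⁻ x, ‖f' r x‖ₑ ∂μ :=
        (lintegral_lintegral_swap (f := fun r x => ‖f' r x‖ₑ) hmeas.enorm).symm
    _ ≤ ∫⁻ r in Set.Ioo a b, C := setLIntegral_mono' measurableSet_Ioo fun r hr =>
        hC r (Set.Ioo_subset_Icc_self hr)
    _ = C * ENNReal.ofReal (b - a) := by simp

theorem lintegral_enorm_sub_le {α : Type*} [MeasurableSpace α] {μ : Measure α} [SFinite μ]
    {f f' : ℝ → α → ℂ} {S : Set ℝ} {a b : ℝ} (hS : Set.uIcc a b ⊆ S)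
    (hm : ∀ r ∈ S, Measurable (f r))
    (h : ∀ r ∈ S, ∀ x, HasDerivWithinAt (fun s => f s x) (f' r x) S r)
    {C : ℝ≥0∞} (hC : ∀ r ∈ Set.uIcc a b, ∫⁻ x, ‖f' r x‖ₑ ∂μ ≤ C) :
    ∫⁻ x, ‖f b x - f a x‖ₑ ∂μ ≤ C * ENNReal.ofReal |b - a| := by
  rcases le_total a b with hab | hab
  · rw [Set.uIcc_of_le hab] at hS hC
    rw [abs_of_nonneg (sub_nonneg.2 hab)]
    exact lintegral_enorm_sub_le_of_le hab (fun r hr => hm r (hS hr))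
      (fun r hr x => (h r (hS hr) x).mono hS) hC
  · rw [Set.uIcc_of_ge hab] at hS hC
    rw [abs_sub_comm, abs_of_nonneg (sub_nonneg.2 hab)]
    simp_rw [enorm_sub_rev (f b _)]
    exact lintegral_enorm_sub_le_of_le hab (fun r hr => hm r (hS hr))
      (fun r hr x => (h r (hS hr) x).mono hS) hC

/-- A family of functions that is differentiable pointwise, with a derivative that is continuous
at `t` in `L¹`, is differentiable at `t` in `L¹`. -/
theorem lintegral_enorm_sub_sub_smul_le {α : Type*} [MeasurableSpace α] {μ : Measure α} [SFinite μ]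
    {f f' : ℝ → α → ℂ} {S : Set ℝ} {t s : ℝ} (hS : Set.uIcc t s ⊆ S)
    (hm : ∀ r ∈ S, Measurable (f r)) (hm' : Measurable (f' t))
    (h : ∀ r ∈ S, ∀ x, HasDerivWithinAt (fun s => f s x) (f' r x) S r)
    {C : ℝ≥0∞} (hC : ∀ r ∈ Set.uIcc t s, ∫⁻ x, ‖f' r x - f' t x‖ₑ ∂μ ≤ C) :
    ∫⁻ x, ‖f s x - f t x - (s - t) • f' t x‖ₑ ∂μ ≤ C * ENNReal.ofReal |s - t| := by
  -- The mean value inequality is applied after subtracting the linear function with slope `f' t`.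
  have := lintegral_enorm_sub_le (μ := μ) (f := fun r x => f r x - r • f' t x)
    (f' := fun r x => f' r x - f' t x) hS (fun r hr => (hm r hr).sub (hm'.const_smul r))
    (fun r hr x => by
      simpa using (h r hr x).fun_sub ((hasDerivWithinAt_id r S).smul_const (f' t x))) hC
  refine le_trans (le_of_eq (lintegral_congr fun x => ?_)) this
  congr 1
  rw [sub_smul]; abel

/-! ### Partial derivatives -/

section Partial

variable {f : ℝ × ℝ → ℂ}

theorem hasDerivAt_fst_of_hasFDerivAt {L : ℝ × ℝ →L[ℝ] ℂ} {x y : ℝ} (h : HasFDerivAt f L (x, y)) :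
    HasDerivAt (fun s => f (s, y)) (L (1, 0)) x := by
  have : HasDerivAt (fun s : ℝ => (s, y)) ((1 : ℝ), (0 : ℝ)) x :=
    (hasDerivAt_id x).prodMk (hasDerivAt_const x y)
  exact h.comp_hasDerivAt x this

theorem hasDerivAt_snd_of_hasFDerivAt {L : ℝ × ℝ →L[ℝ] ℂ} {x y : ℝ} (h : HasFDerivAt f L (x, y)) :
    HasDerivAt (fun s => f (x, s)) (L (0, 1)) y := by
  have : HasDerivAt (fun s : ℝ => (x, s)) ((0 : ℝ), (1 : ℝ)) y :=
    (hasDerivAt_const y x).prodMk (hasDerivAt_id y)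
  exact h.comp_hasDerivAt y this

theorem dXi_eq_fderiv (hf : Differentiable ℝ f) : dXi f = fun p => fderiv ℝ f p (1, 0) := by
  funext p
  exact (hasDerivAt_fst_of_hasFDerivAt (hf p).hasFDerivAt).deriv

theorem dEta_eq_fderiv (hf : Differentiable ℝ f) : dEta f = fun p => fderiv ℝ f p (0, 1) := by
  funext p
  exact (hasDerivAt_snd_of_hasFDerivAt (hf p).hasFDerivAt).deriv

theorem differentiable_of_contDiff_succ {n : ℕ} (hf : ContDiff ℝ ((n + 1 : ℕ) : ℕ∞) f) :
    Differentiable ℝ f := hf.differentiable (by simp)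

theorem hasDerivAt_dXi (hf : Differentiable ℝ f) (x y : ℝ) :
    HasDerivAt (fun s => f (s, y)) (dXi f (x, y)) x :=
  (hasDerivAt_fst_of_hasFDerivAt (hf (x, y)).hasFDerivAt).differentiableAt.hasDerivAt

theorem hasDerivAt_dEta (hf : Differentiable ℝ f) (x y : ℝ) :
    HasDerivAt (fun s => f (x, s)) (dEta f (x, y)) y :=
  (hasDerivAt_snd_of_hasFDerivAt (hf (x, y)).hasFDerivAt).differentiableAt.hasDerivAt

theorem contDiff_dXi {n : ℕ} (hf : ContDiff ℝ ((n + 1 : ℕ) : ℕ∞) f) :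
    ContDiff ℝ ((n : ℕ) : ℕ∞) (dXi f) := by
  rw [dXi_eq_fderiv (differentiable_of_contDiff_succ hf)]
  exact (hf.fderiv_right (m := ((n : ℕ) : ℕ∞)) (by norm_cast)).clm_apply contDiff_const

theorem contDiff_dEta {n : ℕ} (hf : ContDiff ℝ ((n + 1 : ℕ) : ℕ∞) f) :
    ContDiff ℝ ((n : ℕ) : ℕ∞) (dEta f) := by
  rw [dEta_eq_fderiv (differentiable_of_contDiff_succ hf)]
  exact (hf.fderiv_right (m := ((n : ℕ) : ℕ∞)) (by norm_cast)).clm_apply contDiff_const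

theorem dEta_dXi_comm (hf : ContDiff ℝ ((2 : ℕ) : ℕ∞) f) : dEta (dXi f) = dXi (dEta f) := by
  have h1 := differentiable_of_contDiff_succ hf
  have hd : Differentiable ℝ (fderiv ℝ f) :=
    (hf.fderiv_right (m := ((1 : ℕ) : ℕ∞)) (by norm_cast)).differentiable (by simp)
  funext p
  have hsymm : IsSymmSndFDerivAt ℝ f p := hf.contDiffAt.isSymmSndFDerivAt (by simp)
  have e1 : dEta (dXi f) p = fderiv ℝ (fderiv ℝ f) p (0, 1) (1, 0) := by
    rw [dXi_eq_fderiv h1]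
    have := (hd p).hasFDerivAt.clm_apply (hasFDerivAt_const ((1 : ℝ), (0 : ℝ)) p)
    rw [show dEta (fun p => fderiv ℝ f p (1, 0)) p = _ from
      (hasDerivAt_snd_of_hasFDerivAt (x := p.1) (y := p.2) this).deriv]
    simp
  have e2 : dXi (dEta f) p = fderiv ℝ (fderiv ℝ f) p (1, 0) (0, 1) := by
    rw [dEta_eq_fderiv h1]
    have := (hd p).hasFDerivAt.clm_apply (hasFDerivAt_const ((0 : ℝ), (1 : ℝ)) p)
    rw [show dXi (fun p => fderiv ℝ f p (0, 1)) p = _ from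
      (hasDerivAt_fst_of_hasFDerivAt (x := p.1) (y := p.2) this).deriv]
    simp
  rw [e1, e2, hsymm.eq]

theorem iterate_dEta_dXi (b : ℕ) : ∀ {f : ℝ × ℝ → ℂ}, ContDiff ℝ ((b + 1 : ℕ) : ℕ∞) f →
    dEta^[b] (dXi f) = dXi (dEta^[b] f) := by
  induction b with
  | zero => intro f _; rfl
  | succ b ih =>
    intro f hf
    rw [Function.iterate_succ_apply, dEta_dXi_comm (hf.of_le (by norm_cast; omega)),
      ih (contDiff_dEta hf), Function.iterate_succ_apply]

theorem iterate_dEta_iterate_dXi (b : ℕ) (a : ℕ) : ∀ {f : ℝ × ℝ → ℂ},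
    ContDiff ℝ ((a + b : ℕ) : ℕ∞) f → dEta^[b] (dXi^[a] f) = dXi^[a] (dEta^[b] f) := by
  induction a with
  | zero => intro f _; rfl
  | succ a ih =>
    intro f hf
    rw [Function.iterate_succ_apply, ih (contDiff_dXi (hf.of_le (by norm_cast; omega))),
      iterate_dEta_dXi b (hf.of_le (by norm_cast; omega)), Function.iterate_succ_apply]

theorem dMulti_dXi {a b : ℕ} (hf : ContDiff ℝ ((b + 1 : ℕ) : ℕ∞) f) :
    dMulti a b (dXi f) = dMulti (a + 1) b f := by
  unfold dMulti
  rw [iterate_dEta_dXi b hf, Function.iterate_succ_apply]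

theorem dMulti_dEta {a b : ℕ} : dMulti a b (dEta f) = dMulti a (b + 1) f := by
  unfold dMulti
  rw [Function.iterate_succ_apply]

theorem dXi_comp_swap (f : ℝ × ℝ → ℂ) : dXi (fun p => f p.swap) = fun p => dEta f p.swap := rfl

theorem dEta_comp_swap (f : ℝ × ℝ → ℂ) : dEta (fun p => f p.swap) = fun p => dXi f p.swap := rfl

theorem dXi_neg (f : ℝ × ℝ → ℂ) : dXi (fun p => -f p) = fun p => -dXi f p := by
  funext p; exact deriv.fun_neg

theorem dEta_neg (f : ℝ × ℝ → ℂ) : dEta (fun p => -f p) = fun p => -dEta f p := by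
  funext p; exact deriv.fun_neg

/-- The swap exchanges the two partial derivatives, so they come out in the order opposite to that
of `dMulti`; the smoothness is needed to commute them. -/
theorem dMulti_neg_swap {a b : ℕ} (hf : ContDiff ℝ ((a + b : ℕ) : ℕ∞) f) :
    dMulti a b (fun p => -f p.swap) = fun p => -dMulti b a f p.swap := by
  have h1 : ∀ (n : ℕ) (g : ℝ × ℝ → ℂ),
      dEta^[n] (fun p => -g p.swap) = fun p => -(dXi^[n] g) p.swap := by
    intro n
    induction n with
    | zero => intro g; rfl
    | succ n ih =>
      intro g
      rw [Function.iterate_succ_apply, dEta_neg, dEta_comp_swap, ih, Function.iterate_succ_apply]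
  have h2 : ∀ (n : ℕ) (g : ℝ × ℝ → ℂ),
      dXi^[n] (fun p => -g p.swap) = fun p => -(dEta^[n] g) p.swap := by
    intro n
    induction n with
    | zero => intro g; rfl
    | succ n ih =>
      intro g
      rw [Function.iterate_succ_apply, dXi_neg, dXi_comp_swap, ih, Function.iterate_succ_apply]
  unfold dMulti
  rw [h1, h2, iterate_dEta_iterate_dXi a b (hf.of_le (by norm_cast; omega))]

end Partial

/-! ### Regularity classes and their stability under derivatives and the symmetry -/

/-- `f` is `C^(n+1)` and its partial derivatives of order at most `n` are integrable. -/
structure SobolevReg (n : ℕ) (f : ℝ × ℝ → ℂ) : Prop where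
  contDiff : ContDiff ℝ ((n + 1 : ℕ) : ℕ∞) f
  integrable : ∀ a b : ℕ, a + b ≤ n → Integrable (dMulti a b f)

namespace SobolevReg

variable {n : ℕ} {f : ℝ × ℝ → ℂ}

theorem differentiable (h : SobolevReg n f) : Differentiable ℝ f :=
  differentiable_of_contDiff_succ h.contDiff

theorem continuous (h : SobolevReg n f) : Continuous f := h.contDiff.continuous

theorem integrable_self (h : SobolevReg n f) : Integrable f := h.integrable 0 0 (by omega)

theorem mono {m : ℕ} (h : SobolevReg n f) (hm : m ≤ n) : SobolevReg m f :=
  ⟨h.contDiff.of_le (by norm_cast; omega), fun a b hab => h.integrable a b (hab.trans hm)⟩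

theorem dXi (h : SobolevReg (n + 1) f) : SobolevReg n (dXi f) :=
  ⟨contDiff_dXi h.contDiff, fun a b hab => by
    rw [dMulti_dXi (h.contDiff.of_le (by norm_cast; omega))]
    exact h.integrable _ _ (by omega)⟩

theorem dEta (h : SobolevReg (n + 1) f) : SobolevReg n (dEta f) :=
  ⟨contDiff_dEta h.contDiff, fun a b hab => by
    rw [dMulti_dEta]; exact h.integrable _ _ (by omega)⟩

end SobolevReg

namespace RegularOn

variable {n : ℕ} {T : ℝ} {f : ℝ → ℝ × ℝ → ℂ}

theorem sobolevReg (h : RegularOn n T f) {t : ℝ} (ht : t ∈ Set.Icc 0 T) : SobolevReg n (f t) :=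
  ⟨h.contDiff t ht, h.integrable t ht⟩

theorem mono {m : ℕ} (h : RegularOn n T f) (hm : m ≤ n) : RegularOn m T f :=
  ⟨fun _ ht => ((h.sobolevReg ht).mono hm).contDiff,
    fun _ ht => ((h.sobolevReg ht).mono hm).integrable,
    fun t ht a b hab => h.continuous_L1 t ht a b (hab.trans hm)⟩

theorem dXi (h : RegularOn (n + 1) T f) : RegularOn n T (fun t => dXi (f t)) :=
  ⟨fun _ ht => (h.sobolevReg ht).dXi.contDiff, fun _ ht => (h.sobolevReg ht).dXi.integrable,
    fun t ht a b hab => by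
      refine (h.continuous_L1 t ht (a + 1) b (by omega)).congr' ?_
      filter_upwards [self_mem_nhdsWithin] with s hs
      rw [dMulti_dXi ((h.contDiff s hs).of_le (by norm_cast; omega)),
        dMulti_dXi ((h.contDiff t ht).of_le (by norm_cast; omega))]⟩

theorem dEta (h : RegularOn (n + 1) T f) : RegularOn n T (fun t => dEta (f t)) :=
  ⟨fun _ ht => (h.sobolevReg ht).dEta.contDiff, fun _ ht => (h.sobolevReg ht).dEta.integrable,
    fun t ht a b hab => by
      refine (h.continuous_L1 t ht a (b + 1) (by omega)).congr' ?_
      filter_upwards [self_mem_nhdsWithin] with s hs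
      rw [dMulti_dEta, dMulti_dEta]⟩

theorem tendsto_lintegral (h : RegularOn n T f) {t : ℝ} (ht : t ∈ Set.Icc 0 T) :
    Tendsto (fun s => ∫⁻ p, ‖f s p - f t p‖ₑ) (𝓝[Set.Icc 0 T] t) (𝓝 0) := by
  have h0 := h.continuous_L1 t ht 0 0 (by omega)
  rw [← ENNReal.ofReal_zero]
  refine (ENNReal.tendsto_ofReal h0).congr' ?_
  filter_upwards [self_mem_nhdsWithin] with s hs
  rw [ofReal_integral_norm_eq_lintegral_enorm]
  · rfl
  · exact (h.integrable s hs 0 0 (by omega)).sub (h.integrable t ht 0 0 (by omega))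

/-- This symmetry later reduces φ, G₂ and V₂ to ψ, G₁ and V₁. -/
theorem neg_swap (h : RegularOn n T f) : RegularOn n T (fun t p => -f t p.swap) := by
  have hswap : MeasurePreserving (Prod.swap : ℝ × ℝ → ℝ × ℝ) := Measure.measurePreserving_swap
  have hE : MeasurableEmbedding (Prod.swap : ℝ × ℝ → ℝ × ℝ) :=
    MeasurableEquiv.prodComm.measurableEmbedding
  refine ⟨fun t ht => ?_, fun t ht a b hab => ?_, fun t ht a b hab => ?_⟩
  · have hs : ContDiff ℝ ((n + 1 : ℕ) : ℕ∞) (Prod.swap : ℝ × ℝ → ℝ × ℝ) :=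
      contDiff_snd.prodMk contDiff_fst
    exact ((h.contDiff t ht).comp hs).neg
  · rw [dMulti_neg_swap ((h.contDiff t ht).of_le (by norm_cast; omega))]
    exact ((hswap.integrable_comp_emb hE).2 (h.integrable t ht b a (by omega))).neg
  · refine (h.continuous_L1 t ht b a (by omega)).congr' ?_
    filter_upwards [self_mem_nhdsWithin] with s hs
    rw [dMulti_neg_swap ((h.contDiff t ht).of_le (by norm_cast; omega)),
      dMulti_neg_swap ((h.contDiff s hs).of_le (by norm_cast; omega))]
    rw [← hswap.integral_comp hE]
    refine integral_congr_ae (Eventually.of_forall fun p => ?_)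
    dsimp only
    rw [← neg_sub', norm_neg]

end RegularOn

/-! ### Integrals along lines -/

theorem tendsto_zero_atBot_of_integrable_deriv {f f' : ℝ → ℂ} (hd : ∀ x, HasDerivAt f (f' x) x)
    (hf : Integrable f) (hf' : Integrable f') : Tendsto f atBot (𝓝 0) :=
  tendsto_zero_of_hasDerivAt_of_integrableOn_Iic (a := 0) (fun x _ => hd x) hf'.integrableOn
    hf.integrableOn

theorem tendsto_zero_atTop_of_integrable_deriv {f f' : ℝ → ℂ} (hd : ∀ x, HasDerivAt f (f' x) x)
    (hf : Integrable f) (hf' : Integrable f') : Tendsto f atTop (𝓝 0) :=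
  tendsto_zero_of_hasDerivAt_of_integrableOn_Ioi (a := 0) (fun x _ => hd x) hf'.integrableOn
    hf.integrableOn

/-- An integrable function with integrable derivative vanishes at −∞, so it is the integral of its
derivative over a half-line. -/
theorem enorm_le_lintegral_enorm_deriv {f f' : ℝ → ℂ} (hd : ∀ x, HasDerivAt f (f' x) x)
    (hf : Integrable f) (hf' : Integrable f') (x : ℝ) : ‖f x‖ₑ ≤ ∫⁻ s, ‖f' s‖ₑ := by
  have h := integral_Iic_of_hasDerivAt_of_tendsto (a := x) (hd x).continuousAt.continuousWithinAt
    (fun s _ => hd s) hf'.integrableOn (tendsto_zero_atBot_of_integrable_deriv hd hf hf')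
  rw [sub_zero] at h
  rw [← h]
  exact (enorm_integral_le_lintegral_enorm _).trans (setLIntegral_le_lintegral _ _)

theorem ae_forall_enorm_le_lintegral_snd {g g' : ℝ × ℝ → ℂ}
    (hd : ∀ x y, HasDerivAt (fun s => g (x, s)) (g' (x, y)) y) (hg : Integrable g)
    (hg' : Integrable g') : ∀ᵐ x, ∀ y, ‖g (x, y)‖ₑ ≤ ∫⁻ s, ‖g' (x, s)‖ₑ := by
  filter_upwards [hg.prod_right_ae, hg'.prod_right_ae] with x h1 h2 y
  exact enorm_le_lintegral_enorm_deriv (hd x) h1 h2 y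

/-- A trace inequality. For almost every `x` the bound by the transversal integral holds for all `y`
at once; hence the conclusion holds on every line, not only on almost every one. -/
theorem lintegral_fst_le {g g' : ℝ × ℝ → ℂ}
    (hd : ∀ x y, HasDerivAt (fun s => g (x, s)) (g' (x, y)) y) (hg : Integrable g)
    (hg' : Integrable g') (y : ℝ) : ∫⁻ x, ‖g (x, y)‖ₑ ≤ ∫⁻ p, ‖g' p‖ₑ := by
  rw [Measure.volume_eq_prod, lintegral_prod _ hg'.aestronglyMeasurable.enorm]
  refine lintegral_mono_ae ?_
  filter_upwards [ae_forall_enorm_le_lintegral_snd hd hg hg'] with x hx using hx y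

/-- The integral of the transversal derivative is a majorant independent of `y`. It is what
dominated convergence uses when the line moves. -/
theorem exists_integrable_dominating_fst {g g' : ℝ × ℝ → ℂ}
    (hd : ∀ x y, HasDerivAt (fun s => g (x, s)) (g' (x, y)) y) (hg : Integrable g)
    (hg' : Integrable g') : ∃ a : ℝ → ℝ, Integrable a ∧ ∀ᵐ x, ∀ y, ‖g (x, y)‖ ≤ a x := by
  refine ⟨fun x => ∫ y, ‖g' (x, y)‖, hg'.integral_norm_prod_left, ?_⟩
  filter_upwards [ae_forall_enorm_le_lintegral_snd hd hg hg', hg'.prod_right_ae] with x hx h2 y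
  rw [← ENNReal.ofReal_le_ofReal_iff (integral_nonneg fun _ => norm_nonneg _),
    ofReal_integral_norm_eq_lintegral_enorm h2, ofReal_norm]
  exact hx y

theorem lintegral_comp_swap (g : ℝ × ℝ → ℝ≥0∞) : ∫⁻ p : ℝ × ℝ, g p.swap = ∫⁻ p, g p :=
  (Measure.measurePreserving_swap (μ := (volume : Measure ℝ)) (ν := (volume : Measure ℝ))).lintegral_comp_emb
    MeasurableEquiv.prodComm.measurableEmbedding g

/-! ### Potentials controlled along coordinate lines -/

/-- Continuous functions that are dominated, in either variable, by an integrable function of that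
variable alone. -/
structure LineDominated (q : ℝ × ℝ → ℂ) : Prop where
  continuous : Continuous q
  dom_fst : ∃ a : ℝ → ℝ, Integrable a ∧ ∀ᵐ x, ∀ y, ‖q (x, y)‖ ≤ a x
  dom_snd : ∃ b : ℝ → ℝ, Integrable b ∧ ∀ᵐ y, ∀ x, ‖q (x, y)‖ ≤ b y

/-- The supremum of the `L¹` norms along the coordinate lines. -/
def lineNorm (q : ℝ × ℝ → ℂ) : ℝ≥0∞ :=
  (⨆ y, ∫⁻ x, ‖q (x, y)‖ₑ) ⊔ (⨆ x, ∫⁻ y, ‖q (x, y)‖ₑ)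

theorem lineNorm_le_iff {q : ℝ × ℝ → ℂ} {C : ℝ≥0∞} : lineNorm q ≤ C ↔
    (∀ y, ∫⁻ x, ‖q (x, y)‖ₑ ≤ C) ∧ (∀ x, ∫⁻ y, ‖q (x, y)‖ₑ ≤ C) := by
  simp [lineNorm]

theorem lintegral_fst_le_lineNorm (q : ℝ × ℝ → ℂ) (y : ℝ) : ∫⁻ x, ‖q (x, y)‖ₑ ≤ lineNorm q :=
  (lineNorm_le_iff.1 le_rfl).1 y

theorem lintegral_snd_le_lineNorm (q : ℝ × ℝ → ℂ) (x : ℝ) : ∫⁻ y, ‖q (x, y)‖ₑ ≤ lineNorm q :=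
  (lineNorm_le_iff.1 le_rfl).2 x

theorem lineNorm_mono {q r : ℝ × ℝ → ℂ} (h : ∀ p, ‖q p‖ₑ ≤ ‖r p‖ₑ) : lineNorm q ≤ lineNorm r :=
  lineNorm_le_iff.2
    ⟨fun y => (lintegral_mono fun _ => h _).trans (lintegral_fst_le_lineNorm r y),
      fun x => (lintegral_mono fun _ => h _).trans (lintegral_snd_le_lineNorm r x)⟩

theorem lineNorm_congr {q r : ℝ × ℝ → ℂ} (h : ∀ p, ‖q p‖ₑ = ‖r p‖ₑ) : lineNorm q = lineNorm r :=
  le_antisymm (lineNorm_mono fun p => (h p).le) (lineNorm_mono fun p => (h p).ge)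

theorem lineNorm_add_le {q r : ℝ × ℝ → ℂ} (hq : Continuous q) :
    lineNorm (fun p => q p + r p) ≤ lineNorm q + lineNorm r := by
  refine lineNorm_le_iff.2 ⟨fun y => ?_, fun x => ?_⟩
  · calc ∫⁻ x, ‖q (x, y) + r (x, y)‖ₑ ≤ ∫⁻ x, (‖q (x, y)‖ₑ + ‖r (x, y)‖ₑ) :=
          lintegral_mono fun _ => enorm_add_le _ _
      _ = (∫⁻ x, ‖q (x, y)‖ₑ) + ∫⁻ x, ‖r (x, y)‖ₑ :=
          lintegral_add_left (hq.comp (by fun_prop)).enorm.measurable _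
      _ ≤ _ := add_le_add (lintegral_fst_le_lineNorm q y) (lintegral_fst_le_lineNorm r y)
  · calc ∫⁻ y, ‖q (x, y) + r (x, y)‖ₑ ≤ ∫⁻ y, (‖q (x, y)‖ₑ + ‖r (x, y)‖ₑ) :=
          lintegral_mono fun _ => enorm_add_le _ _
      _ = (∫⁻ y, ‖q (x, y)‖ₑ) + ∫⁻ y, ‖r (x, y)‖ₑ :=
          lintegral_add_left (hq.comp (by fun_prop)).enorm.measurable _
      _ ≤ _ := add_le_add (lintegral_snd_le_lineNorm q x) (lintegral_snd_le_lineNorm r x)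

theorem lineNorm_mul_le {g q : ℝ × ℝ → ℂ} {C : ℝ≥0∞} (hg : ∀ p, ‖g p‖ₑ ≤ C) (hq : Continuous q) :
    lineNorm (fun p => g p * q p) ≤ C * lineNorm q := by
  refine lineNorm_le_iff.2 ⟨fun y => ?_, fun x => ?_⟩
  · calc ∫⁻ x, ‖g (x, y) * q (x, y)‖ₑ ≤ ∫⁻ x, C * ‖q (x, y)‖ₑ :=
          lintegral_mono fun _ => by rw [enorm_mul]; gcongr; exact hg _
      _ = C * ∫⁻ x, ‖q (x, y)‖ₑ := lintegral_const_mul _ (hq.comp (by fun_prop)).enorm.measurable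
      _ ≤ _ := by gcongr; exact lintegral_fst_le_lineNorm q y
  · calc ∫⁻ y, ‖g (x, y) * q (x, y)‖ₑ ≤ ∫⁻ y, C * ‖q (x, y)‖ₑ :=
          lintegral_mono fun _ => by rw [enorm_mul]; gcongr; exact hg _
      _ = C * ∫⁻ y, ‖q (x, y)‖ₑ := lintegral_const_mul _ (hq.comp (by fun_prop)).enorm.measurable
      _ ≤ _ := by gcongr; exact lintegral_snd_le_lineNorm q x

/-- The trace inequality in both directions: convergence of gradients in L¹ of the plane implies
convergence in `lineNorm`. -/
theorem lineNorm_le_of_hasDerivAt {g gx gy : ℝ × ℝ → ℂ}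
    (hx : ∀ x y, HasDerivAt (fun s => g (s, y)) (gx (x, y)) x)
    (hy : ∀ x y, HasDerivAt (fun s => g (x, s)) (gy (x, y)) y)
    (hg : Integrable g) (hgx : Integrable gx) (hgy : Integrable gy) :
    lineNorm g ≤ (∫⁻ p, ‖gx p‖ₑ) + ∫⁻ p, ‖gy p‖ₑ := by
  refine lineNorm_le_iff.2 ⟨fun y => ?_, fun x => ?_⟩
  · exact (lintegral_fst_le hy hg hgy y).trans le_add_self
  · refine le_trans ?_ le_self_add
    rw [← lintegral_comp_swap fun p => ‖gx p‖ₑ]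
    exact lintegral_fst_le (g := fun p => g p.swap) (g' := fun p => gx p.swap)
      (fun a b => hx b a) hg.swap hgx.swap x

/-- The reflection `(x, y) ↦ (-y, -x)`, which interchanges the two families of half-lines
`(-∞, x] × {y}` and `{x} × [y, ∞)`. -/
def reflect (p : ℝ × ℝ) : ℝ × ℝ := (-p.2, -p.1)

theorem continuous_reflect : Continuous reflect := by unfold reflect; fun_prop

@[simp] theorem reflect_mk (x y : ℝ) : reflect (x, y) = (-y, -x) := rfl

theorem lintegral_comp_neg (f : ℝ → ℝ≥0∞) : ∫⁻ x : ℝ, f (-x) = ∫⁻ x, f x :=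
  (Measure.measurePreserving_neg (volume : Measure ℝ)).lintegral_comp_emb
    (MeasurableEquiv.neg ℝ).measurableEmbedding f

theorem lineNorm_comp_reflect_le (q : ℝ × ℝ → ℂ) :
    lineNorm (fun p => q (reflect p)) ≤ lineNorm q := by
  refine lineNorm_le_iff.2 ⟨fun y => ?_, fun x => ?_⟩
  · rw [show ∫⁻ x, ‖q (reflect (x, y))‖ₑ = ∫⁻ x, ‖q (-y, x)‖ₑ from
      lintegral_comp_neg fun x => ‖q (-y, x)‖ₑ]
    exact lintegral_snd_le_lineNorm q _
  · rw [show ∫⁻ y, ‖q (reflect (x, y))‖ₑ = ∫⁻ y, ‖q (y, -x)‖ₑ from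
      lintegral_comp_neg fun y => ‖q (y, -x)‖ₑ]
    exact lintegral_fst_le_lineNorm q _

namespace LineDominated

variable {q r : ℝ × ℝ → ℂ}

theorem integrable_fst (h : LineDominated q) (y : ℝ) : Integrable (fun x => q (x, y)) := by
  obtain ⟨a, ha, hd⟩ := h.dom_fst
  refine ha.mono' (h.continuous.comp (by fun_prop)).aestronglyMeasurable ?_
  filter_upwards [hd] with x hx using hx y

theorem integrable_snd (h : LineDominated q) (x : ℝ) : Integrable (fun y => q (x, y)) := by
  obtain ⟨a, ha, hd⟩ := h.dom_snd
  refine ha.mono' (h.continuous.comp (by fun_prop)).aestronglyMeasurable ?_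
  filter_upwards [hd] with y hy using hy x

theorem lineNorm_ne_top (h : LineDominated q) : lineNorm q ≠ ∞ := by
  obtain ⟨a, ha, hda⟩ := h.dom_fst
  obtain ⟨b, hb, hdb⟩ := h.dom_snd
  refine ne_top_of_le_ne_top (ENNReal.add_ne_top.2
    ⟨ha.hasFiniteIntegral.ne, hb.hasFiniteIntegral.ne⟩) (lineNorm_le_iff.2 ⟨fun y => ?_, fun x => ?_⟩)
  · refine le_trans (lintegral_mono_ae ?_) le_self_add
    filter_upwards [hda] with x hx
    exact enorm_le_iff_norm_le.2 ((hx y).trans (le_abs_self _))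
  · refine le_trans (lintegral_mono_ae ?_) le_add_self
    filter_upwards [hdb] with y hy
    exact enorm_le_iff_norm_le.2 ((hy x).trans (le_abs_self _))

theorem add (hq : LineDominated q) (hr : LineDominated r) :
    LineDominated (fun p => q p + r p) := by
  obtain ⟨a, ha, hda⟩ := hq.dom_fst
  obtain ⟨b, hb, hdb⟩ := hq.dom_snd
  obtain ⟨a', ha', hda'⟩ := hr.dom_fst
  obtain ⟨b', hb', hdb'⟩ := hr.dom_snd
  refine ⟨hq.continuous.add hr.continuous, ⟨_, ha.add ha', ?_⟩, ⟨_, hb.add hb', ?_⟩⟩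
  · filter_upwards [hda, hda'] with x h1 h2 y
    exact (norm_add_le _ _).trans (add_le_add (h1 y) (h2 y))
  · filter_upwards [hdb, hdb'] with y h1 h2 x
    exact (norm_add_le _ _).trans (add_le_add (h1 x) (h2 x))

theorem bounded_mul {g : ℝ × ℝ → ℂ} (hq : LineDominated q) (hg : Continuous g) {C : ℝ}
    (hC : ∀ p, ‖g p‖ ≤ C) : LineDominated (fun p => g p * q p) := by
  obtain ⟨a, ha, hda⟩ := hq.dom_fst
  obtain ⟨b, hb, hdb⟩ := hq.dom_snd
  have hC0 : 0 ≤ C := (norm_nonneg _).trans (hC 0)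
  refine ⟨hg.mul hq.continuous, ⟨_, ha.const_mul C, ?_⟩, ⟨_, hb.const_mul C, ?_⟩⟩
  · filter_upwards [hda] with x h1 y
    rw [norm_mul]; exact mul_le_mul (hC _) (h1 y) (norm_nonneg _) hC0
  · filter_upwards [hdb] with y h1 x
    rw [norm_mul]; exact mul_le_mul (hC _) (h1 x) (norm_nonneg _) hC0

theorem const_mul (hq : LineDominated q) (c : ℂ) : LineDominated (fun p => c * q p) :=
  hq.bounded_mul continuous_const (C := ‖c‖) fun _ => le_rfl

theorem neg (hq : LineDominated q) : LineDominated (fun p => -q p) := by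
  simpa using hq.const_mul (-1)

theorem sub (hq : LineDominated q) (hr : LineDominated r) :
    LineDominated (fun p => q p - r p) := by
  simpa [sub_eq_add_neg] using hq.add hr.neg

theorem conj (hq : LineDominated q) : LineDominated (fun p => starRingEnd ℂ (q p)) := by
  obtain ⟨a, ha, hda⟩ := hq.dom_fst
  obtain ⟨b, hb, hdb⟩ := hq.dom_snd
  exact ⟨Complex.continuous_conj.comp hq.continuous,
    ⟨a, ha, by simpa only [RCLike.norm_conj] using hda⟩,
    ⟨b, hb, by simpa only [RCLike.norm_conj] using hdb⟩⟩

theorem comp_reflect (hq : LineDominated q) : LineDominated (fun p => q (reflect p)) := by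
  obtain ⟨a, ha, hda⟩ := hq.dom_fst
  obtain ⟨b, hb, hdb⟩ := hq.dom_snd
  have hneg := (Measure.measurePreserving_neg (volume : Measure ℝ)).quasiMeasurePreserving
  refine ⟨hq.continuous.comp continuous_reflect, ⟨_, hb.comp_neg, ?_⟩, ⟨_, ha.comp_neg, ?_⟩⟩
  · filter_upwards [hneg.ae hdb] with x hx y using hx _
  · filter_upwards [hneg.ae hda] with x hx y using hx _

theorem comp_add (hq : LineDominated q) (v : ℝ × ℝ) : LineDominated (fun p => q (p + v)) := by
  obtain ⟨a, ha, hda⟩ := hq.dom_fst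
  obtain ⟨b, hb, hdb⟩ := hq.dom_snd
  have htr := fun c : ℝ =>
    (measurePreserving_add_right (volume : Measure ℝ) c).quasiMeasurePreserving
  refine ⟨hq.continuous.comp (by fun_prop), ⟨_, ha.comp_add_right v.1, ?_⟩,
    ⟨_, hb.comp_add_right v.2, ?_⟩⟩
  · filter_upwards [(htr v.1).ae hda] with x hx y using hx _
  · filter_upwards [(htr v.2).ae hdb] with x hx y using hx _

theorem of_hasDerivAt {g gx gy : ℝ × ℝ → ℂ} (hc : Continuous g)
    (hx : ∀ x y, HasDerivAt (fun s => g (s, y)) (gx (x, y)) x)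
    (hy : ∀ x y, HasDerivAt (fun s => g (x, s)) (gy (x, y)) y)
    (hg : Integrable g) (hgx : Integrable gx) (hgy : Integrable gy) : LineDominated g :=
  ⟨hc, exists_integrable_dominating_fst hy hg hgy,
    exists_integrable_dominating_fst (g := fun p => g p.swap) (g' := fun p => gx p.swap)
      (fun a b => hx b a) hg.swap hgx.swap⟩

end LineDominated

/-- Integrate along the line through `p`, then apply the trace inequality to the derivative. The
mixed second derivative alone controls the supremum. -/
theorem enorm_le_lintegral_mixed {g gx gy gxy : ℝ × ℝ → ℂ}
    (hx : ∀ x y, HasDerivAt (fun s => g (s, y)) (gx (x, y)) x)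
    (hy : ∀ x y, HasDerivAt (fun s => g (x, s)) (gy (x, y)) y)
    (hxy : ∀ x y, HasDerivAt (fun s => gx (x, s)) (gxy (x, y)) y)
    (hcg : Continuous g) (hcgx : Continuous gx)
    (hg : Integrable g) (hgx : Integrable gx) (hgy : Integrable gy) (hgxy : Integrable gxy)
    (p : ℝ × ℝ) : ‖g p‖ₑ ≤ ∫⁻ p, ‖gxy p‖ₑ := by
  have h1 : Integrable (fun x => g (x, p.2)) :=
    ⟨(hcg.comp (by fun_prop)).aestronglyMeasurable,
      (lintegral_fst_le hy hg hgy p.2).trans_lt hgy.hasFiniteIntegral⟩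
  have h2 : Integrable (fun x => gx (x, p.2)) :=
    ⟨(hcgx.comp (by fun_prop)).aestronglyMeasurable,
      (lintegral_fst_le hxy hgx hgxy p.2).trans_lt hgxy.hasFiniteIntegral⟩
  exact (enorm_le_lintegral_enorm_deriv (fun x => hx x p.2) h1 h2 p.1).trans
    (lintegral_fst_le hxy hgx hgxy p.2)

/-! ### Consequences for functions with integrable derivatives -/

namespace SobolevReg

variable {n : ℕ} {q : ℝ × ℝ → ℂ}

theorem hasDerivAt_fst (h : SobolevReg n q) (x y : ℝ) :
    HasDerivAt (fun s => q (s, y)) (DS1.dXi q (x, y)) x := hasDerivAt_dXi h.differentiable x y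

theorem hasDerivAt_snd (h : SobolevReg n q) (x y : ℝ) :
    HasDerivAt (fun s => q (x, s)) (DS1.dEta q (x, y)) y := hasDerivAt_dEta h.differentiable x y

theorem integrable_dXi (h : SobolevReg (n + 1) q) : Integrable (DS1.dXi q) :=
  h.dXi.integrable_self

theorem integrable_dEta (h : SobolevReg (n + 1) q) : Integrable (DS1.dEta q) :=
  h.dEta.integrable_self

theorem lineDominated (h : SobolevReg (n + 1) q) : LineDominated q :=
  .of_hasDerivAt h.continuous h.hasDerivAt_fst h.hasDerivAt_snd h.integrable_self h.integrable_dXi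
    h.integrable_dEta

theorem exists_bound (h : SobolevReg (n + 2) q) : ∃ C : ℝ, ∀ p, ‖q p‖ ≤ C := by
  refine ⟨(∫⁻ p, ‖DS1.dEta (DS1.dXi q) p‖ₑ).toReal, fun p => ?_⟩
  have := enorm_le_lintegral_mixed h.hasDerivAt_fst h.hasDerivAt_snd h.dXi.hasDerivAt_snd
    h.continuous h.dXi.continuous h.integrable_self h.integrable_dXi h.integrable_dEta
    h.dXi.integrable_dEta p
  rw [← toReal_enorm]
  exact ENNReal.toReal_mono h.dXi.integrable_dEta.hasFiniteIntegral.ne this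

theorem tendsto_fst_atBot (h : SobolevReg (n + 2) q) (y : ℝ) :
    Tendsto (fun x => q (x, y)) atBot (𝓝 0) :=
  tendsto_zero_atBot_of_integrable_deriv (fun x => h.hasDerivAt_fst x y)
    (h.lineDominated.integrable_fst y) (h.dXi.lineDominated.integrable_fst y)

theorem tendsto_fst_atTop (h : SobolevReg (n + 2) q) (y : ℝ) :
    Tendsto (fun x => q (x, y)) atTop (𝓝 0) :=
  tendsto_zero_atTop_of_integrable_deriv (fun x => h.hasDerivAt_fst x y)
    (h.lineDominated.integrable_fst y) (h.dXi.lineDominated.integrable_fst y)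

theorem tendsto_snd_atBot (h : SobolevReg (n + 2) q) (x : ℝ) :
    Tendsto (fun y => q (x, y)) atBot (𝓝 0) :=
  tendsto_zero_atBot_of_integrable_deriv (fun y => h.hasDerivAt_snd x y)
    (h.lineDominated.integrable_snd x) (h.dEta.lineDominated.integrable_snd x)

theorem tendsto_snd_atTop (h : SobolevReg (n + 2) q) (x : ℝ) :
    Tendsto (fun y => q (x, y)) atTop (𝓝 0) :=
  tendsto_zero_atTop_of_integrable_deriv (fun y => h.hasDerivAt_snd x y)
    (h.lineDominated.integrable_snd x) (h.dEta.lineDominated.integrable_snd x)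

/-- The Volterra estimate needs a majorant with a differentiable primitive, so it has to be
continuous. The integral of |∂_η q| over η is even Lipschitz in ξ, with constant `lineNorm` of
∂_ξ∂_η q; finiteness of that norm is what uses third derivatives. -/
theorem exists_continuous_dominating (h : SobolevReg 3 q) :
    ∃ a : ℝ → ℝ, Continuous a ∧ Integrable a ∧ ∀ x y, ‖q (x, y)‖ ≤ a x := by
  have hη : SobolevReg 2 (DS1.dEta q) := h.dEta
  have hη' := hη.lineDominated
  refine ⟨fun x => ∫ y, ‖DS1.dEta q (x, y)‖, ?_, hη.integrable_self.integral_norm_prod_left,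
    fun x y => ?_⟩
  · have hfin := hη.dXi.lineDominated.lineNorm_ne_top
    refine (LipschitzWith.of_dist_le_mul
      (K := (lineNorm (DS1.dXi (DS1.dEta q))).toNNReal) fun x x' => ?_).continuous
    have hi : ∀ x, Integrable (fun y => ‖DS1.dEta q (x, y)‖) := fun x => (hη'.integrable_snd x).norm
    -- The mean value inequality in L¹ between two vertical lines.
    have hle := lintegral_enorm_sub_le (μ := volume) (f := fun r y => DS1.dEta q (r, y))
      (f' := fun r y => DS1.dXi (DS1.dEta q) (r, y)) (S := Set.univ) (a := x') (b := x)
      (Set.subset_univ _) (fun r _ => (hη.continuous.comp (by fun_prop)).measurable)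
      (fun r _ y => (hη.hasDerivAt_fst r y).hasDerivWithinAt)
      (fun r _ => lintegral_snd_le_lineNorm _ r)
    rw [Real.dist_eq, ← integral_sub (hi x) (hi x')]
    have h1 : |∫ y, (‖DS1.dEta q (x, y)‖ - ‖DS1.dEta q (x', y)‖)|
        ≤ ∫ y, ‖DS1.dEta q (x, y) - DS1.dEta q (x', y)‖ := by
      refine (norm_integral_le_integral_norm _).trans (integral_mono ((hi x).sub (hi x')).norm
        ((hη'.integrable_snd x).sub (hη'.integrable_snd x')).norm fun y => ?_)
      exact abs_norm_sub_norm_le _ _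
    refine h1.trans ?_
    have h2 : ENNReal.ofReal (∫ y, ‖DS1.dEta q (x, y) - DS1.dEta q (x', y)‖)
        = ∫⁻ y, ‖DS1.dEta q (x, y) - DS1.dEta q (x', y)‖ₑ :=
      ofReal_integral_norm_eq_lintegral_enorm
        ((hη'.integrable_snd x).sub (hη'.integrable_snd x'))
    rw [← ENNReal.ofReal_le_ofReal_iff (by positivity), h2, ENNReal.ofReal_mul (by positivity),
      ENNReal.ofReal_coe_nnreal, ENNReal.coe_toNNReal hfin, Real.dist_eq]
    exact hle
  · have := enorm_le_lintegral_enorm_deriv (fun y => h.hasDerivAt_snd x y)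
      (h.lineDominated.integrable_snd x) (hη'.integrable_snd x) y
    rw [← ofReal_norm, ← ofReal_integral_norm_eq_lintegral_enorm (hη'.integrable_snd x)] at this
    exact (ENNReal.ofReal_le_ofReal_iff (integral_nonneg fun _ => norm_nonneg _)).1 this

end SobolevReg

/-! ### Continuity in `lineNorm` under translation and in time -/

/-- Strong continuity of translations on L¹, taken from the continuous action of the translation
group on `Lp`. -/
theorem tendsto_lintegral_translate {g : ℝ × ℝ → ℂ} (hg : Integrable g) (v : ℝ × ℝ) :
    Tendsto (fun h : ℝ => ∫⁻ p, ‖g (p + h • v) - g p‖ₑ) (𝓝 0) (𝓝 0) := by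
  have hm : MemLp g 1 volume := memLp_one_iff_integrable.2 hg
  have : Fact ((1 : ℝ≥0∞) ≠ ∞) := ⟨ENNReal.one_ne_top⟩
  let c : ℝ → (ℝ × ℝ)ᵈᵃᵃ := fun h => DomAddAct.mk (h • v)
  have hc : Continuous fun h : ℝ => c h +ᵥ hm.toLp g := by
    have hcc : Continuous c := DomAddAct.continuous_mk.comp (by fun_prop)
    exact hcc.vadd continuous_const
  have h0 : Tendsto (fun h : ℝ => edist (c h +ᵥ hm.toLp g) (hm.toLp g)) (𝓝 0) (𝓝 0) := by
    have := (hc.edist (continuous_const (y := hm.toLp g))).tendsto 0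
    simpa [c] using this
  refine h0.congr fun h => ?_
  rw [Lp.edist_def, eLpNorm_one_eq_lintegral_enorm]
  refine lintegral_congr_ae ?_
  have hqm := (measurePreserving_add_left (volume : Measure (ℝ × ℝ)) (h • v)).quasiMeasurePreserving
  filter_upwards [DomAddAct.vadd_Lp_ae_eq (c h) (hm.toLp g), hm.coeFn_toLp,
    hqm.ae hm.coeFn_toLp] with p h1 h2 h3
  simp only [Pi.sub_apply]
  rw [h1, h2]
  simp only [c, Equiv.symm_apply_apply, vadd_eq_add]
  rw [h3, add_comm]

/-- By `lineNorm_le_of_hasDerivAt` it is enough to translate the gradient in L¹. -/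
theorem SobolevReg.tendsto_lineNorm_translate {n : ℕ} {q : ℝ × ℝ → ℂ} (h : SobolevReg (n + 1) q)
    (v : ℝ × ℝ) :
    Tendsto (fun s : ℝ => lineNorm (fun p => q (p + s • v) - q p)) (𝓝 0) (𝓝 0) := by
  have h1 := (tendsto_lintegral_translate h.integrable_dXi v).add
    (tendsto_lintegral_translate h.integrable_dEta v)
  rw [add_zero] at h1
  refine tendsto_of_tendsto_of_tendsto_of_le_of_le tendsto_const_nhds h1 (fun _ => zero_le)
    fun s => ?_
  refine lineNorm_le_of_hasDerivAt (g := fun p => q (p + s • v) - q p)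
    (gx := fun p => DS1.dXi q (p + s • v) - DS1.dXi q p)
    (gy := fun p => DS1.dEta q (p + s • v) - DS1.dEta q p) (fun x y => ?_) (fun x y => ?_)
    ((h.integrable_self.comp_add_right _).sub h.integrable_self)
    ((h.integrable_dXi.comp_add_right _).sub h.integrable_dXi)
    ((h.integrable_dEta.comp_add_right _).sub h.integrable_dEta)
  · exact ((h.hasDerivAt_fst (x + (s • v).1) (y + (s • v).2)).comp_add_const x _).sub
      (h.hasDerivAt_fst x y)
  · exact ((h.hasDerivAt_snd (x + (s • v).1) (y + (s • v).2)).comp_add_const y _).sub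
      (h.hasDerivAt_snd x y)

namespace RegularOn

variable {n : ℕ} {T : ℝ} {f : ℝ → ℝ × ℝ → ℂ}

theorem tendsto_lineNorm (h : RegularOn (n + 1) T f) {t : ℝ} (ht : t ∈ Set.Icc 0 T) :
    Tendsto (fun s => lineNorm (fun p => f s p - f t p)) (𝓝[Set.Icc 0 T] t) (𝓝 0) := by
  have h1 := (h.dXi.tendsto_lintegral ht).add (h.dEta.tendsto_lintegral ht)
  rw [add_zero] at h1
  refine tendsto_of_tendsto_of_tendsto_of_le_of_le' tendsto_const_nhds h1
    (Eventually.of_forall fun _ => zero_le) ?_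
  filter_upwards [self_mem_nhdsWithin] with s hs
  have hs' := h.sobolevReg hs
  have ht' := h.sobolevReg ht
  exact lineNorm_le_of_hasDerivAt (g := fun p => f s p - f t p)
    (gx := fun p => DS1.dXi (f s) p - DS1.dXi (f t) p)
    (gy := fun p => DS1.dEta (f s) p - DS1.dEta (f t) p)
    (fun x y => (hs'.hasDerivAt_fst x y).sub (ht'.hasDerivAt_fst x y))
    (fun x y => (hs'.hasDerivAt_snd x y).sub (ht'.hasDerivAt_snd x y))
    (hs'.integrable_self.sub ht'.integrable_self) (hs'.integrable_dXi.sub ht'.integrable_dXi)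
    (hs'.integrable_dEta.sub ht'.integrable_dEta)

/-- The bound is the L¹ norm of the mixed derivative of the difference, as in
`enorm_le_lintegral_mixed`. -/
theorem exists_tendsto_sup (h : RegularOn (n + 2) T f) {t : ℝ} (ht : t ∈ Set.Icc 0 T) :
    ∃ B : ℝ → ℝ≥0∞, Tendsto B (𝓝[Set.Icc 0 T] t) (𝓝 0) ∧
      ∀ s ∈ Set.Icc 0 T, ∀ p, ‖f s p - f t p‖ₑ ≤ B s := by
  refine ⟨_, h.dXi.dEta.tendsto_lintegral ht, fun s hs => ?_⟩
  have hs' := h.sobolevReg hs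
  have ht' := h.sobolevReg ht
  exact enorm_le_lintegral_mixed (g := fun p => f s p - f t p)
    (gx := fun p => DS1.dXi (f s) p - DS1.dXi (f t) p)
    (gy := fun p => DS1.dEta (f s) p - DS1.dEta (f t) p)
    (gxy := fun p => DS1.dEta (DS1.dXi (f s)) p - DS1.dEta (DS1.dXi (f t)) p)
    (fun x y => (hs'.hasDerivAt_fst x y).sub (ht'.hasDerivAt_fst x y))
    (fun x y => (hs'.hasDerivAt_snd x y).sub (ht'.hasDerivAt_snd x y))
    (fun x y => (hs'.dXi.hasDerivAt_snd x y).sub (ht'.dXi.hasDerivAt_snd x y))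
    (hs'.continuous.sub ht'.continuous) (hs'.dXi.continuous.sub ht'.dXi.continuous)
    (hs'.integrable_self.sub ht'.integrable_self) (hs'.integrable_dXi.sub ht'.integrable_dXi)
    (hs'.integrable_dEta.sub ht'.integrable_dEta)
    (hs'.dXi.integrable_dEta.sub ht'.dXi.integrable_dEta)

end RegularOn

/-! ### Integration along half-lines as operators on bounded continuous functions -/

theorem hasDerivAt_integral_Iic {F : Type*} [NormedAddCommGroup F] [NormedSpace ℝ F]
    [CompleteSpace F] {g : ℝ → F} (hc : Continuous g) (hg : Integrable g) (x : ℝ) :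
    HasDerivAt (fun x => ∫ t in Set.Iic x, g t) (g x) x := by
  have h1 : HasDerivAt (fun x => ∫ t in (0 : ℝ)..x, g t) (g x) x :=
    intervalIntegral.integral_hasDerivAt_right (hg.intervalIntegrable)
      hc.stronglyMeasurable.stronglyMeasurableAtFilter hc.continuousAt
  refine (h1.add_const (∫ t in Set.Iic (0 : ℝ), g t)).congr_of_eventuallyEq
    (Eventually.of_forall fun y => ?_)
  dsimp only
  rw [← intervalIntegral.integral_Iic_sub_Iic hg.integrableOn hg.integrableOn, sub_add_cancel]

/-- Bounded continuous functions of `(ξ, η)` and of a parameter. -/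
def BC (P : Type*) [TopologicalSpace P] := BoundedContinuousFunction (P × ℝ × ℝ) ℂ

namespace BC

variable {P : Type*} [TopologicalSpace P]

instance : NormedCommRing (BC P) :=
  inferInstanceAs (NormedCommRing (BoundedContinuousFunction (P × ℝ × ℝ) ℂ))

instance : NormedAlgebra ℝ (BC P) :=
  inferInstanceAs (NormedAlgebra ℝ (BoundedContinuousFunction (P × ℝ × ℝ) ℂ))

instance : CompleteSpace (BC P) :=
  inferInstanceAs (CompleteSpace (BoundedContinuousFunction (P × ℝ × ℝ) ℂ))

instance : FunLike (BC P) (P × ℝ × ℝ) ℂ :=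
  inferInstanceAs (FunLike (BoundedContinuousFunction (P × ℝ × ℝ) ℂ) (P × ℝ × ℝ) ℂ)

@[ext] theorem ext {f g : BC P} (h : ∀ p x y, f (p, x, y) = g (p, x, y)) : f = g :=
  DFunLike.ext f g fun z => h z.1 z.2.1 z.2.2

protected theorem continuous (f : BC P) : Continuous f := BoundedContinuousFunction.continuous f

theorem norm_apply_le (f : BC P) (z : P × ℝ × ℝ) : ‖f z‖ ≤ ‖f‖ :=
  BoundedContinuousFunction.norm_coe_le_norm f z

theorem norm_le {f : BC P} {C : ℝ} (hC : 0 ≤ C) : ‖f‖ ≤ C ↔ ∀ z, ‖f z‖ ≤ C :=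
  BoundedContinuousFunction.norm_le hC

/-- A bounded continuous function from its values. -/
def mk (f : P × ℝ × ℝ → ℂ) (hf : Continuous f) (h : ∃ C, ∀ z, ‖f z‖ ≤ C) : BC P :=
  BoundedContinuousFunction.ofNormedAddCommGroup f hf h.choose h.choose_spec

@[simp] theorem mk_apply {f : P × ℝ × ℝ → ℂ} (hf : Continuous f) (h : ∃ C, ∀ z, ‖f z‖ ≤ C)
    (z : P × ℝ × ℝ) : mk f hf h z = f z := rfl

@[simp] theorem add_apply (f g : BC P) (z : P × ℝ × ℝ) : (f + g) z = f z + g z := rfl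
@[simp] theorem sub_apply (f g : BC P) (z : P × ℝ × ℝ) : (f - g) z = f z - g z := rfl
@[simp] theorem neg_apply (f : BC P) (z : P × ℝ × ℝ) : (-f) z = -f z := rfl
@[simp] theorem mul_apply (f g : BC P) (z : P × ℝ × ℝ) : (f * g) z = f z * g z := rfl
@[simp] theorem one_apply (z : P × ℝ × ℝ) : (1 : BC P) z = 1 := rfl
@[simp] theorem smul_apply (c : ℝ) (f : BC P) (z : P × ℝ × ℝ) : (c • f) z = c • f z := rfl

end BC

/-- Composition with a continuous map, as an operator on bounded continuous functions. -/
def compL {P P' : Type*} [TopologicalSpace P] [TopologicalSpace P']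
    (g : C(P × ℝ × ℝ, P' × ℝ × ℝ)) : BC P' →L[ℝ] BC P :=
  LinearMap.mkContinuous
    { toFun := fun f => BoundedContinuousFunction.compContinuous f g
      map_add' := fun _ _ => rfl
      map_smul' := fun _ _ => rfl } 1 fun f => by
    rw [one_mul]
    exact (BC.norm_le (norm_nonneg _)).2 fun x => BC.norm_apply_le f _

section Operators

variable {P : Type*} [TopologicalSpace P]

theorem continuous_slice_fst (f : BC P) (p : P) (y : ℝ) : Continuous fun t => f (p, t, y) :=
  f.continuous.comp (by fun_prop)

theorem LineDominated.integrable_mul_fst {q : ℝ × ℝ → ℂ} (hq : LineDominated q) (f : BC P)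
    (p : P) (y : ℝ) : Integrable fun t => q (t, y) * f (p, t, y) :=
  (hq.integrable_fst y).mul_bdd (c := ‖f‖) (continuous_slice_fst f p y).aestronglyMeasurable
    (Eventually.of_forall fun _ => f.norm_apply_le _)

theorem norm_setIntegral_mul_le {q : ℝ × ℝ → ℂ} (hq : LineDominated q) (f : BC P) (z : P × ℝ × ℝ) :
    ‖∫ t in Set.Iic z.2.1, q (t, z.2.2) * f (z.1, t, z.2.2)‖ ≤ (lineNorm q).toReal * ‖f‖ := by
  have h1 : ‖∫ t in Set.Iic z.2.1, q (t, z.2.2) * f (z.1, t, z.2.2)‖ₑ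
      ≤ lineNorm q * ‖f‖ₑ := by
    refine (enorm_integral_le_lintegral_enorm _).trans
      ((setLIntegral_le_lintegral _ _).trans ?_)
    calc ∫⁻ t, ‖q (t, z.2.2) * f (z.1, t, z.2.2)‖ₑ ≤ ∫⁻ t, ‖q (t, z.2.2)‖ₑ * ‖f‖ₑ :=
          lintegral_mono fun t => by
            rw [enorm_mul]; gcongr
            exact enorm_le_iff_norm_le.2 (f.norm_apply_le _)
      _ = (∫⁻ t, ‖q (t, z.2.2)‖ₑ) * ‖f‖ₑ :=
          lintegral_mul_const _ (hq.continuous.comp (by fun_prop)).enorm.measurable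
      _ ≤ _ := by gcongr; exact lintegral_fst_le_lineNorm q _
  have h2 := ENNReal.toReal_mono (ENNReal.mul_ne_top hq.lineNorm_ne_top enorm_ne_top) h1
  rwa [ENNReal.toReal_mul, toReal_enorm, toReal_enorm] at h2

/-- The operator `f ↦ f ∘ reflect`. -/
def reflectL : BC P →L[ℝ] BC P :=
  compL ⟨fun z => (z.1, reflect z.2), by
    exact continuous_fst.prodMk (continuous_reflect.comp continuous_snd)⟩

@[simp] theorem reflectL_apply (f : BC P) (p : P) (x y : ℝ) :
    reflectL f (p, x, y) = f (p, -y, -x) := rfl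

/-- The operator `f ↦ f(· + v)`. -/
def translateL (v : ℝ × ℝ) : BC P →L[ℝ] BC P := compL ⟨fun z => (z.1, z.2 + v), by fun_prop⟩

@[simp] theorem translateL_apply (v : ℝ × ℝ) (f : BC P) (p : P) (x y : ℝ) :
    translateL v f (p, x, y) = f (p, x + v.1, y + v.2) := rfl

variable [FirstCountableTopology P]

/-- Dominated convergence on the whole line, with the half-line written as an indicator. The
majorant depends on the integration variable only, so both the end point and the line may move. -/
theorem continuous_setIntegral_Iic {q : ℝ × ℝ → ℂ} (hq : LineDominated q) (f : BC P) :
    Continuous fun z : P × ℝ × ℝ => ∫ t in Set.Iic z.2.1, q (t, z.2.2) * f (z.1, t, z.2.2) := by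
  obtain ⟨a, ha, hd⟩ := hq.dom_fst
  refine continuous_iff_continuousAt.2 fun z₀ => ?_
  simp_rw [← integral_indicator measurableSet_Iic]
  refine continuousAt_of_dominated (bound := fun t => a t * ‖f‖) (Eventually.of_forall fun z => ?_)
    (Eventually.of_forall fun z => ?_) (ha.mul_const _) ?_
  · exact (hq.integrable_mul_fst f z.1 z.2.2).aestronglyMeasurable.indicator measurableSet_Iic
  · filter_upwards [hd] with t ht
    refine (norm_indicator_le_norm_self _ _).trans ?_
    rw [norm_mul]
    exact mul_le_mul (ht _) (f.norm_apply_le _) (norm_nonneg _) ((norm_nonneg _).trans (ht 0))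
  · have hne : ∀ᵐ t : ℝ, t ≠ z₀.2.1 := by simp [ae_iff]
    filter_upwards [hne] with t ht
    have hcont : Continuous fun z : P × ℝ × ℝ => q (t, z.2.2) * f (z.1, t, z.2.2) :=
      (hq.continuous.comp (by fun_prop)).mul (f.continuous.comp (by fun_prop))
    rcases lt_or_gt_of_ne ht with h | h
    · refine hcont.continuousAt.congr ?_
      have : ∀ᶠ z : P × ℝ × ℝ in 𝓝 z₀, t < z.2.1 :=
        (continuous_fst.comp continuous_snd).continuousAt.eventually (lt_mem_nhds h)
      filter_upwards [this] with z hz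
      rw [Set.indicator_of_mem (Set.mem_Iic.2 hz.le)]
    · refine (continuousAt_const (y := (0 : ℂ))).congr ?_
      have : ∀ᶠ z : P × ℝ × ℝ in 𝓝 z₀, z.2.1 < t :=
        (continuous_fst.comp continuous_snd).continuousAt.eventually (gt_mem_nhds h)
      filter_upwards [this] with z hz
      rw [Set.indicator_of_notMem (by simpa using hz)]

open Classical in
/-- The operator `f ↦ ∫_{-∞}^ξ q f dξ'`. -/
def intLeft (q : ℝ × ℝ → ℂ) : BC P →L[ℝ] BC P :=
  if hq : LineDominated q then
    LinearMap.mkContinuous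
      { toFun := fun f => BC.mk
          (fun z : P × ℝ × ℝ => ∫ t in Set.Iic z.2.1, q (t, z.2.2) * f (z.1, t, z.2.2))
          (continuous_setIntegral_Iic hq f) ⟨_, norm_setIntegral_mul_le hq f⟩
        map_add' := fun f g => by
          ext p x y
          simp only [BC.mk_apply, BC.add_apply, mul_add]
          exact integral_add (hq.integrable_mul_fst f _ _).integrableOn
            (hq.integrable_mul_fst g _ _).integrableOn
        map_smul' := fun c f => by
          ext p x y
          simp only [BC.mk_apply, BC.smul_apply, mul_smul_comm, RingHom.id_apply]
          exact integral_smul c _ }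
      (lineNorm q).toReal fun f => (BC.norm_le (by positivity)).2 (norm_setIntegral_mul_le hq f)
  else 0

theorem intLeft_apply {q : ℝ × ℝ → ℂ} (hq : LineDominated q) (f : BC P) (p : P) (x y : ℝ) :
    intLeft q f (p, x, y) = ∫ t in Set.Iic x, q (t, y) * f (p, t, y) := by
  rw [intLeft, dif_pos hq]; rfl

/-- No domination is assumed: the operator is 0 by default for potentials that are not dominated. -/
theorem enorm_intLeft_le (q : ℝ × ℝ → ℂ) : ‖(intLeft q : BC P →L[ℝ] BC P)‖ₑ ≤ lineNorm q := by
  rw [intLeft]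
  split_ifs with hq
  · rw [← ofReal_norm]
    exact ENNReal.ofReal_le_of_le_toReal (LinearMap.mkContinuous_norm_le _ (by positivity) _)
  · rw [← ofReal_norm, norm_zero, ENNReal.ofReal_zero]; exact zero_le

theorem intLeft_sub {q r : ℝ × ℝ → ℂ} (hq : LineDominated q) (hr : LineDominated r) :
    (intLeft (fun p => q p - r p) : BC P →L[ℝ] BC P) = intLeft q - intLeft r := by
  ext f p x y
  rw [sub_apply, BC.sub_apply]
  rw [intLeft_apply hq, intLeft_apply hr, intLeft_apply (hq.sub hr),
    ← integral_sub (hq.integrable_mul_fst f _ _).integrableOn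
      (hr.integrable_mul_fst f _ _).integrableOn]
  simp_rw [sub_mul]

theorem LineDominated.smul {q : ℝ × ℝ → ℂ} (hq : LineDominated q) (c : ℝ) :
    LineDominated (fun p => c • q p) := hq.const_mul c

theorem intLeft_smul {q : ℝ × ℝ → ℂ} (hq : LineDominated q) (c : ℝ) :
    (intLeft (fun p => c • q p) : BC P →L[ℝ] BC P) = c • intLeft q := by
  ext f p x y
  rw [smul_apply, BC.smul_apply]
  rw [intLeft_apply hq, intLeft_apply (hq.smul c), ← integral_smul]
  simp_rw [smul_mul_assoc]

/-- The operator `f ↦ ∫_η^∞ q f dη'`. -/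
def intRight (q : ℝ × ℝ → ℂ) : BC P →L[ℝ] BC P :=
  reflectL * intLeft (fun p => q (reflect p)) * reflectL

theorem intRight_eq (q : ℝ × ℝ → ℂ) (f : BC P) :
    intRight q f = reflectL (intLeft (fun p => q (reflect p)) (reflectL f)) := rfl

theorem intRight_apply {q : ℝ × ℝ → ℂ} (hq : LineDominated q) (f : BC P) (p : P) (x y : ℝ) :
    intRight q f (p, x, y) = ∫ t in Set.Ioi y, q (x, t) * f (p, x, t) := by
  have h := integral_comp_neg_Iic (-y) fun t => q (x, t) * f (p, x, t)
  rw [neg_neg] at h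
  rw [← h]
  rw [intRight_eq, reflectL_apply, intLeft_apply hq.comp_reflect]
  simp

theorem hasDerivAt_intLeft {q : ℝ × ℝ → ℂ} (hq : LineDominated q) (f : BC P) (p : P) (x y : ℝ) :
    HasDerivAt (fun s => intLeft q f (p, s, y)) (q (x, y) * f (p, x, y)) x := by
  simp_rw [intLeft_apply hq]
  exact hasDerivAt_integral_Iic ((hq.continuous.comp (by fun_prop)).mul
    (continuous_slice_fst f p y)) (hq.integrable_mul_fst f p y) x

theorem tendsto_intLeft {q : ℝ × ℝ → ℂ} (hq : LineDominated q) (f : BC P) (p : P) (y : ℝ) :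
    Tendsto (fun s => intLeft q f (p, s, y)) atBot (𝓝 0) := by
  simp_rw [intLeft_apply hq]
  exact tendsto_integral_Iic_zero tendsto_id

theorem hasDerivAt_intRight {q : ℝ × ℝ → ℂ} (hq : LineDominated q) (f : BC P) (p : P) (x y : ℝ) :
    HasDerivAt (fun s => intRight q f (p, x, s)) (-(q (x, y) * f (p, x, y))) y := by
  have h := hasDerivAt_intLeft hq.comp_reflect (reflectL f) p (-y) (-x)
  have h2 := h.scomp y (hasDerivAt_neg y)
  simp only [reflect_mk, neg_neg, reflectL_apply, neg_smul, one_smul] at h2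
  exact h2

theorem tendsto_intRight {q : ℝ × ℝ → ℂ} (hq : LineDominated q) (f : BC P) (p : P) (x : ℝ) :
    Tendsto (fun s => intRight q f (p, x, s)) atTop (𝓝 0) :=
  (tendsto_intLeft hq.comp_reflect (reflectL f) p (-x)).comp tendsto_neg_atTop_atBot

/-- Passage from a differential equation with a limit at −∞ to an integral equation. Later
identities between operators are proved in this way. -/
theorem eq_intLeft_of_hasDerivAt {q : ℝ × ℝ → ℂ} (hq : LineDominated q) (f : BC P) {p : P}
    {y : ℝ} {h : ℝ → ℂ} {c : ℂ} (hd : ∀ x, HasDerivAt h (q (x, y) * f (p, x, y)) x)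
    (hlim : Tendsto h atBot (𝓝 c)) (x : ℝ) : h x = c + intLeft q f (p, x, y) := by
  rw [intLeft_apply hq, integral_Iic_of_hasDerivAt_of_tendsto
    (hd x).continuousAt.continuousWithinAt (fun s _ => hd s)
    (hq.integrable_mul_fst f p y).integrableOn hlim]
  ring

theorem eq_intRight_of_hasDerivAt {q : ℝ × ℝ → ℂ} (hq : LineDominated q) (f : BC P) {p : P}
    {x : ℝ} {h : ℝ → ℂ} {c : ℂ} (hd : ∀ y, HasDerivAt h (-(q (x, y) * f (p, x, y))) y)
    (hlim : Tendsto h atTop (𝓝 c)) (y : ℝ) : h y = c + intRight q f (p, x, y) := by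
  have := eq_intLeft_of_hasDerivAt hq.comp_reflect (reflectL f) (p := p) (y := -x)
    (h := fun s => h (-s)) (c := c) (fun s => by
      have h2 := (hd (-s)).scomp s (hasDerivAt_neg s)
      simp only [neg_neg, neg_smul, one_smul] at h2
      simp only [reflect_mk, neg_neg, reflectL_apply]
      exact h2) (hlim.comp tendsto_neg_atBot_atTop) (-y)
  rw [neg_neg] at this
  exact this

/-- Translating a solution amounts to translating the potential. Space derivatives thereby become
derivatives with respect to a parameter of the potential. -/
theorem translateL_intLeft {q : ℝ × ℝ → ℂ} (hq : LineDominated q) (v : ℝ × ℝ) (f : BC P) :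
    translateL v (intLeft q f) = intLeft (fun p => q (p + v)) (translateL v f) := by
  ext p x y
  rw [translateL_apply, intLeft_apply hq, intLeft_apply (hq.comp_add v)]
  have := (measurePreserving_add_right (volume : Measure ℝ) v.1).setIntegral_preimage_emb
    (measurableEmbedding_addRight v.1) (fun t => q (t, y + v.2) * f (p, t, y + v.2))
    (Set.Iic (x + v.1))
  rw [← this]
  simp [Prod.add_def]

theorem translateL_intRight {q : ℝ × ℝ → ℂ} (hq : LineDominated q) (v : ℝ × ℝ) (f : BC P) :
    translateL v (intRight q f) = intRight (fun p => q (p + v)) (translateL v f) := by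
  have h1 : ∀ g : BC P, translateL v (reflectL g) = reflectL (translateL (reflect v) g) := by
    intro g; ext p x y; simp [reflect, add_comm]
  have h2 : ∀ g : BC P, translateL (reflect v) (reflectL g) = reflectL (translateL v g) := by
    intro g; ext p x y; simp [reflect, add_comm]
  rw [intRight_eq, intRight_eq, h1, translateL_intLeft hq.comp_reflect, h2]
  congr 3
  funext p
  simp [reflect, add_comm, Prod.add_def]

/-! ### Differentiable families of potentials -/

end Operators

/-- A family of potentials that is differentiable pointwise on `S`, with a derivative that is
continuous at `t` for `lineNorm`. -/
structure LineFamily (S : Set ℝ) (q q' : ℝ → ℝ × ℝ → ℂ) (t : ℝ) : Prop where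
  dominated : ∀ s ∈ S, LineDominated (q s)
  dominated_deriv : LineDominated (q' t)
  hasDeriv : ∀ s ∈ S, ∀ p, HasDerivWithinAt (fun r => q r p) (q' s p) S s
  tendsto : Tendsto (fun s => lineNorm (fun p => q' s p - q' t p)) (𝓝[S] t) (𝓝 0)

namespace LineFamily

variable {S : Set ℝ} {q q' : ℝ → ℝ × ℝ → ℂ} {t : ℝ}

theorem conj (h : LineFamily S q q' t) :
    LineFamily S (fun s p => starRingEnd ℂ (q s p)) (fun s p => starRingEnd ℂ (q' s p)) t where
  dominated s hs := (h.dominated s hs).conj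
  dominated_deriv := h.dominated_deriv.conj
  hasDeriv s hs p :=
    (Complex.conjCLE : ℂ →L[ℝ] ℂ).hasFDerivAt.comp_hasDerivWithinAt s (h.hasDeriv s hs p)
  tendsto := h.tendsto.congr fun s => lineNorm_congr fun p => by
    rw [← map_sub, ← ofReal_norm, ← ofReal_norm, RCLike.norm_conj]

theorem comp_reflect (h : LineFamily S q q' t) :
    LineFamily S (fun s p => q s (reflect p)) (fun s p => q' s (reflect p)) t where
  dominated s hs := (h.dominated s hs).comp_reflect
  dominated_deriv := h.dominated_deriv.comp_reflect
  hasDeriv s hs _ := h.hasDeriv s hs _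
  tendsto := tendsto_of_tendsto_of_tendsto_of_le_of_le tendsto_const_nhds h.tendsto
    (fun _ => zero_le) fun s => lineNorm_comp_reflect_le fun p => q' s p - q' t p

variable {P : Type*} [TopologicalSpace P] [FirstCountableTopology P]

/-- Since the operator is additive and homogeneous in the potential, with norm at most `lineNorm`,
the claim reduces to differentiability of the potential in `lineNorm`. That follows from the mean
value inequality in L¹ along each line; order-connectedness of `S` provides the segment between the
two times. -/
theorem hasDerivWithinAt_intLeft (h : LineFamily S q q' t) (hS : S.OrdConnected) (ht : t ∈ S) :
    HasDerivWithinAt (fun s => (intLeft (q s) : BC P →L[ℝ] BC P)) (intLeft (q' t)) S t := by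
  rw [hasDerivWithinAt_iff_isLittleO, Asymptotics.isLittleO_iff]
  intro ε hε
  have hev := h.tendsto.eventually (ge_mem_nhds (ENNReal.ofReal_pos.2 hε))
  obtain ⟨δ, hδ, hsub⟩ := Metric.mem_nhdsWithin_iff.1 hev
  filter_upwards [inter_mem_nhdsWithin S (Metric.ball_mem_nhds t hδ)] with s hs
  have hI : Set.uIcc t s ⊆ S := hS.uIcc_subset ht hs.1
  have hI' : Set.uIcc t s ⊆ Metric.ball t δ := by
    rw [Real.ball_eq_Ioo] at hs ⊢
    exact Set.ordConnected_Ioo.uIcc_subset ⟨by linarith, by linarith⟩ hs.2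
  have hC : ∀ r ∈ Set.uIcc t s, lineNorm (fun p => q' r p - q' t p) ≤ ENNReal.ofReal ε :=
    fun r hr => hsub ⟨hI' hr, hI hr⟩
  have hq' := h.dominated_deriv
  -- The estimate on each line has the same constant, so the supremum over all lines is allowed.
  have hbound : lineNorm (fun p => q s p - q t p - (s - t) • q' t p)
      ≤ ENNReal.ofReal ε * ENNReal.ofReal |s - t| := by
    refine lineNorm_le_iff.2 ⟨fun y => ?_, fun x => ?_⟩
    · exact lintegral_enorm_sub_sub_smul_le (f := fun r x => q r (x, y))
        (f' := fun r x => q' r (x, y)) hI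
        (fun r hr => ((h.dominated r hr).continuous.comp (by fun_prop)).measurable)
        (hq'.continuous.comp (by fun_prop)).measurable (fun r hr x => h.hasDeriv r hr (x, y))
        (fun r hr => (lintegral_fst_le_lineNorm (fun p => q' r p - q' t p) y).trans (hC r hr))
    · exact lintegral_enorm_sub_sub_smul_le (f := fun r y => q r (x, y))
        (f' := fun r y => q' r (x, y)) hI
        (fun r hr => ((h.dominated r hr).continuous.comp (by fun_prop)).measurable)
        (hq'.continuous.comp (by fun_prop)).measurable (fun r hr y => h.hasDeriv r hr (x, y))
        (fun r hr => (lintegral_snd_le_lineNorm (fun p => q' r p - q' t p) x).trans (hC r hr))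
  have hqs := h.dominated s hs.1
  have hqt := h.dominated t ht
  have heq : (intLeft (q s) : BC P →L[ℝ] BC P) - intLeft (q t) - (s - t) • intLeft (q' t)
      = intLeft (fun p => q s p - q t p - (s - t) • q' t p) := by
    rw [intLeft_sub (hqs.sub hqt) (hq'.smul _), intLeft_sub hqs hqt, intLeft_smul hq']
  rw [heq]
  have := (enorm_intLeft_le (P := P) _).trans hbound
  rw [← ofReal_norm, ← ENNReal.ofReal_mul hε.le] at this
  rw [Real.norm_eq_abs]
  exact (ENNReal.ofReal_le_ofReal_iff (by positivity)).1 this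

theorem hasDerivWithinAt_intRight (h : LineFamily S q q' t) (hS : S.OrdConnected) (ht : t ∈ S) :
    HasDerivWithinAt (fun s => (intRight (q s) : BC P →L[ℝ] BC P)) (intRight (q' t)) S t := by
  have := h.comp_reflect.hasDerivWithinAt_intLeft (P := P) hS ht
  exact (this.const_mul (reflectL : BC P →L[ℝ] BC P)).mul_const (reflectL : BC P →L[ℝ] BC P)

end LineFamily

/-! ### The Volterra operator of the Dirac system -/

section Volterra

variable {P : Type*} [TopologicalSpace P] [FirstCountableTopology P]

/-- The operator `f ↦ -½ ∫_{-∞}^ξ q f dξ'`. -/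
def opA (q : ℝ × ℝ → ℂ) : BC P →L[ℝ] BC P := (-(1 / 2) : ℝ) • intLeft q

/-- The operator `f ↦ ½ σ ∫_η^∞ q̄ f dη'`. -/
def opB (σ : ℝ) (q : ℝ × ℝ → ℂ) : BC P →L[ℝ] BC P :=
  (σ / 2) • intRight (fun p => starRingEnd ℂ (q p))

/-- The composition of `opA` and `opB`. -/
def volterra (σ : ℝ) (q : ℝ × ℝ → ℂ) : BC P →L[ℝ] BC P := opA q * opB σ q

theorem volterra_apply (σ : ℝ) (q : ℝ × ℝ → ℂ) (f : BC P) :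
    volterra σ q f = opA q (opB σ q f) := rfl

theorem opA_eq (q : ℝ × ℝ → ℂ) (f : BC P) : opA q f = (-(1 / 2) : ℝ) • intLeft q f := rfl

theorem opB_eq (σ : ℝ) (q : ℝ × ℝ → ℂ) (f : BC P) :
    opB σ q f = (σ / 2) • intRight (fun p => starRingEnd ℂ (q p)) f := rfl

theorem opA_apply {q : ℝ × ℝ → ℂ} (hq : LineDominated q) (f : BC P) (p : P) (x y : ℝ) :
    opA q f (p, x, y) = -(1 / 2) * ∫ t in Set.Iic x, q (t, y) * f (p, t, y) := by
  rw [opA_eq, BC.smul_apply, intLeft_apply hq, Complex.real_smul]; push_cast; ring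

theorem opB_apply (σ : ℝ) {q : ℝ × ℝ → ℂ} (hq : LineDominated q) (f : BC P) (p : P) (x y : ℝ) :
    opB σ q f (p, x, y)
      = σ / 2 * ∫ t in Set.Ioi y, starRingEnd ℂ (q (x, t)) * f (p, x, t) := by
  rw [opB_eq, BC.smul_apply, intRight_apply hq.conj, Complex.real_smul]; push_cast; ring

theorem hasDerivAt_opA {q : ℝ × ℝ → ℂ} (hq : LineDominated q) (f : BC P) (p : P) (x y : ℝ) :
    HasDerivAt (fun s => opA q f (p, s, y)) (-(1 / 2) * q (x, y) * f (p, x, y)) x := by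
  have := (hasDerivAt_intLeft hq f p x y).const_smul (-(1 / 2) : ℝ)
  refine this.congr_deriv ?_
  rw [Complex.real_smul]; push_cast; ring

theorem hasDerivAt_opB (σ : ℝ) {q : ℝ × ℝ → ℂ} (hq : LineDominated q) (f : BC P) (p : P)
    (x y : ℝ) : HasDerivAt (fun s => opB σ q f (p, x, s))
      (-(1 / 2) * σ * starRingEnd ℂ (q (x, y)) * f (p, x, y)) y := by
  have := (hasDerivAt_intRight hq.conj f p x y).const_smul (σ / 2)
  refine this.congr_deriv ?_
  rw [Complex.real_smul]; push_cast; ring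

theorem tendsto_opA {q : ℝ × ℝ → ℂ} (hq : LineDominated q) (f : BC P) (p : P) (y : ℝ) :
    Tendsto (fun s => opA q f (p, s, y)) atBot (𝓝 0) := by
  have := (tendsto_intLeft hq f p y).const_smul (-(1 / 2) : ℝ)
  rwa [smul_zero] at this

theorem tendsto_opB (σ : ℝ) {q : ℝ × ℝ → ℂ} (hq : LineDominated q) (f : BC P) (p : P) (x : ℝ) :
    Tendsto (fun s => opB σ q f (p, x, s)) atTop (𝓝 0) := by
  have := (tendsto_intRight hq.conj f p x).const_smul (σ / 2)
  rwa [smul_zero] at this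

theorem eq_opA_of_hasDerivAt {q : ℝ × ℝ → ℂ} (hq : LineDominated q) (f : BC P) {p : P}
    {y : ℝ} {h : ℝ → ℂ} {c : ℂ} (hd : ∀ x, HasDerivAt h (-(1 / 2) * q (x, y) * f (p, x, y)) x)
    (hlim : Tendsto h atBot (𝓝 c)) (x : ℝ) : h x = c + opA q f (p, x, y) := by
  have := eq_intLeft_of_hasDerivAt hq ((-(1 / 2) : ℝ) • f) (fun x => (hd x).congr_deriv (by
    rw [BC.smul_apply, Complex.real_smul]; push_cast; ring)) hlim x
  rw [this, map_smul]; rfl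

theorem eq_opB_of_hasDerivAt (σ : ℝ) {q : ℝ × ℝ → ℂ} (hq : LineDominated q) (f : BC P) {p : P}
    {x : ℝ} {h : ℝ → ℂ} {c : ℂ}
    (hd : ∀ y, HasDerivAt h (-(1 / 2) * σ * starRingEnd ℂ (q (x, y)) * f (p, x, y)) y)
    (hlim : Tendsto h atTop (𝓝 c)) (y : ℝ) : h y = c + opB σ q f (p, x, y) := by
  have := eq_intRight_of_hasDerivAt hq.conj ((σ / 2) • f) (fun y => (hd y).congr_deriv (by
    rw [BC.smul_apply, Complex.real_smul]; push_cast; ring)) hlim y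
  rw [this, map_smul]; rfl

/-- Conjugating by the multiplication with e^{−(n+1)A(ξ)}, where A' = a dominates the potential,
makes the operator a contraction. This replaces the factorial bounds of the Volterra series. -/
theorem isUnit_one_sub_volterra {σ : ℝ} (hσ : |σ| ≤ 1) {q : ℝ × ℝ → ℂ} (hq : LineDominated q)
    (ha : ∃ a : ℝ → ℝ, Continuous a ∧ Integrable a ∧ ∀ x y, ‖q (x, y)‖ ≤ a x) :
    IsUnit (1 - volterra σ q : BC P →L[ℝ] BC P) := by
  obtain ⟨a, hac, hai, had⟩ := ha
  have ha0 : ∀ x, 0 ≤ a x := fun x => (norm_nonneg _).trans (had x 0)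
  set n : ℝ := (lineNorm q).toReal with hn
  have hn0 : 0 ≤ n := ENNReal.toReal_nonneg
  let A : ℝ → ℝ := fun x => ∫ t in Set.Iic x, a t
  have hAd : ∀ x, HasDerivAt A (a x) x := hasDerivAt_integral_Iic hac hai
  have hAc : Continuous A := continuous_iff_continuousAt.2 fun x => (hAd x).continuousAt
  have hA0 : ∀ x, 0 ≤ A x := fun x => integral_nonneg fun t => ha0 t
  have hA1 : ∀ x, A x ≤ ∫ t, a t := fun x =>
    setIntegral_le_integral hai (Eventually.of_forall ha0)
  have hAlim : Tendsto A atBot (𝓝 0) := tendsto_integral_Iic_zero tendsto_id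
  -- The factor `n + 1`, rather than `n`, stays positive when the potential vanishes. As A is
  -- bounded, the weight and its inverse are both bounded.
  let w : BC P := BC.mk (fun z => Complex.exp ((-((n + 1) * A z.2.1) : ℝ) : ℂ))
    (by fun_prop) ⟨1, fun z => by
      rw [Complex.norm_exp, Complex.ofReal_re]
      exact Real.exp_le_one_iff.2 (neg_nonpos.2 (mul_nonneg (by positivity) (hA0 _)))⟩
  let w' : BC P := BC.mk (fun z => Complex.exp (((n + 1) * A z.2.1 : ℝ) : ℂ))
    (by fun_prop) ⟨Real.exp ((n + 1) * ∫ t, a t), fun z => by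
      rw [Complex.norm_exp, Complex.ofReal_re]
      exact Real.exp_le_exp.2 (mul_le_mul_of_nonneg_left (hA1 _) (by positivity))⟩
  have hww : w * w' = 1 := by
    ext p x y
    simp only [BC.mul_apply, w, w', BC.mk_apply, BC.one_apply]
    rw [← Complex.exp_add, ← Complex.ofReal_add, neg_add_cancel, Complex.ofReal_zero,
      Complex.exp_zero]
  let M : BC P →L[ℝ] BC P := ContinuousLinearMap.mul ℝ (BC P) w
  let M' : BC P →L[ℝ] BC P := ContinuousLinearMap.mul ℝ (BC P) w'
  have hMM : M * M' = 1 := by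
    ext1 f
    change w * (w' * f) = f
    rw [← mul_assoc, hww, one_mul]
  have hMM' : M' * M = 1 := by
    ext1 f
    change w' * (w * f) = f
    rw [← mul_assoc, mul_comm w' w, hww, one_mul]
  -- The weight depends on ξ alone, so it passes through the integration in η and leaves its growth
  -- factor outside.
  have hB : ∀ (g : BC P) (p : P) (t y : ℝ),
      ‖opB σ q (w' * g) (p, t, y)‖ ≤ 1 / 2 * (n * (Real.exp ((n + 1) * A t) * ‖g‖)) := by
    intro g p t y
    rw [opB_apply σ hq, norm_mul]
    have h1 : ‖(σ : ℂ) / 2‖ ≤ 1 / 2 := by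
      rw [norm_div, Complex.norm_real, Real.norm_eq_abs, Complex.norm_ofNat]; linarith
    refine mul_le_mul h1 ?_ (norm_nonneg _) (by norm_num)
    have hqi := hq.integrable_snd t
    have h2 : ‖∫ s in Set.Ioi y, starRingEnd ℂ (q (t, s)) * (w' * g) (p, t, s)‖
        ≤ ∫ s in Set.Ioi y, ‖q (t, s)‖ * (Real.exp ((n + 1) * A t) * ‖g‖) := by
      refine norm_integral_le_of_norm_le (hqi.norm.mul_const _).integrableOn
        (Eventually.of_forall fun s => ?_)
      rw [norm_mul, RCLike.norm_conj, BC.mul_apply, norm_mul]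
      refine mul_le_mul_of_nonneg_left (mul_le_mul (le_of_eq ?_) (g.norm_apply_le _)
        (norm_nonneg _) (Real.exp_pos _).le) (norm_nonneg _)
      simp only [w', BC.mk_apply]
      rw [Complex.norm_exp, Complex.ofReal_re]
    refine h2.trans ?_
    rw [integral_mul_const]
    refine mul_le_mul_of_nonneg_right ?_ (by positivity)
    refine (setIntegral_le_integral hqi.norm (Eventually.of_forall fun _ => norm_nonneg _)).trans ?_
    rw [hn, integral_norm_eq_lintegral_enorm hqi.aestronglyMeasurable]
    exact ENNReal.toReal_mono hq.lineNorm_ne_top (lintegral_snd_le_lineNorm q t)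
  -- Each of the two operators contributes 1/2. Integrating a·e^{(n+1)A} exactly gains 1/(n+1),
  -- which absorbs the norm `n` of the integration in η.
  have hnorm : ‖M * volterra σ q * M'‖ ≤ 1 / 4 := by
    refine ContinuousLinearMap.opNorm_le_bound _ (by norm_num) fun g => ?_
    refine (BC.norm_le (by positivity)).2 fun z => ?_
    obtain ⟨p, x, y⟩ := z
    change ‖(w * opA q (opB σ q (w' * g))) (p, x, y)‖ ≤ _
    rw [BC.mul_apply, norm_mul, opA_apply hq, norm_mul]
    have hwn : ‖w (p, x, y)‖ = Real.exp (-((n + 1) * A x)) := by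
      simp only [w, BC.mk_apply]
      rw [Complex.norm_exp, Complex.ofReal_re]
    have hhalf : ‖(-(1 / 2) : ℂ)‖ = 1 / 2 := by norm_num
    have hae : Integrable (fun t => a t * Real.exp ((n + 1) * A t)) :=
      hai.mul_bdd (c := Real.exp ((n + 1) * ∫ t, a t)) (by fun_prop)
        (Eventually.of_forall fun t => by
          rw [Real.norm_eq_abs, abs_of_pos (Real.exp_pos _)]
          exact Real.exp_le_exp.2 (mul_le_mul_of_nonneg_left (hA1 _) (by positivity)))
    have hexp : ∫ t in Set.Iic x, a t * Real.exp ((n + 1) * A t)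
        = (Real.exp ((n + 1) * A x) - 1) / (n + 1) := by
      have hd : ∀ t, HasDerivAt (fun t => Real.exp ((n + 1) * A t) / (n + 1))
          (a t * Real.exp ((n + 1) * A t)) t := fun t => by
        refine ((((hAd t).const_mul (n + 1)).exp).div_const (n + 1)).congr_deriv ?_
        field_simp
      have hl : Tendsto (fun t => Real.exp ((n + 1) * A t) / (n + 1)) atBot (𝓝 (1 / (n + 1))) := by
        have : Tendsto (fun t => Real.exp ((n + 1) * A t) / (n + 1)) atBot
            (𝓝 (Real.exp ((n + 1) * 0) / (n + 1))) :=
          ((Real.continuous_exp.tendsto _).comp (hAlim.const_mul (n + 1))).div_const _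
        simpa using this
      rw [integral_Iic_of_hasDerivAt_of_tendsto (hd x).continuousAt.continuousWithinAt
        (fun t _ => hd t) hae.integrableOn hl]
      ring
    have h3 : ‖∫ t in Set.Iic x, q (t, y) * opB σ q (w' * g) (p, t, y)‖
        ≤ ∫ t in Set.Iic x, a t * Real.exp ((n + 1) * A t) * (1 / 2 * n * ‖g‖) := by
      refine norm_integral_le_of_norm_le (hae.mul_const _).integrableOn
        (Eventually.of_forall fun t => ?_)
      rw [norm_mul]
      calc ‖q (t, y)‖ * ‖opB σ q (w' * g) (p, t, y)‖
          ≤ a t * (1 / 2 * (n * (Real.exp ((n + 1) * A t) * ‖g‖))) :=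
            mul_le_mul (had t y) (hB g p t y) (norm_nonneg _) (ha0 t)
        _ = _ := by ring
    rw [integral_mul_const, hexp] at h3
    rw [hwn, hhalf]
    have hE : Real.exp (-((n + 1) * A x)) * (Real.exp ((n + 1) * A x) - 1) ≤ 1 := by
      rw [mul_sub, ← Real.exp_add, neg_add_cancel, Real.exp_zero]
      linarith [Real.exp_pos (-((n + 1) * A x))]
    calc Real.exp (-((n + 1) * A x))
          * (1 / 2 * ‖∫ t in Set.Iic x, q (t, y) * opB σ q (w' * g) (p, t, y)‖)
        ≤ Real.exp (-((n + 1) * A x)) * (1 / 2 *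
            ((Real.exp ((n + 1) * A x) - 1) / (n + 1) * (1 / 2 * n * ‖g‖))) := by gcongr
      _ = (Real.exp (-((n + 1) * A x)) * (Real.exp ((n + 1) * A x) - 1))
            * (n / (n + 1)) * (1 / 4 * ‖g‖) := by ring
      _ ≤ 1 * 1 * (1 / 4 * ‖g‖) := by
          have : n / (n + 1) ≤ 1 := (div_le_one (by positivity)).2 (by linarith)
          have h0 : 0 ≤ n / (n + 1) := by positivity
          gcongr
      _ = 1 / 4 * ‖g‖ := by ring
  have hu := isUnit_one_sub_of_norm_lt_one (lt_of_le_of_lt hnorm (by norm_num))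
  have hM : IsUnit M := ⟨⟨M, M', hMM, hMM'⟩, rfl⟩
  have hM' : IsUnit M' := ⟨⟨M', M, hMM', hMM⟩, rfl⟩
  have heq : (1 - volterra σ q : BC P →L[ℝ] BC P) = M' * (1 - M * volterra σ q * M') * M := by
    have : M' * (1 - M * volterra σ q * M') * M
        = M' * M - (M' * M) * volterra σ q * (M' * M) := by
      simp only [mul_sub, sub_mul, mul_one, mul_assoc]
    rw [this, hMM', one_mul, mul_one]
  rw [heq]
  exact (hM'.mul hu).mul hM

end Volterra

/-! ### Differentiation of solutions of linear equations -/

/-- Invertibility is open and inversion is differentiable, so near `t` the solution is A(s)⁻¹g(s).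
The equation for the derivative is the product rule multiplied out by A(t). -/
theorem exists_hasDerivWithinAt_of_apply_eq {V : Type*} [NormedAddCommGroup V] [NormedSpace ℝ V]
    [CompleteSpace V] {A : ℝ → V →L[ℝ] V} {A' : V →L[ℝ] V} {x g : ℝ → V} {g' : V} {S : Set ℝ}
    {t : ℝ} (ht : t ∈ S) (hu : IsUnit (A t)) (hA : HasDerivWithinAt A A' S t)
    (hg : HasDerivWithinAt g g' S t) (hx : ∀ s ∈ S, A s (x s) = g s) :
    ∃ x', HasDerivWithinAt x x' S t ∧ A t x' = g' - A' (x t) := by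
  obtain ⟨u, hu⟩ := hu
  have hinv := (hasFDerivAt_ringInverse (𝕜 := ℝ) u)
  rw [hu] at hinv
  have h1 := (hinv.comp_hasDerivWithinAt t hA).clm_apply hg
  have hev : ∀ᶠ s in 𝓝[S] t, IsUnit (A s) := by
    have : {B : V →L[ℝ] V | IsUnit B} ∈ 𝓝 (A t) := by
      rw [← hu]; exact u.nhds
    exact hA.continuousWithinAt this
  have hsol : ∀ s ∈ S, IsUnit (A s) → x s = Ring.inverse (A s) (g s) := fun s hs hus => by
    rw [← hx s hs]
    change x s = (Ring.inverse (A s) * A s) (x s)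
    rw [Ring.inverse_mul_cancel _ hus]; rfl
  have hmul : ∀ v : V, A t ((↑u⁻¹ : V →L[ℝ] V) v) = v := fun v => by
    change (A t * (↑u⁻¹ : V →L[ℝ] V)) v = v
    rw [← hu, Units.mul_inv]; rfl
  have hut : IsUnit (A t) := ⟨u, hu⟩
  have hxt : (↑u⁻¹ : V →L[ℝ] V) (g t) = x t := by
    rw [hsol t ht hut, ← hu, Ring.inverse_unit]
  refine ⟨_, h1.congr_of_eventuallyEq ?_ (hsol t ht hut), ?_⟩
  · filter_upwards [self_mem_nhdsWithin, hev] with s hs hus using hsol s hs hus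
  · rw [map_add]
    have e1 : (Ring.inverse ∘ A) t = (↑u⁻¹ : V →L[ℝ] V) := by
      rw [Function.comp_apply, ← hu, Ring.inverse_unit]
    rw [e1, hmul]
    have e2 : ((-((ContinuousLinearMap.mulLeftRight ℝ (V →L[ℝ] V)) ↑u⁻¹) (↑u⁻¹ : V →L[ℝ] V)) A')
        (g t) = -((↑u⁻¹ : V →L[ℝ] V) (A' ((↑u⁻¹ : V →L[ℝ] V) (g t)))) := rfl
    rw [e2, map_neg, hmul, hxt]
    abel

/-! ### Existence and uniqueness of the spectral functions -/

theorem SobolevReg.isUnit {P : Type*} [TopologicalSpace P] [FirstCountableTopology P] {σ : ℝ}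
    (hσ : |σ| ≤ 1) {q : ℝ × ℝ → ℂ} (hq : SobolevReg 3 q) :
    IsUnit (1 - volterra σ q : BC P →L[ℝ] BC P) :=
  isUnit_one_sub_volterra hσ hq.lineDominated hq.exists_continuous_dominating

theorem eq_of_volterra {P : Type*} [TopologicalSpace P] [FirstCountableTopology P] {σ : ℝ}
    (hσ : |σ| ≤ 1) {q : ℝ × ℝ → ℂ} (hq : SobolevReg 3 q) {f g e : BC P}
    (hf : f = e + opA q (opB σ q f)) (hg : g = e + opA q (opB σ q g)) : f = g := by
  have h : ∀ h : BC P, h = e + opA q (opB σ q h) → (1 - volterra σ q) h = e := fun h hh => by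
    change h - volterra σ q h = e
    rw [volterra_apply, sub_eq_iff_eq_add]; exact hh
  have hinv : ∀ h : BC P, Ring.inverse (1 - volterra σ q) ((1 - volterra σ q) h) = h := fun h => by
    change (Ring.inverse (1 - volterra σ q) * (1 - volterra σ q) : BC P →L[ℝ] BC P) h = h
    rw [Ring.inverse_mul_cancel _ (hq.isUnit hσ)]; rfl
  rw [← hinv f, ← hinv g, h f hf, h g hg]

/-- The exponential `exp(ikη)`, as a function of `k` and `(ξ, η)`. -/
def planeWave : BC ℝ :=
  BC.mk (fun z => Complex.exp (Complex.I * z.1 * z.2.2)) (by fun_prop) ⟨1, fun z => by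
    rw [Complex.norm_exp]; simp⟩

@[simp] theorem planeWave_apply (k x y : ℝ) :
    planeWave (k, x, y) = Complex.exp (Complex.I * k * y) := rfl

/-- Restriction to one value of the parameter. -/
def sliceL (k : ℝ) : BC ℝ →L[ℝ] BC Unit := compL ⟨fun z => (k, z.2), by fun_prop⟩

@[simp] theorem sliceL_apply (k : ℝ) (f : BC ℝ) (u : Unit) (x y : ℝ) :
    sliceL k f (u, x, y) = f (k, x, y) := rfl

/-- The first component of the spectral function, with the parameter `k`. -/
def psiFst (σ : ℝ) (q : ℝ × ℝ → ℂ) : BC ℝ := Ring.inverse (1 - volterra σ q) planeWave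

/-- The second component of the spectral function, with the parameter `k`. -/
def psiSnd (σ : ℝ) (q : ℝ × ℝ → ℂ) : BC ℝ := opB σ q (psiFst σ q)

theorem psiFst_eq {σ : ℝ} (hσ : |σ| ≤ 1) {q : ℝ × ℝ → ℂ} (hq : SobolevReg 3 q) :
    psiFst σ q = planeWave + opA q (psiSnd σ q) := by
  have h : (1 - volterra σ q) (psiFst σ q) = planeWave := by
    change ((1 - volterra σ q) * Ring.inverse (1 - volterra σ q) : BC ℝ →L[ℝ] BC ℝ) planeWave = planeWave
    rw [Ring.mul_inverse_cancel _ (hq.isUnit hσ)]; rfl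
  have h2 : psiFst σ q - volterra σ q (psiFst σ q) = planeWave := h
  rw [sub_eq_iff_eq_add] at h2
  exact h2

theorem sliceL_opA {q : ℝ × ℝ → ℂ} (hq : LineDominated q) (k : ℝ) (f : BC ℝ) :
    sliceL k (opA q f) = opA q (sliceL k f) := by
  ext u x y
  rw [sliceL_apply, opA_apply hq, opA_apply hq]; rfl

theorem sliceL_opB (σ : ℝ) {q : ℝ × ℝ → ℂ} (hq : LineDominated q) (k : ℝ) (f : BC ℝ) :
    sliceL k (opB σ q f) = opB σ q (sliceL k f) := by
  ext u x y
  rw [sliceL_apply, opB_apply σ hq, opB_apply σ hq]; rfl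

/-- The first component of the spectral function at `k`. -/
def psiOne (σ : ℝ) (q : ℝ × ℝ → ℂ) (k : ℝ) : BC Unit := sliceL k (psiFst σ q)

/-- The second component of the spectral function at `k`. -/
def psiTwo (σ : ℝ) (q : ℝ × ℝ → ℂ) (k : ℝ) : BC Unit := sliceL k (psiSnd σ q)

section

variable {σ : ℝ} {q : ℝ × ℝ → ℂ}

theorem psiOne_eq (hσ : |σ| ≤ 1) (hq : SobolevReg 3 q) (k : ℝ) :
    psiOne σ q k = sliceL k planeWave + opA q (psiTwo σ q k) := by
  rw [psiOne, psiFst_eq hσ hq, map_add, sliceL_opA hq.lineDominated]; rfl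

theorem psiTwo_eq (hq : SobolevReg 3 q) (k : ℝ) :
    psiTwo σ q k = opB σ q (psiOne σ q k) := by
  rw [psiTwo, psiSnd, sliceL_opB σ hq.lineDominated]; rfl

/-- Continuity and boundedness put the second component into `BC Unit`, so the differential equation
and its limit at −∞ integrate to an integral equation. -/
theorem IsPsi.eq₁ {k : ℝ} {ψ : ℝ × ℝ → ℂ × ℂ} (h : IsPsi σ q k ψ) (hq : LineDominated q)
    (x y : ℝ) : (ψ (x, y)).1 = Complex.exp (Complex.I * k * y)
      - (1 / 2) * ∫ t in Set.Iic x, q (t, y) * (ψ (t, y)).2 := by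
  obtain ⟨C, hC⟩ := h.bounded
  let f : BC Unit := BC.mk (fun z => (ψ z.2).2) (continuous_snd.comp (h.continuous.comp (by fun_prop)))
    ⟨C, fun z => (norm_snd_le _).trans (hC _)⟩
  have := eq_opA_of_hasDerivAt hq f (p := ()) (fun x => h.dirac₁ x y) (h.boundary₁ y) x
  rw [this, opA_apply hq]
  simp only [f, BC.mk_apply]; ring

theorem IsPsi.eq₂ {k : ℝ} {ψ : ℝ × ℝ → ℂ × ℂ} (h : IsPsi σ q k ψ) (hq : LineDominated q)
    (x y : ℝ) : (ψ (x, y)).2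
      = σ / 2 * ∫ t in Set.Ioi y, starRingEnd ℂ (q (x, t)) * (ψ (x, t)).1 := by
  obtain ⟨C, hC⟩ := h.bounded
  let f : BC Unit := BC.mk (fun z => (ψ z.2).1) (continuous_fst.comp (h.continuous.comp (by fun_prop)))
    ⟨C, fun z => (norm_fst_le _).trans (hC _)⟩
  have := eq_opB_of_hasDerivAt σ hq f (p := ()) (fun y => h.dirac₂ x y) (h.boundary₂ x) y
  rw [this, opB_apply σ hq, zero_add]
  simp only [f, BC.mk_apply]

theorem isPsi_of_dirac {f g : BC Unit} (hq : LineDominated q) {k : ℝ}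
    (hf : f = sliceL k planeWave + opA q g) (hg : g = opB σ q f) :
    IsPsi σ q k (fun p => (f ((), p), g ((), p))) where
  continuous := (f.continuous.comp (by fun_prop)).prodMk (g.continuous.comp (by fun_prop))
  bounded := ⟨max ‖f‖ ‖g‖, fun p => by
    rw [Prod.norm_mk]; exact max_le_max (f.norm_apply_le _) (g.norm_apply_le _)⟩
  dirac₁ x y := by
    have := (hasDerivAt_opA hq g () x y).const_add (Complex.exp (Complex.I * k * y))
    refine this.congr_of_eventuallyEq (Eventually.of_forall fun s => ?_)
    dsimp only
    rw [hf]; rfl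
  dirac₂ x y := by
    have := hasDerivAt_opB σ hq f () x y
    rw [← hg] at this; exact this
  boundary₁ y := by
    have := (tendsto_opA hq g () y).const_add (Complex.exp (Complex.I * k * y))
    rw [add_zero] at this
    refine this.congr fun s => ?_
    dsimp only
    rw [hf]; rfl
  boundary₂ x := by
    have := tendsto_opB σ hq f () x
    rw [← hg] at this; exact this

theorem isPsi_psi (hσ : |σ| ≤ 1) (hq : SobolevReg 3 q) (k : ℝ) :
    IsPsi σ q k (fun p => (psiOne σ q k ((), p), psiTwo σ q k ((), p))) :=
  isPsi_of_dirac hq.lineDominated (psiOne_eq hσ hq k) (psiTwo_eq hq k)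

/-- Uniqueness is proved for the integral equations, because φ is given by integral equations and
reaches this form after the swap, while ψ reaches it after integration. -/
theorem eq_psi_of_integral (hσ : |σ| ≤ 1) (hq : SobolevReg 3 q) {k : ℝ} {ψ : ℝ × ℝ → ℂ × ℂ}
    (hc : Continuous ψ) (hb : ∃ C : ℝ, ∀ p, ‖ψ p‖ ≤ C)
    (h₁ : ∀ x y, (ψ (x, y)).1 = Complex.exp (Complex.I * k * y)
      - (1 / 2) * ∫ t in Set.Iic x, q (t, y) * (ψ (t, y)).2)
    (h₂ : ∀ x y, (ψ (x, y)).2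
      = σ / 2 * ∫ t in Set.Ioi y, starRingEnd ℂ (q (x, t)) * (ψ (x, t)).1) :
    ψ = fun p => (psiOne σ q k ((), p), psiTwo σ q k ((), p)) := by
  obtain ⟨C, hC⟩ := hb
  let f : BC Unit := BC.mk (fun z => (ψ z.2).1) (continuous_fst.comp (hc.comp (by fun_prop)))
    ⟨C, fun z => (norm_fst_le _).trans (hC _)⟩
  let g : BC Unit := BC.mk (fun z => (ψ z.2).2) (continuous_snd.comp (hc.comp (by fun_prop)))
    ⟨C, fun z => (norm_snd_le _).trans (hC _)⟩
  have hf : f = sliceL k planeWave + opA q g := by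
    ext u x y
    rw [BC.add_apply, opA_apply hq.lineDominated]
    change (ψ (x, y)).1 = _
    rw [h₁ x y]
    simp only [sliceL_apply, planeWave_apply, g, BC.mk_apply]; ring
  have hg : g = opB σ q f := by
    ext u x y
    rw [opB_apply σ hq.lineDominated]
    exact h₂ x y
  have hfeq : f = psiOne σ q k := by
    refine eq_of_volterra hσ hq (e := sliceL k planeWave) ?_ ?_
    · rw [← hg]; exact hf
    · rw [← psiTwo_eq hq]; exact psiOne_eq hσ hq k
  have hgeq : g = psiTwo σ q k := by rw [hg, hfeq, psiTwo_eq hq]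
  funext p
  rw [← hfeq, ← hgeq]; rfl

theorem IsPsi.eq (hσ : |σ| ≤ 1) (hq : SobolevReg 3 q) {k : ℝ} {ψ : ℝ × ℝ → ℂ × ℂ}
    (h : IsPsi σ q k ψ) : ψ = fun p => (psiOne σ q k ((), p), psiTwo σ q k ((), p)) :=
  eq_psi_of_integral hσ hq h.continuous h.bounded (h.eq₁ hq.lineDominated)
    (h.eq₂ hq.lineDominated)

theorem existsUnique_isPsi (hσ : |σ| ≤ 1) (hq : SobolevReg 3 q) (k : ℝ) :
    ∃! ψ, IsPsi σ q k ψ :=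
  ⟨_, isPsi_psi hσ hq k, fun _ h => h.eq hσ hq⟩

/-- The potential with the roles of `ξ` and `η` interchanged. -/
def negSwap (q : ℝ × ℝ → ℂ) : ℝ × ℝ → ℂ := fun p => -q p.swap

/-- With ξ and η exchanged and `q` replaced by its negative, the equations for φ are those for ψ:
the sign of the potential absorbs the opposite signs in front of both integrals. -/
theorem IsPhi.eq (hσ : |σ| ≤ 1) (hq : SobolevReg 3 (negSwap q)) {l : ℝ} {φ : ℝ × ℝ → ℂ × ℂ}
    (h : IsPhi σ q l φ) : φ = fun p => (psiOne σ (negSwap q) l ((), p.swap),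
      psiTwo σ (negSwap q) l ((), p.swap)) := by
  obtain ⟨C, hC⟩ := h.bounded
  have := eq_psi_of_integral hσ hq (k := l) (ψ := fun p => φ p.swap)
    (h.continuous.comp continuous_swap) ⟨C, fun p => hC _⟩ (fun x y => by
      rw [Prod.swap_prod_mk, h.eq₁]
      simp only [negSwap, Prod.swap_prod_mk, neg_mul, integral_neg]; ring) (fun x y => by
      rw [Prod.swap_prod_mk, h.eq₂]
      simp only [negSwap, Prod.swap_prod_mk, neg_mul, integral_neg, map_neg]; ring)
  funext p
  have h2 := congrFun this p.swap
  simpa using h2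

theorem isPhi_psi (hσ : |σ| ≤ 1) (hq : SobolevReg 3 (negSwap q)) (l : ℝ) :
    IsPhi σ q l (fun p => (psiOne σ (negSwap q) l ((), p.swap),
      psiTwo σ (negSwap q) l ((), p.swap))) := by
  have h := isPsi_psi hσ hq l
  refine ⟨h.continuous.comp continuous_swap, ?_, fun x y => ?_, fun x y => ?_⟩
  · obtain ⟨C, hC⟩ := h.bounded
    exact ⟨C, fun p => hC p.swap⟩
  · have := h.eq₁ hq.lineDominated y x
    simp only [negSwap, Prod.swap_prod_mk, neg_mul, integral_neg] at this ⊢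
    rw [this]; ring
  · have := h.eq₂ hq.lineDominated y x
    simp only [negSwap, Prod.swap_prod_mk, neg_mul, integral_neg, map_neg] at this ⊢
    rw [this]; ring

theorem existsUnique_isPhi (hσ : |σ| ≤ 1) (hq : SobolevReg 3 (negSwap q)) (l : ℝ) :
    ∃! φ, IsPhi σ q l φ :=
  ⟨_, isPhi_psi hσ hq l, fun _ h => h.eq hσ hq⟩

end

/-! ### Derivatives of the spectral functions in `ξ` and `η` -/

section Translation

variable {P : Type*} [TopologicalSpace P]

/-- Evaluation at a point. -/
def evalL (z : P × ℝ × ℝ) : BC P →L[ℝ] ℂ :=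
  LinearMap.mkContinuous
    { toFun := fun f => f z
      map_add' := fun _ _ => rfl
      map_smul' := fun _ _ => rfl } 1 fun f => by
    rw [one_mul]; exact f.norm_apply_le z

/-- `f'` is the derivative of `f` in the direction `v`, uniformly. -/
def HasTransDeriv (v : ℝ × ℝ) (f f' : BC P) : Prop :=
  HasDerivAt (fun h : ℝ => translateL (h • v) f) f' 0

theorem translateL_zero (f : BC P) : translateL 0 f = f := by
  ext p x y; simp

namespace HasTransDeriv

variable {v : ℝ × ℝ} {f f' g g' : BC P}

/-- Point evaluation is a continuous linear functional, so a derivative in the supremum norm is one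
at each point. -/
theorem hasDerivAt_fst (h : HasTransDeriv (1, 0) f f') (p : P) (x y : ℝ) :
    HasDerivAt (fun s => f (p, s, y)) (f' (p, x, y)) x := by
  have h1 : HasDerivAt (fun h : ℝ => f (p, x + (h • ((1 : ℝ), (0 : ℝ))).1,
      y + (h • ((1 : ℝ), (0 : ℝ))).2)) (f' (p, x, y)) 0 :=
    (evalL (p, x, y)).hasFDerivAt.comp_hasDerivAt 0 h
  simp only [Prod.smul_mk, smul_eq_mul, mul_one, mul_zero, add_zero] at h1
  have h2 : HasDerivAt (fun h : ℝ => f (p, x + h, y)) (f' (p, x, y)) (-x + x) := by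
    rwa [neg_add_cancel]
  simpa using h2.comp_const_add (-x) x

theorem hasDerivAt_snd (h : HasTransDeriv (0, 1) f f') (p : P) (x y : ℝ) :
    HasDerivAt (fun s => f (p, x, s)) (f' (p, x, y)) y := by
  have h1 : HasDerivAt (fun h : ℝ => f (p, x + (h • ((0 : ℝ), (1 : ℝ))).1,
      y + (h • ((0 : ℝ), (1 : ℝ))).2)) (f' (p, x, y)) 0 :=
    (evalL (p, x, y)).hasFDerivAt.comp_hasDerivAt 0 h
  simp only [Prod.smul_mk, smul_eq_mul, mul_one, mul_zero, add_zero] at h1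
  have h2 : HasDerivAt (fun h : ℝ => f (p, x, y + h)) (f' (p, x, y)) (-y + y) := by
    rwa [neg_add_cancel]
  simpa using h2.comp_const_add (-y) y

theorem add (hf : HasTransDeriv v f f') (hg : HasTransDeriv v g g') :
    HasTransDeriv v (f + g) (f' + g') := by
  unfold HasTransDeriv
  simp_rw [map_add]
  exact HasDerivAt.fun_add hf hg

end HasTransDeriv

/-- `q'` is the derivative of the potential `q` in the direction `v`. -/
def HasPotDeriv (v : ℝ × ℝ) (q q' : ℝ × ℝ → ℂ) : Prop :=
  LineFamily Set.univ (fun s p => q (p + s • v)) (fun s p => q' (p + s • v)) 0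

theorem HasPotDeriv.dominated {v : ℝ × ℝ} {q q' : ℝ × ℝ → ℂ} (h : HasPotDeriv v q q') :
    LineDominated q := by
  have := LineFamily.dominated h 0 (Set.mem_univ _)
  simpa using this

theorem SobolevReg.hasPotDeriv_fst {n : ℕ} {q : ℝ × ℝ → ℂ} (h : SobolevReg (n + 2) q) :
    HasPotDeriv (1, 0) q (DS1.dXi q) where
  dominated _ _ := h.lineDominated.comp_add _
  dominated_deriv := h.dXi.lineDominated.comp_add _
  hasDeriv s _ p := by
    simp only [Prod.add_def, Prod.smul_mk, smul_eq_mul, mul_one, mul_zero, add_zero]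
    exact ((h.hasDerivAt_fst (p.1 + s) p.2).comp_const_add p.1 s).hasDerivWithinAt
  tendsto := by
    rw [nhdsWithin_univ]
    simpa using h.dXi.tendsto_lineNorm_translate (1, 0)

theorem SobolevReg.hasPotDeriv_snd {n : ℕ} {q : ℝ × ℝ → ℂ} (h : SobolevReg (n + 2) q) :
    HasPotDeriv (0, 1) q (DS1.dEta q) where
  dominated _ _ := h.lineDominated.comp_add _
  dominated_deriv := h.dEta.lineDominated.comp_add _
  hasDeriv s _ p := by
    simp only [Prod.add_def, Prod.smul_mk, smul_eq_mul, mul_one, mul_zero, add_zero]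
    exact ((h.hasDerivAt_snd p.1 (p.2 + s)).comp_const_add p.2 s).hasDerivWithinAt
  tendsto := by
    rw [nhdsWithin_univ]
    simpa using h.dEta.tendsto_lineNorm_translate (0, 1)

variable [FirstCountableTopology P]

theorem translateL_opA {q : ℝ × ℝ → ℂ} (hq : LineDominated q) (v : ℝ × ℝ) (f : BC P) :
    translateL v (opA q f) = opA (fun p => q (p + v)) (translateL v f) := by
  rw [opA_eq, opA_eq, map_smul, translateL_intLeft hq]

theorem translateL_opB (σ : ℝ) {q : ℝ × ℝ → ℂ} (hq : LineDominated q) (v : ℝ × ℝ) (f : BC P) :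
    translateL v (opB σ q f) = opB σ (fun p => q (p + v)) (translateL v f) := by
  rw [opB_eq, opB_eq, map_smul, translateL_intRight hq.conj]

namespace LineFamily

variable {S : Set ℝ} {q q' : ℝ → ℝ × ℝ → ℂ} {t : ℝ}

theorem hasDerivWithinAt_opA (h : LineFamily S q q' t) (hS : S.OrdConnected) (ht : t ∈ S) :
    HasDerivWithinAt (fun s => (opA (q s) : BC P →L[ℝ] BC P)) (opA (q' t)) S t :=
  (h.hasDerivWithinAt_intLeft hS ht).const_smul (-(1 / 2) : ℝ)

theorem hasDerivWithinAt_opB (σ : ℝ) (h : LineFamily S q q' t) (hS : S.OrdConnected)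
    (ht : t ∈ S) :
    HasDerivWithinAt (fun s => (opB σ (q s) : BC P →L[ℝ] BC P)) (opB σ (q' t)) S t :=
  (h.conj.hasDerivWithinAt_intRight hS ht).const_smul (σ / 2)

theorem hasDerivWithinAt_volterra (σ : ℝ) (h : LineFamily S q q' t) (hS : S.OrdConnected)
    (ht : t ∈ S) :
    HasDerivWithinAt (fun s => (1 - volterra σ (q s) : BC P →L[ℝ] BC P))
      (-(opA (q' t) * opB σ (q t) + opA (q t) * opB σ (q' t))) S t := by
  exact HasDerivWithinAt.const_sub 1
    (HasDerivWithinAt.mul (h.hasDerivWithinAt_opA (P := P) hS ht) (h.hasDerivWithinAt_opB σ hS ht))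

/-- Solutions of the Dirac system depend differentiably on the potential. -/
theorem exists_hasDerivWithinAt {σ : ℝ} (h : LineFamily S q q' t) (hS : S.OrdConnected)
    (ht : t ∈ S) (hu : IsUnit (1 - volterra σ (q t) : BC P →L[ℝ] BC P)) {f g : ℝ → BC P}
    {g' : BC P} (hg : HasDerivWithinAt g g' S t)
    (hf : ∀ s ∈ S, f s = g s + opA (q s) (opB σ (q s) (f s))) :
    ∃ f', HasDerivWithinAt f f' S t ∧
      f' = g' + opA (q' t) (opB σ (q t) (f t)) + opA (q t) (opB σ (q' t) (f t))
        + opA (q t) (opB σ (q t) f') := by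
  obtain ⟨f', hf', heq⟩ := exists_hasDerivWithinAt_of_apply_eq ht hu
    (h.hasDerivWithinAt_volterra (P := P) σ hS ht) hg (fun s hs => by
      change f s - opA (q s) (opB σ (q s) (f s)) = g s
      rw [sub_eq_iff_eq_add]; exact hf s hs)
  refine ⟨f', hf', ?_⟩
  have heq2 : f' - opA (q t) (opB σ (q t) f')
      = g' - -(opA (q' t) (opB σ (q t) (f t)) + opA (q t) (opB σ (q' t) (f t))) := heq
  rw [sub_eq_iff_eq_add] at heq2
  rw [sub_neg_eq_add, ← add_assoc] at heq2
  exact heq2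

end LineFamily

namespace HasTransDeriv

variable {v : ℝ × ℝ} {f f' g g' : BC P} {q q' : ℝ × ℝ → ℂ}

theorem opA (hf : HasTransDeriv v f f') (hq : HasPotDeriv v q q') :
    HasTransDeriv v (opA q f) (DS1.opA q' f + DS1.opA q f') := by
  have h1 := LineFamily.hasDerivWithinAt_opA (P := P) hq Set.ordConnected_univ (Set.mem_univ _)
  rw [hasDerivWithinAt_univ] at h1
  have h2 := h1.clm_apply hf
  simp only [translateL_zero, zero_smul, add_zero] at h2
  refine h2.congr_of_eventuallyEq (Eventually.of_forall fun s => ?_)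
  exact translateL_opA hq.dominated _ _

theorem opB (σ : ℝ) (hf : HasTransDeriv v f f') (hq : HasPotDeriv v q q') :
    HasTransDeriv v (opB σ q f) (DS1.opB σ q' f + DS1.opB σ q f') := by
  have h1 := LineFamily.hasDerivWithinAt_opB (P := P) σ hq Set.ordConnected_univ (Set.mem_univ _)
  rw [hasDerivWithinAt_univ] at h1
  have h2 := h1.clm_apply hf
  simp only [translateL_zero, zero_smul, add_zero] at h2
  refine h2.congr_of_eventuallyEq (Eventually.of_forall fun s => ?_)
  exact translateL_opB σ hq.dominated _ _

/-- The translates of `f` solve the Volterra equation with translated potential and inhomogeneity,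
so differentiable dependence on the potential applies at translation 0. -/
theorem exists_of_volterra {σ : ℝ} (hg : HasTransDeriv v g g') (hq : HasPotDeriv v q q')
    (hu : IsUnit (1 - volterra σ q : BC P →L[ℝ] BC P))
    (hf : f = g + DS1.opA q (DS1.opB σ q f)) :
    ∃ f', HasTransDeriv v f f' ∧
      f' = g' + DS1.opA q' (DS1.opB σ q f) + DS1.opA q (DS1.opB σ q' f)
        + DS1.opA q (DS1.opB σ q f') := by
  have h := LineFamily.exists_hasDerivWithinAt (P := P) (σ := σ) hq Set.ordConnected_univ
    (Set.mem_univ _) (by simpa using hu) (f := fun s => translateL (s • v) f)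
    (g := fun s => translateL (s • v) g) (g' := g')
    (by rw [hasDerivWithinAt_univ]; exact hg) (fun s _ => by
      rw [← translateL_opB σ hq.dominated, ← translateL_opA hq.dominated, ← map_add, ← hf])
  obtain ⟨f', hf', he⟩ := h
  rw [hasDerivWithinAt_univ] at hf'
  refine ⟨f', hf', ?_⟩
  simpa only [translateL_zero, zero_smul, add_zero] using he

end HasTransDeriv

/-- The first derivative solves a Volterra equation with the same operator and a new inhomogeneity
that is again differentiable, so the differentiation can be repeated. -/
theorem exists_second_transDeriv {σ : ℝ} {v : ℝ × ℝ} {q q' q'' : ℝ × ℝ → ℂ}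
    (hu : IsUnit (1 - volterra σ q : BC P →L[ℝ] BC P)) (hq : HasPotDeriv v q q')
    (hq' : HasPotDeriv v q' q'') {e e' e'' f g : BC P} (he : HasTransDeriv v e e')
    (he' : HasTransDeriv v e' e'') (hf : f = e + opA q g) (hg : g = opB σ q f) :
    ∃ f' g' f'' g'' : BC P, HasTransDeriv v f f' ∧ HasTransDeriv v f' f'' ∧
      HasTransDeriv v g g' ∧ HasTransDeriv v g' g'' ∧
      f' = e' + opA q' g + opA q g' ∧ g' = opB σ q' f + opB σ q f' ∧
      f'' = e'' + opA q'' g + (2 : ℝ) • opA q' g' + opA q g'' ∧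
      g'' = opB σ q'' f + (2 : ℝ) • opB σ q' f' + opB σ q f'' := by
  obtain ⟨f', hf', hfe⟩ := he.exists_of_volterra hq hu (f := f) (by rw [← hg]; exact hf)
  have hg' : HasTransDeriv v g (opB σ q' f + opB σ q f') := by
    have := hf'.opB σ hq; rwa [← hg] at this
  rw [← hg] at hfe
  -- The inhomogeneity of the equation for the first derivative, and its own derivative.
  have hr : HasTransDeriv v (e' + opA q' g + opA q (opB σ q' f))
      (e'' + (opA q'' g + opA q' (opB σ q' f + opB σ q f'))
        + (opA q' (opB σ q' f) + opA q (opB σ q'' f + opB σ q' f'))) :=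
    (he'.add (hg'.opA hq')).add ((hf'.opB σ hq').opA hq)
  obtain ⟨f'', hf'', hfe'⟩ := hr.exists_of_volterra hq hu hfe
  have hg'' := (hf'.opB σ hq').add (hf''.opB σ hq)
  refine ⟨f', _, f'', _, hf', hf'', hg', hg'', ?_, rfl, ?_, ?_⟩
  · rw [map_add]
    conv_lhs => rw [hfe]
    abel
  · conv_lhs => rw [hfe']
    simp only [map_add, two_smul]
    abel
  · rw [two_smul]; abel

end Translation

/-! ### Continuity in time -/

open Classical in
/-- A function of `(ξ, η)` as an element of `BC Unit`, if it is bounded and continuous. -/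
def BC.ofFun (f : ℝ × ℝ → ℂ) : BC Unit :=
  if h : Continuous f ∧ ∃ C : ℝ, ∀ p, ‖f p‖ ≤ C then
    BC.mk (fun z => f z.2) (h.1.comp continuous_snd) (h.2.imp fun _ hC z => hC z.2)
  else 0

theorem BC.ofFun_apply {f : ℝ × ℝ → ℂ} (hf : Continuous f) (hb : ∃ C : ℝ, ∀ p, ‖f p‖ ≤ C)
    (u : Unit) (p : ℝ × ℝ) : BC.ofFun f (u, p) = f p := by
  rw [BC.ofFun, dif_pos ⟨hf, hb⟩]; rfl

/-- The constant function. -/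
def BC.const (c : ℂ) : BC Unit := BC.mk (fun _ => c) continuous_const ⟨‖c‖, fun _ => le_rfl⟩

@[simp] theorem BC.const_apply (c : ℂ) (z : Unit × ℝ × ℝ) : BC.const c z = c := rfl

theorem SobolevReg.ofFun_apply {n : ℕ} {q : ℝ × ℝ → ℂ} (h : SobolevReg (n + 2) q) (u : Unit)
    (p : ℝ × ℝ) : BC.ofFun q (u, p) = q p := BC.ofFun_apply h.continuous h.exists_bound u p

theorem SobolevReg.ofFun_conj_apply {n : ℕ} {q : ℝ × ℝ → ℂ} (h : SobolevReg (n + 2) q) (u : Unit)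
    (p : ℝ × ℝ) : BC.ofFun (fun p => starRingEnd ℂ (q p)) (u, p) = starRingEnd ℂ (q p) :=
  BC.ofFun_apply (Complex.continuous_conj.comp h.continuous)
    (h.exists_bound.imp fun _ hC p => (RCLike.norm_conj (q p)).trans_le (hC p)) u p

theorem continuousWithinAt_of_enorm_le {V : Type*} [NormedAddCommGroup V] {f : ℝ → V} {S : Set ℝ}
    {t : ℝ} {B : ℝ → ℝ≥0∞} (hB : Tendsto B (𝓝[S] t) (𝓝 0))
    (h : ∀ s ∈ S, ‖f s - f t‖ₑ ≤ B s) : ContinuousWithinAt f S t := by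
  refine tendsto_iff_edist_tendsto_0.2 (tendsto_of_tendsto_of_tendsto_of_le_of_le'
    tendsto_const_nhds hB (Eventually.of_forall fun _ => zero_le) ?_)
  filter_upwards [self_mem_nhdsWithin] with s hs
  rw [edist_eq_enorm_sub]; exact h s hs

theorem BC.enorm_le {f : BC Unit} {B : ℝ≥0∞} (h : ∀ z, ‖f z‖ₑ ≤ B) : ‖f‖ₑ ≤ B := by
  by_cases hB : B = ∞
  · rw [hB]; exact le_top
  rw [← ofReal_norm]
  refine ENNReal.ofReal_le_of_le_toReal ((BC.norm_le ENNReal.toReal_nonneg).2 fun z => ?_)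
  rw [← toReal_enorm]
  exact ENNReal.toReal_mono hB (h z)

theorem enorm_conj (z : ℂ) : ‖starRingEnd ℂ z‖ₑ = ‖z‖ₑ := by
  rw [← ofReal_norm, RCLike.norm_conj, ofReal_norm]

theorem RegularOn.continuousOn_ofFun {n : ℕ} {T : ℝ} {f : ℝ → ℝ × ℝ → ℂ}
    (h : RegularOn (n + 2) T f) : ContinuousOn (fun s => BC.ofFun (f s)) (Set.Icc 0 T) := by
  intro t ht
  obtain ⟨B, hB, hle⟩ := h.exists_tendsto_sup ht
  refine continuousWithinAt_of_enorm_le hB fun s hs => BC.enorm_le fun z => ?_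
  rw [BC.sub_apply, (h.sobolevReg hs).ofFun_apply, (h.sobolevReg ht).ofFun_apply]
  exact hle s hs _

theorem RegularOn.continuousOn_ofFun_conj {n : ℕ} {T : ℝ} {f : ℝ → ℝ × ℝ → ℂ}
    (h : RegularOn (n + 2) T f) :
    ContinuousOn (fun s => BC.ofFun (fun p => starRingEnd ℂ (f s p))) (Set.Icc 0 T) := by
  intro t ht
  obtain ⟨B, hB, hle⟩ := h.exists_tendsto_sup ht
  refine continuousWithinAt_of_enorm_le hB fun s hs => BC.enorm_le fun z => ?_
  rw [BC.sub_apply, (h.sobolevReg hs).ofFun_conj_apply, (h.sobolevReg ht).ofFun_conj_apply,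
    ← map_sub, enorm_conj]
  exact hle s hs _

theorem continuousWithinAt_intLeft {S : Set ℝ} {q : ℝ → ℝ × ℝ → ℂ} {t : ℝ}
    (hq : ∀ s ∈ S, LineDominated (q s)) (ht : t ∈ S)
    (h : Tendsto (fun s => lineNorm (fun p => q s p - q t p)) (𝓝[S] t) (𝓝 0)) :
    ContinuousWithinAt (fun s => (intLeft (q s) : BC Unit →L[ℝ] BC Unit)) S t := by
  refine continuousWithinAt_of_enorm_le h fun s hs => ?_
  rw [← intLeft_sub (hq s hs) (hq t ht)]
  exact enorm_intLeft_le _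

theorem RegularOn.continuousOn_intLeft {n : ℕ} {T : ℝ} {f : ℝ → ℝ × ℝ → ℂ}
    (h : RegularOn (n + 1) T f) :
    ContinuousOn (fun s => (intLeft (f s) : BC Unit →L[ℝ] BC Unit)) (Set.Icc 0 T) :=
  fun _ ht => continuousWithinAt_intLeft (fun _ hs => (h.sobolevReg hs).lineDominated) ht
    (h.tendsto_lineNorm ht)

theorem RegularOn.continuousOn_intLeft_conj {n : ℕ} {T : ℝ} {f : ℝ → ℝ × ℝ → ℂ}
    (h : RegularOn (n + 1) T f) :
    ContinuousOn (fun s => (intLeft (fun p => starRingEnd ℂ (f s p)) : BC Unit →L[ℝ] BC Unit))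
      (Set.Icc 0 T) :=
  fun _ ht => continuousWithinAt_intLeft (fun _ hs => (h.sobolevReg hs).lineDominated.conj) ht
    ((h.tendsto_lineNorm ht).congr fun _ => lineNorm_congr fun p => by
      rw [← map_sub, enorm_conj])

/-! ### The mean fields -/

theorem ofReal_cross (q u : ℂ) :
    (cross q u : ℂ) = q * starRingEnd ℂ u + starRingEnd ℂ q * u := by
  apply Complex.ext <;> simp [cross]
  ring

theorem hasDerivAt_conj {f : ℝ → ℂ} {f' : ℂ} {x : ℝ} (h : HasDerivAt f f' x) :
    HasDerivAt (fun s => starRingEnd ℂ (f s)) (starRingEnd ℂ f') x :=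
  (Complex.conjCLE : ℂ →L[ℝ] ℂ).hasFDerivAt.comp_hasDerivAt x h

theorem hasDerivAt_cross {f g : ℝ → ℂ} {f' g' : ℂ} {x : ℝ} (hf : HasDerivAt f f' x)
    (hg : HasDerivAt g g' x) :
    HasDerivAt (fun s => cross (f s) (g s)) (cross f' (g x) + cross (f x) g') x := by
  have h := (hf.mul (hasDerivAt_conj hg)).add ((hasDerivAt_conj hf).mul hg)
  have h2 := Complex.reCLM.hasFDerivAt.comp_hasDerivAt x h
  refine h2.congr_deriv ?_
  simp only [Complex.reCLM_apply, cross, Complex.add_re]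
  ring

theorem dEta_cross {f g : ℝ × ℝ → ℂ} (hf : Differentiable ℝ f) (hg : Differentiable ℝ g)
    (p : ℝ × ℝ) : dEta (fun r => cross (f r) (g r)) p
      = cross (dEta f p) (g p) + cross (f p) (dEta g p) :=
  (hasDerivAt_cross (hasDerivAt_dEta hf p.1 p.2) (hasDerivAt_dEta hg p.1 p.2)).deriv

theorem dXi_cross {f g : ℝ × ℝ → ℂ} (hf : Differentiable ℝ f) (hg : Differentiable ℝ g)
    (p : ℝ × ℝ) : dXi (fun r => cross (f r) (g r)) p
      = cross (dXi f p) (g p) + cross (f p) (dXi g p) :=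
  (hasDerivAt_cross (hasDerivAt_dXi hf p.1 p.2) (hasDerivAt_dXi hg p.1 p.2)).deriv

/-- A mean field given by its boundary values and its `ξ`-derivative is bounded and continuous, and
depends continuously on time. -/
theorem exists_meanField {T c : ℝ} {A B : ℝ → ℝ × ℝ → ℂ} (hA : RegularOn 3 T A)
    (hB : RegularOn 3 T B) {u : ℝ → ℝ} (hu : Continuous u) (hub : ∃ C, ∀ y, |u y| ≤ C)
    {G : ℝ → ℝ × ℝ → ℝ}
    (hd : ∀ t ∈ Set.Icc 0 T, ∀ ξ η, DifferentiableAt ℝ (fun x => G t (x, η)) ξ)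
    (heq : ∀ t ∈ Set.Icc 0 T, ∀ p, dXi (G t) p = c * dEta (fun r => cross (A t r) (B t r)) p)
    (hlim : ∀ t ∈ Set.Icc 0 T, ∀ η, Tendsto (fun ξ => G t (ξ, η)) atBot (𝓝 (u η))) :
    ∃ g : ℝ → BC Unit, ContinuousOn g (Set.Icc 0 T) ∧
      ∀ t ∈ Set.Icc 0 T, ∀ p, g t ((), p) = (G t p : ℂ) := by
  have hA1 : RegularOn 2 T fun t => dEta (A t) := hA.dEta
  have hB1 : RegularOn 2 T fun t => dEta (B t) := hB.dEta
  let uE : BC Unit := BC.mk (fun z => (u z.2.2 : ℂ)) (by fun_prop)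
    (hub.imp fun C hC z => by rw [Complex.norm_real]; exact hC _)
  -- The boundary value plus the integral over ξ' < ξ of the prescribed ξ-derivative. Each of its
  -- four products is split into an integrable factor inside the operator and a bounded factor on
  -- which the operator acts.
  let g : ℝ → BC Unit := fun t => uE + c •
    ((intLeft (dEta (A t)) (BC.ofFun fun p => starRingEnd ℂ (B t p))
      + intLeft (fun p => starRingEnd ℂ (dEta (A t) p)) (BC.ofFun (B t)))
    + (intLeft (fun p => starRingEnd ℂ (dEta (B t) p)) (BC.ofFun (A t))
      + intLeft (dEta (B t)) (BC.ofFun fun p => starRingEnd ℂ (A t p))))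
  refine ⟨g, ?_, fun t ht p => ?_⟩
  · refine continuousOn_const.add (ContinuousOn.const_smul (((ContinuousOn.clm_apply ?_ ?_).add
      (ContinuousOn.clm_apply ?_ ?_)).add ((ContinuousOn.clm_apply ?_ ?_).add
      (ContinuousOn.clm_apply ?_ ?_))) c)
    · exact hA1.continuousOn_intLeft
    · exact hB.continuousOn_ofFun_conj
    · exact hA1.continuousOn_intLeft_conj
    · exact hB.continuousOn_ofFun
    · exact hB1.continuousOn_intLeft_conj
    · exact hA.continuousOn_ofFun
    · exact hB1.continuousOn_intLeft
    · exact hA.continuousOn_ofFun_conj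
  · obtain ⟨x, y⟩ := p
    have rA := hA.sobolevReg ht
    have rB := hB.sobolevReg ht
    have rA1 := (hA1.sobolevReg ht).lineDominated
    have rB1 := (hB1.sobolevReg ht).lineDominated
    -- The difference of candidate and field is constant in ξ and tends to 0 at −∞.
    have hdg : ∀ x, HasDerivAt (fun s => g t ((), s, y) - (G t (s, y) : ℂ)) 0 x := fun x => by
      have e1 := hasDerivAt_intLeft rA1 (BC.ofFun fun p => starRingEnd ℂ (B t p)) () x y
      have e2 := hasDerivAt_intLeft rA1.conj (BC.ofFun (B t)) () x y
      have e3 := hasDerivAt_intLeft rB1.conj (BC.ofFun (A t)) () x y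
      have e4 := hasDerivAt_intLeft rB1 (BC.ofFun fun p => starRingEnd ℂ (A t p)) () x y
      have e5 : HasDerivAt (fun s => (G t (s, y) : ℂ)) (dXi (G t) (x, y) : ℝ) x :=
        ((hd t ht x y).hasDerivAt).ofReal_comp
      have e6 := ((((e1.add e2).add (e3.add e4)).const_smul c).const_add (u y : ℂ)).sub e5
      refine e6.congr_deriv ?_
      rw [heq t ht, dEta_cross rA.differentiable rB.differentiable, rA.ofFun_apply,
        rA.ofFun_conj_apply, rB.ofFun_apply, rB.ofFun_conj_apply, Complex.real_smul]
      push_cast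
      rw [ofReal_cross, ofReal_cross]
      ring
    have hlg : Tendsto (fun s => g t ((), s, y) - (G t (s, y) : ℂ)) atBot (𝓝 0) := by
      have e1 := tendsto_intLeft rA1 (BC.ofFun fun p => starRingEnd ℂ (B t p)) () y
      have e2 := tendsto_intLeft rA1.conj (BC.ofFun (B t)) () y
      have e3 := tendsto_intLeft rB1.conj (BC.ofFun (A t)) () y
      have e4 := tendsto_intLeft rB1 (BC.ofFun fun p => starRingEnd ℂ (A t p)) () y
      have e5 : Tendsto (fun s => (G t (s, y) : ℂ)) atBot (𝓝 (u y : ℂ)) :=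
        (Complex.continuous_ofReal.tendsto _).comp (hlim t ht y)
      have e6 := ((((e1.add e2).add (e3.add e4)).const_smul c).const_add (u y : ℂ)).sub e5
      simp only [add_zero, smul_zero, sub_self] at e6
      exact e6
    have hconst := is_const_of_deriv_eq_zero (fun x => (hdg x).differentiableAt)
      (fun x => (hdg x).deriv)
    have : Tendsto (fun s => g t ((), s, y) - (G t (s, y) : ℂ)) atBot
        (𝓝 (g t ((), x, y) - (G t (x, y) : ℂ))) :=
      tendsto_const_nhds.congr fun s => hconst x s
    exact sub_eq_zero.1 (tendsto_nhds_unique this hlg)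

/-! ### The symmetry between `ξ` and `η` -/

/-- A function with the roles of `ξ` and `η` interchanged. -/
def swapR (G : ℝ × ℝ → ℝ) : ℝ × ℝ → ℝ := fun p => G p.swap

theorem lap_negSwap (f : ℝ × ℝ → ℂ) (p : ℝ × ℝ) : lap (negSwap f) p = -lap f p.swap := by
  unfold lap negSwap
  rw [dXi_neg, dXi_neg, dEta_neg, dEta_neg]
  simp only [dXi_comp_swap, dEta_comp_swap]
  ring

/-- The DS-1 equations are invariant under the exchange of ξ and η together with the two mean fields
and the two boundary values. The sign of Q is irrelevant to them; it is chosen to match the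
equations for φ. -/
theorem IsSolution.swap {σ T : ℝ} {u₁ u₂ : ℝ → ℝ} {Q : ℝ → ℝ × ℝ → ℂ} {G₁ G₂ : ℝ → ℝ × ℝ → ℝ}
    (h : IsSolution σ T u₁ u₂ Q G₁ G₂) : IsSolution σ T u₂ u₁ (fun t => negSwap (Q t))
      (fun t => swapR (G₂ t)) (fun t => swapR (G₁ t)) where
  differentiable_time t ht p := (h.differentiable_time t ht p.swap).neg
  evolution t ht p := by
    have := h.evolution t ht p.swap
    rw [lap_negSwap, show derivWithin (fun s => negSwap (Q s) p) (Set.Icc 0 T) t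
      = -derivWithin (fun s => Q s p.swap) (Set.Icc 0 T) t from derivWithin.fun_neg]
    simp only [swapR, negSwap]
    rw [add_comm (G₂ t p.swap)]
    linear_combination -this
  differentiable_G₁ t ht ξ η := h.differentiable_G₂ t ht η ξ
  differentiable_G₂ t ht ξ η := h.differentiable_G₁ t ht η ξ
  eq_G₁ t ht p := by
    have := h.eq_G₂ t ht p.swap
    simp only [negSwap, norm_neg]
    exact this
  eq_G₂ t ht p := by
    have := h.eq_G₁ t ht p.swap
    simp only [negSwap, norm_neg]
    exact this
  boundary_G₁ t ht η := h.boundary_G₂ t ht η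
  boundary_G₂ t ht ξ := h.boundary_G₁ t ht ξ

theorem IsLinearizedSolution.swap {σ T : ℝ} {Q F U : ℝ → ℝ × ℝ → ℂ}
    {G₁ G₂ V₁ V₂ : ℝ → ℝ × ℝ → ℝ} (h : IsLinearizedSolution σ T Q G₁ G₂ F U V₁ V₂) :
    IsLinearizedSolution σ T (fun t => negSwap (Q t)) (fun t => swapR (G₂ t))
      (fun t => swapR (G₁ t)) (fun t => negSwap (F t)) (fun t => negSwap (U t))
      (fun t => swapR (V₂ t)) (fun t => swapR (V₁ t)) where
  differentiable_time t ht p := (h.differentiable_time t ht p.swap).neg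
  evolution t ht p := by
    have := h.evolution t ht p.swap
    rw [lap_negSwap, show derivWithin (fun s => negSwap (U s) p) (Set.Icc 0 T) t
      = -derivWithin (fun s => U s p.swap) (Set.Icc 0 T) t from derivWithin.fun_neg]
    simp only [swapR, negSwap]
    rw [add_comm (G₂ t p.swap), add_comm (V₂ t p.swap)]
    linear_combination -this
  differentiable_V₁ t ht ξ η := h.differentiable_V₂ t ht η ξ
  differentiable_V₂ t ht ξ η := h.differentiable_V₁ t ht η ξ
  eq_V₁ t ht p := by
    have := h.eq_V₂ t ht p.swap
    simp only [negSwap, cross, map_neg, neg_mul_neg]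
    exact this
  eq_V₂ t ht p := by
    have := h.eq_V₁ t ht p.swap
    simp only [negSwap, cross, map_neg, neg_mul_neg]
    exact this
  boundary_V₁ t ht η := h.boundary_V₂ t ht η
  boundary_V₂ t ht ξ := h.boundary_V₁ t ht ξ

/-- The operator `f ↦ f ∘ swap`. -/
def swapL : BC Unit →L[ℝ] BC Unit := compL ⟨fun z => (z.1, z.2.swap), by fun_prop⟩

@[simp] theorem swapL_apply (f : BC Unit) (z : Unit × ℝ × ℝ) : swapL f z = f (z.1, z.2.swap) := rfl

theorem cross_self (q : ℂ) : cross q q = 2 * ‖q‖ ^ 2 := by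
  have : (cross q q : ℂ) = ((2 * ‖q‖ ^ 2 : ℝ) : ℂ) := by
    rw [ofReal_cross]; push_cast; rw [← Complex.mul_conj']; ring
  exact_mod_cast this

/-- The square |Q|² is half of `cross Q Q`; so the mean fields and their variations are covered by
one lemma, `exists_meanField`. -/
theorem dEta_norm_sq {f : ℝ × ℝ → ℂ} (hf : Differentiable ℝ f) (p : ℝ × ℝ) :
    dEta (fun r => ‖f r‖ ^ 2) p = 1 / 2 * dEta (fun r => cross (f r) (f r)) p := by
  have h := hasDerivAt_cross (hasDerivAt_dEta hf p.1 p.2) (hasDerivAt_dEta hf p.1 p.2)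
  have h1 : HasDerivAt (fun s => ‖f (p.1, s)‖ ^ 2) _ p.2 :=
    (h.const_mul (1 / 2)).congr_of_eventuallyEq (Eventually.of_forall fun s => by
      dsimp only; rw [cross_self]; ring)
  rw [dEta_cross hf hf]
  exact h1.deriv

section MeanFields

variable {σ T : ℝ} {u₁ u₂ : ℝ → ℝ} {Q : ℝ → ℝ × ℝ → ℂ} {G₁ G₂ : ℝ → ℝ × ℝ → ℝ}

theorem IsSolution.exists_G₁ (h : IsSolution σ T u₁ u₂ Q G₁ G₂) (hQ : RegularOn 3 T Q)
    (hu : Continuous u₁) (hub : ∃ C, ∀ y, |u₁ y| ≤ C) :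
    ∃ g : ℝ → BC Unit, ContinuousOn g (Set.Icc 0 T) ∧
      ∀ t ∈ Set.Icc 0 T, ∀ p, g t ((), p) = (G₁ t p : ℂ) :=
  exists_meanField (c := -(σ / 2) * (1 / 2)) hQ hQ hu hub h.differentiable_G₁ (fun t ht p => by
    rw [h.eq_G₁ t ht, dEta_norm_sq (hQ.sobolevReg ht).differentiable, mul_assoc]) h.boundary_G₁

theorem exists_swap {G : ℝ → ℝ × ℝ → ℝ} (h : ∃ g : ℝ → BC Unit, ContinuousOn g (Set.Icc 0 T) ∧
      ∀ t ∈ Set.Icc 0 T, ∀ p, g t ((), p) = (swapR (G t) p : ℂ)) :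
    ∃ g : ℝ → BC Unit, ContinuousOn g (Set.Icc 0 T) ∧
      ∀ t ∈ Set.Icc 0 T, ∀ p, g t ((), p) = (G t p : ℂ) := by
  obtain ⟨g, hg, hgG⟩ := h
  refine ⟨fun t => swapL (g t), swapL.continuous.comp_continuousOn hg, fun t ht p => ?_⟩
  rw [swapL_apply, hgG t ht, swapR, Prod.swap_swap]

theorem IsSolution.exists_G₂ (h : IsSolution σ T u₁ u₂ Q G₁ G₂) (hQ : RegularOn 3 T Q)
    (hu : Continuous u₂) (hub : ∃ C, ∀ y, |u₂ y| ≤ C) :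
    ∃ g : ℝ → BC Unit, ContinuousOn g (Set.Icc 0 T) ∧
      ∀ t ∈ Set.Icc 0 T, ∀ p, g t ((), p) = (G₂ t p : ℂ) :=
  exists_swap (h.swap.exists_G₁ hQ.neg_swap hu hub)

theorem IsLinearizedSolution.exists_V₁ {F U : ℝ → ℝ × ℝ → ℂ} {V₁ V₂ : ℝ → ℝ × ℝ → ℝ}
    (h : IsLinearizedSolution σ T Q G₁ G₂ F U V₁ V₂) (hQ : RegularOn 3 T Q)
    (hU : RegularOn 3 T U) : ∃ g : ℝ → BC Unit, ContinuousOn g (Set.Icc 0 T) ∧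
      ∀ t ∈ Set.Icc 0 T, ∀ p, g t ((), p) = (V₁ t p : ℂ) :=
  exists_meanField hQ hU continuous_const ⟨0, by simp⟩ h.differentiable_V₁ h.eq_V₁ h.boundary_V₁

theorem IsLinearizedSolution.exists_V₂ {F U : ℝ → ℝ × ℝ → ℂ} {V₁ V₂ : ℝ → ℝ × ℝ → ℝ}
    (h : IsLinearizedSolution σ T Q G₁ G₂ F U V₁ V₂) (hQ : RegularOn 3 T Q)
    (hU : RegularOn 3 T U) : ∃ g : ℝ → BC Unit, ContinuousOn g (Set.Icc 0 T) ∧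
      ∀ t ∈ Set.Icc 0 T, ∀ p, g t ((), p) = (V₂ t p : ℂ) :=
  exists_swap (h.swap.exists_V₁ hQ.neg_swap hU.neg_swap)

/-- The time derivative of `Q`. -/
def timeDeriv (Q : ℝ → ℝ × ℝ → ℂ) (G₁ G₂ : ℝ → ℝ × ℝ → ℝ) (t : ℝ) (p : ℝ × ℝ) : ℂ :=
  Complex.I * (lap (Q t) p + ((G₁ t p + G₂ t p : ℝ) : ℂ) * Q t p)

theorem IsSolution.hasDerivWithinAt (h : IsSolution σ T u₁ u₂ Q G₁ G₂) {t : ℝ}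
    (ht : t ∈ Set.Icc 0 T) (p : ℝ × ℝ) :
    HasDerivWithinAt (fun s => Q s p) (timeDeriv Q G₁ G₂ t p) (Set.Icc 0 T) t := by
  refine (h.differentiable_time t ht p).hasDerivWithinAt.congr_deriv ?_
  unfold timeDeriv
  linear_combination -Complex.I * h.evolution t ht p
    + derivWithin (fun s => Q s p) (Set.Icc 0 T) t * Complex.I_mul_I

/-- The equation expresses the time derivative through second derivatives of Q and products with
bounded mean fields. Three derivatives of Q leave one for the second derivatives, which is what
`lineNorm` costs. -/
theorem IsSolution.lineFamily (h : IsSolution σ T u₁ u₂ Q G₁ G₂) (hQ : RegularOn 3 T Q)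
    (hu₁ : Continuous u₁ ∧ ∃ C, ∀ y, |u₁ y| ≤ C) (hu₂ : Continuous u₂ ∧ ∃ C, ∀ y, |u₂ y| ≤ C)
    {t : ℝ} (ht : t ∈ Set.Icc 0 T) :
    LineFamily (Set.Icc 0 T) Q (timeDeriv Q G₁ G₂) t := by
  obtain ⟨g₁, hg₁, hG₁⟩ := h.exists_G₁ hQ hu₁.1 hu₁.2
  obtain ⟨g₂, hg₂, hG₂⟩ := h.exists_G₂ hQ hu₂.1 hu₂.2
  have hxx : RegularOn 1 T fun t => dXi (dXi (Q t)) := (hQ.dXi).dXi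
  have hyy : RegularOn 1 T fun t => dEta (dEta (Q t)) := (hQ.dEta).dEta
  let g : ℝ → BC Unit := fun s => g₁ s + g₂ s
  have hg : ContinuousOn g (Set.Icc 0 T) := hg₁.add hg₂
  have hform : ∀ s ∈ Set.Icc 0 T, timeDeriv Q G₁ G₂ s = fun p => Complex.I *
      ((dXi (dXi (Q s)) p + dEta (dEta (Q s)) p) + g s ((), p) * Q s p) := by
    intro s hs
    funext p
    simp only [timeDeriv, lap, g, BC.add_apply, hG₁ s hs, hG₂ s hs, Complex.ofReal_add]
  have hgc : ∀ s, Continuous fun p : ℝ × ℝ => g s ((), p) := fun s =>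
    (g s).continuous.comp (by fun_prop)
  refine ⟨fun s hs => (hQ.sobolevReg hs).lineDominated, ?_,
    fun s hs p => h.hasDerivWithinAt hs p, ?_⟩
  · rw [hform t ht]
    refine LineDominated.const_mul (((hxx.sobolevReg ht).lineDominated.add
      (hyy.sobolevReg ht).lineDominated).add ?_) _
    exact (hQ.sobolevReg ht).lineDominated.bounded_mul (hgc t) fun p => (g t).norm_apply_le _
  · have hQt := (hQ.sobolevReg ht).lineDominated.lineNorm_ne_top
    -- The product of mean field and Q is split as g(s)(Q(s) − Q(t)) + (g(s) − g(t))Q(t).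
    have hlim : Tendsto (fun s => (lineNorm (fun p => dXi (dXi (Q s)) p - dXi (dXi (Q t)) p)
        + lineNorm (fun p => dEta (dEta (Q s)) p - dEta (dEta (Q t)) p))
        + (‖g s‖ₑ * lineNorm (fun p => Q s p - Q t p) + ‖g s - g t‖ₑ * lineNorm (Q t)))
        (𝓝[Set.Icc 0 T] t) (𝓝 0) := by
      have e1 : Tendsto (fun s => ‖g s‖ₑ) (𝓝[Set.Icc 0 T] t) (𝓝 ‖g t‖ₑ) :=
        (continuous_enorm.tendsto _).comp (hg t ht)
      have e2 : Tendsto (fun s => ‖g s - g t‖ₑ) (𝓝[Set.Icc 0 T] t) (𝓝 0) := by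
        have := (continuous_enorm.tendsto _).comp ((hg t ht).sub (continuousWithinAt_const
          (b := g t)))
        have h0 : ‖g t - g t‖ₑ = 0 := by
          rw [sub_self, ← ofReal_norm, norm_zero, ENNReal.ofReal_zero]
        rw [← h0]
        exact this
      have e3 := ENNReal.Tendsto.mul e1 (Or.inr ENNReal.zero_ne_top) (hQ.tendsto_lineNorm ht)
        (Or.inr enorm_ne_top)
      have e4 := ENNReal.Tendsto.mul_const e2 (Or.inr hQt)
      have := ((hxx.tendsto_lineNorm ht).add (hyy.tendsto_lineNorm ht)).add (e3.add e4)
      simpa using this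
    refine tendsto_of_tendsto_of_tendsto_of_le_of_le' tendsto_const_nhds hlim
      (Eventually.of_forall fun _ => zero_le) ?_
    filter_upwards [self_mem_nhdsWithin] with s hs
    rw [hform s hs, hform t ht]
    have cQs := (hQ.sobolevReg hs).continuous
    have cQt := (hQ.sobolevReg ht).continuous
    have cxx := fun s hs => (hxx.sobolevReg (t := s) hs).continuous
    have cyy := fun s hs => (hyy.sobolevReg (t := s) hs).continuous
    refine le_trans (lineNorm_mono (r := fun p =>
      ((dXi (dXi (Q s)) p - dXi (dXi (Q t)) p) + (dEta (dEta (Q s)) p - dEta (dEta (Q t)) p))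
        + (g s ((), p) * (Q s p - Q t p) + (g s - g t) ((), p) * Q t p)) fun p => ?_) ?_
    · rw [← mul_sub, enorm_mul, ← ofReal_norm Complex.I, Complex.norm_I, ENNReal.ofReal_one, one_mul,
        BC.sub_apply]
      refine le_of_eq (congrArg _ ?_)
      ring
    · refine (lineNorm_add_le (((cxx s hs).sub (cxx t ht)).add ((cyy s hs).sub (cyy t ht)))).trans
        (add_le_add (lineNorm_add_le ((cxx s hs).sub (cxx t ht))) ?_)
      refine (lineNorm_add_le ((hgc s).mul (cQs.sub cQt))).trans (add_le_add ?_ ?_)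
      · exact lineNorm_mul_le (fun p => enorm_le_iff_norm_le.2 ((g s).norm_apply_le _))
          (cQs.sub cQt)
      · exact lineNorm_mul_le
          (fun p => enorm_le_iff_norm_le.2 ((g s - g t).norm_apply_le _)) cQt

end MeanFields

/-! ### Inversion of the convolution kernel -/

theorem kernel_eq_fourier (u : ℝ → ℝ) (k : ℝ) : kernel u k
    = -(Complex.I / (2 * Real.pi)) * 𝓕 (fun x => (u x : ℂ)) (-(2 * Real.pi)⁻¹ * k) := by
  rw [kernel, Real.fourier_eq']
  congr 1
  refine integral_congr_ae (Eventually.of_forall fun x => ?_)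
  simp only [smul_eq_mul]
  rw [mul_comm]
  congr 2
  simp only [RCLike.inner_apply, conj_trivial]
  push_cast
  have : (Real.pi : ℂ) ≠ 0 := by exact_mod_cast Real.pi_ne_zero
  field_simp

/-- Fourier inversion, valid at every point because `u` is continuous and both `u` and its transform
are integrable. This identity is what makes the convolution terms cancel the boundary values of the
mean fields. -/
theorem integral_kernel_mul_exp {u : ℝ → ℝ} (hc : Continuous u) (hi : Integrable u)
    (hk : Integrable (kernel u)) (y : ℝ) :
    ∫ k, kernel u k * Complex.exp (-(Complex.I * k * y)) = -Complex.I * u y := by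
  have hpi : (Real.pi : ℂ) ≠ 0 := by exact_mod_cast Real.pi_ne_zero
  have ha : (-(2 * Real.pi)⁻¹ : ℝ) ≠ 0 := by
    rw [neg_ne_zero]; exact inv_ne_zero (by positivity)
  have hF : Integrable (𝓕 fun x => (u x : ℂ)) := by
    refine (integrable_comp_mul_left_iff _ ha).1 ?_
    refine (hk.const_mul (Complex.I * (2 * Real.pi))).congr (Eventually.of_forall fun k => ?_)
    simp only [kernel_eq_fourier u k]
    field_simp
    simp
  have hinv := congrFun (Continuous.fourierInv_fourier_eq (f := fun x => (u x : ℂ))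
    (by fun_prop) hi.ofReal hF) y
  rw [Real.fourierInv_eq'] at hinv
  -- The substitution v = −k/(2π) passes from the angular frequency to the normalisation of `𝓕`; its
  -- Jacobian 2π cancels the denominator in the kernel.
  have hsub := Measure.integral_comp_mul_left
    (fun v => Complex.exp ((2 * Real.pi * inner ℝ v y : ℝ) * Complex.I)
      • 𝓕 (fun x => (u x : ℂ)) v) (-(2 * Real.pi)⁻¹)
  rw [hinv] at hsub
  have h2 : ∫ k, kernel u k * Complex.exp (-(Complex.I * k * y))
      = ∫ k : ℝ, -(Complex.I / (2 * Real.pi)) *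
        (Complex.exp ((2 * Real.pi * inner ℝ (-(2 * Real.pi)⁻¹ * k) y : ℝ) * Complex.I)
          • 𝓕 (fun x => (u x : ℂ)) (-(2 * Real.pi)⁻¹ * k)) := by
    refine integral_congr_ae (Eventually.of_forall fun k => ?_)
    simp only [kernel_eq_fourier u k, smul_eq_mul]
    rw [mul_assoc, mul_comm (𝓕 (fun x => (u x : ℂ)) _)]
    congr 3
    simp only [RCLike.inner_apply, conj_trivial]
    push_cast
    field_simp
  rw [h2, integral_const_mul, hsub]
  have : |(-(2 * Real.pi)⁻¹)⁻¹| = 2 * Real.pi := by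
    rw [inv_neg, inv_inv, abs_neg, abs_of_pos (by positivity)]
  rw [this, Complex.real_smul]
  push_cast
  field_simp

/-- Boundedness of the boundary values comes for free from Fourier inversion. -/
theorem exists_bound_of_kernel {u : ℝ → ℝ} (hc : Continuous u) (hi : Integrable u)
    (hk : Integrable (kernel u)) : ∃ C, ∀ y, |u y| ≤ C := by
  refine ⟨∫ k, ‖kernel u k‖, fun y => ?_⟩
  have h := norm_integral_le_integral_norm (μ := volume)
    fun k : ℝ => kernel u k * Complex.exp (-(Complex.I * k * y))
  rw [integral_kernel_mul_exp hc hi hk, norm_mul, norm_neg, Complex.norm_I, one_mul,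
    Complex.norm_real] at h
  refine h.trans (le_of_eq (integral_congr_ae (Eventually.of_forall fun k => ?_)))
  simp only [norm_mul, Complex.norm_exp]
  simp

/-! ### Superposition of spectral functions -/

section Superposition

variable {χ : ℝ → ℂ}

/-- The superposition `∫ χ(k') f(k - k') dk'`. -/
def superpose (hχ : Integrable χ) (k : ℝ) (f : BC ℝ) : BC Unit :=
  BC.mk (fun z => ∫ k', χ k' * f (k - k', z.2))
    (continuous_of_dominated (bound := fun k' => ‖χ k'‖ * ‖f‖)
      (fun z => hχ.aestronglyMeasurable.mul (f.continuous.comp (by fun_prop)).aestronglyMeasurable)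
      (fun z => Eventually.of_forall fun k' => by
        rw [norm_mul]; exact mul_le_mul_of_nonneg_left (f.norm_apply_le _) (norm_nonneg _))
      (hχ.norm.mul_const _)
      (Eventually.of_forall fun k' => continuous_const.mul (f.continuous.comp (by fun_prop))))
    ⟨∫ k', ‖χ k'‖ * ‖f‖, fun z => norm_integral_le_of_norm_le (hχ.norm.mul_const _)
      (Eventually.of_forall fun k' => by
        rw [norm_mul]; exact mul_le_mul_of_nonneg_left (f.norm_apply_le _) (norm_nonneg _))⟩

theorem superpose_apply (hχ : Integrable χ) (k : ℝ) (f : BC ℝ) (u : Unit) (p : ℝ × ℝ) :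
    superpose hχ k f (u, p) = ∫ k', χ k' * f (k - k', p) := rfl

theorem integrable_superpose (hχ : Integrable χ) (k : ℝ) (f : BC ℝ) (p : ℝ × ℝ) :
    Integrable fun k' => χ k' * f (k - k', p) :=
  hχ.mul_bdd (c := ‖f‖) (f.continuous.comp (by fun_prop)).aestronglyMeasurable
    (Eventually.of_forall fun _ => f.norm_apply_le _)

theorem superpose_add (hχ : Integrable χ) (k : ℝ) (f g : BC ℝ) :
    superpose hχ k (f + g) = superpose hχ k f + superpose hχ k g := by
  ext u x y
  rw [BC.add_apply, superpose_apply, superpose_apply, superpose_apply,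
    ← integral_add (integrable_superpose hχ k f _) (integrable_superpose hχ k g _)]
  simp only [BC.add_apply, mul_add]

/-- Fubini in k' and `t`. The map `γ` covers the two kinds of coordinate lines as well as the whole
plane. -/
theorem superpose_swap_integral (hχ : Integrable χ) (k : ℝ) (f : BC ℝ) {α : Type*}
    [TopologicalSpace α] [MeasurableSpace α] [OpensMeasurableSpace α] [SecondCountableTopology α]
    {h : α → ℂ} {μ : Measure α} [SFinite μ] (hh : Integrable h μ) (γ : α → ℝ × ℝ)
    (hγ : Continuous γ) :
    ∫ k', χ k' * ∫ t, h t * f (k - k', γ t) ∂μ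
      = ∫ t, h t * superpose hχ k f ((), γ t) ∂μ := by
  simp_rw [superpose_apply, ← integral_const_mul]
  rw [integral_integral_swap]
  · refine integral_congr_ae (Eventually.of_forall fun t => ?_)
    refine integral_congr_ae (Eventually.of_forall fun k' => ?_)
    ring
  · have h1 : Integrable (fun z : ℝ × α => (χ z.1 * h z.2) * f (k - z.1, γ z.2))
        (volume.prod μ) :=
      (hχ.mul_prod hh).mul_bdd (c := ‖f‖) (f.continuous.comp (by fun_prop)).aestronglyMeasurable
        (Eventually.of_forall fun _ => f.norm_apply_le _)
    refine h1.congr (Eventually.of_forall fun z => ?_)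
    simp only [Function.uncurry]; ring

/-- The superposition acts on k and the operator on ξ, so they commute. Superposed spectral
functions therefore solve the Dirac system with the superposed plane wave as boundary value. -/
theorem superpose_opA (hχ : Integrable χ) (k : ℝ) {q : ℝ × ℝ → ℂ} (hq : LineDominated q)
    (f : BC ℝ) : superpose hχ k (opA q f) = opA q (superpose hχ k f) := by
  ext u x y
  rw [opA_apply hq, superpose_apply,
    ← superpose_swap_integral hχ k f (hq.integrable_fst y).integrableOn (fun t => (t, y))
      (by fun_prop), ← integral_const_mul]
  refine integral_congr_ae (Eventually.of_forall fun k' => ?_)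
  simp only [opA_apply hq]; ring

theorem superpose_opB (hχ : Integrable χ) (k σ : ℝ) {q : ℝ × ℝ → ℂ} (hq : LineDominated q)
    (f : BC ℝ) : superpose hχ k (opB σ q f) = opB σ q (superpose hχ k f) := by
  ext u x y
  rw [opB_apply σ hq, superpose_apply,
    ← superpose_swap_integral hχ k f (hq.conj.integrable_snd x).integrableOn (fun t => (x, t))
      (by fun_prop), ← integral_const_mul]
  refine integral_congr_ae (Eventually.of_forall fun k' => ?_)
  simp only [opB_apply σ hq]; ring

/-- Factor out e^{ikη}: what remains is the inversion integral of the kernel. -/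
theorem superpose_planeWave {u : ℝ → ℝ} (hc : Continuous u) (hi : Integrable u)
    (hk : Integrable (kernel u)) (k : ℝ) (x y : ℝ) :
    superpose hk k planeWave ((), x, y)
      = -Complex.I * u y * Complex.exp (Complex.I * k * y) := by
  rw [← integral_kernel_mul_exp hc hi hk y, ← integral_mul_const, superpose_apply]
  refine integral_congr_ae (Eventually.of_forall fun k' => ?_)
  simp only [planeWave_apply]
  rw [mul_assoc (kernel u k'), ← Complex.exp_add]
  congr 2
  push_cast; ring

end Superposition

/-! ### First and second derivatives of the spectral functions -/

/-- Constant functions, as an operator. -/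
def constL : ℂ →L[ℝ] BC Unit :=
  LinearMap.mkContinuous
    { toFun := BC.const
      map_add' := fun _ _ => rfl
      map_smul' := fun _ _ => rfl } 1 fun c => by
    rw [one_mul]; exact (BC.norm_le (norm_nonneg _)).2 fun _ => le_rfl

/-- Translation by `h` multiplies the wave by e^{ikh}. The coefficient `c` allows the statement to
be used twice. -/
theorem hasTransDeriv_planeWave_snd (c : ℂ) (k : ℝ) :
    HasTransDeriv (0, 1) (BC.const c * sliceL k planeWave)
      (BC.const (c * (Complex.I * k)) * sliceL k planeWave) := by
  have h1 : HasDerivAt (fun h : ℝ => c * Complex.exp (Complex.I * k * h)) (c * (Complex.I * k)) 0 := by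
    have h2 : HasDerivAt (fun h : ℝ => Complex.I * k * (h : ℂ)) (Complex.I * k) 0 := by
      simpa using (Complex.ofRealCLM.hasDerivAt (x := (0 : ℝ))).const_mul (Complex.I * (k : ℂ))
    simpa using (h2.cexp).const_mul c
  have h2 : HasDerivAt (fun h : ℝ => BC.const (c * Complex.exp (Complex.I * k * h)))
      (BC.const (c * (Complex.I * k))) 0 := constL.hasFDerivAt.comp_hasDerivAt 0 h1
  refine (h2.mul_const (sliceL k planeWave)).congr_of_eventuallyEq
    (Eventually.of_forall fun h => ?_)
  ext u x y
  simp only [translateL_apply, BC.mul_apply, BC.const_apply, sliceL_apply, planeWave_apply,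
    Prod.smul_mk, smul_eq_mul, mul_one]
  rw [mul_assoc c, ← Complex.exp_add]
  congr 2
  push_cast; ring

theorem hasTransDeriv_zero (v : ℝ × ℝ) : HasTransDeriv v (0 : BC Unit) 0 := by
  unfold HasTransDeriv
  simp only [map_zero]
  exact hasDerivAt_const _ _

theorem hasTransDeriv_planeWave_fst (k : ℝ) : HasTransDeriv (1, 0) (sliceL k planeWave) 0 := by
  refine (hasDerivAt_const (0 : ℝ) (sliceL k planeWave)).congr_of_eventuallyEq
    (Eventually.of_forall fun h => ?_)
  ext u x y
  simp

/-- The equations for the derivatives of a solution `(f, g)` of the Dirac system. -/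
structure DiracJet (σ : ℝ) (q : ℝ × ℝ → ℂ) (f g fy fyy gx gxx : BC Unit) : Prop where
  f_x : ∀ x y, HasDerivAt (fun s => f ((), s, y)) (-(1 / 2) * q (x, y) * g ((), x, y)) x
  g_y : ∀ x y, HasDerivAt (fun s => g ((), x, s))
    (-(1 / 2) * σ * starRingEnd ℂ (q (x, y)) * f ((), x, y)) y
  f_y : ∀ x y, HasDerivAt (fun s => f ((), x, s)) (fy ((), x, y)) y
  f_yy : ∀ x y, HasDerivAt (fun s => fy ((), x, s)) (fyy ((), x, y)) y
  g_x : ∀ x y, HasDerivAt (fun s => g ((), s, y)) (gx ((), x, y)) x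
  g_xx : ∀ x y, HasDerivAt (fun s => gx ((), s, y)) (gxx ((), x, y)) x

/-- The ξ-derivative of ∂_η²ψ₁ and the η-derivative of ∂_ξ²ψ₂ are read off from the integral
equations for the second derivatives. No third derivative of ψ has to be constructed by translation,
and the boundary limits follow from the same equations. -/
theorem exists_diracJet {σ : ℝ} (hσ : |σ| ≤ 1) {q : ℝ × ℝ → ℂ} (hq : SobolevReg 3 q) (k : ℝ) :
    ∃ fy fyy gx gxx : BC Unit, DiracJet σ q (psiOne σ q k) (psiTwo σ q k) fy fyy gx gxx ∧
      (∀ x y, HasDerivAt (fun s => fyy ((), s, y))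
        (-(1 / 2) * (dEta (dEta q) (x, y) * psiTwo σ q k ((), x, y)
          + 2 * dEta q (x, y)
            * (-(1 / 2) * σ * starRingEnd ℂ (q (x, y)) * psiOne σ q k ((), x, y))
          + q (x, y) * (-(1 / 2) * σ * (starRingEnd ℂ (dEta q (x, y)) * psiOne σ q k ((), x, y)
            + starRingEnd ℂ (q (x, y)) * fy ((), x, y))))) x) ∧
      (∀ y, Tendsto (fun s => fyy ((), s, y)) atBot
        (𝓝 (-(k : ℂ) ^ 2 * Complex.exp (Complex.I * k * y)))) ∧
      (∀ x y, HasDerivAt (fun s => gxx ((), x, s))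
        (-(1 / 2) * σ * (starRingEnd ℂ (dXi (dXi q) (x, y)) * psiOne σ q k ((), x, y)
          + 2 * starRingEnd ℂ (dXi q (x, y))
            * (-(1 / 2) * q (x, y) * psiTwo σ q k ((), x, y))
          + starRingEnd ℂ (q (x, y)) * (-(1 / 2) * (dXi q (x, y) * psiTwo σ q k ((), x, y)
            + q (x, y) * gx ((), x, y))))) y) ∧
      (∀ x, Tendsto (fun s => gxx ((), x, s)) atTop (𝓝 0)) := by
  set f := psiOne σ q k with hf_def
  set g := psiTwo σ q k with hg_def
  have hf : f = sliceL k planeWave + opA q g := psiOne_eq hσ hq k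
  have hg : g = opB σ q f := psiTwo_eq hq k
  have hpsi := isPsi_psi hσ hq k
  rw [← hf_def, ← hg_def] at hpsi
  have he : HasTransDeriv (0, 1) (sliceL k planeWave)
      (BC.const (1 * (Complex.I * k)) * sliceL k planeWave) := by
    have h := hasTransDeriv_planeWave_snd 1 k
    have e0 : BC.const 1 * sliceL k planeWave = sliceL k planeWave := by
      ext u x y; simp
    rwa [e0] at h
  have hu := hq.isUnit (P := Unit) hσ
  have hqd : LineDominated q := hq.lineDominated
  have hqy : SobolevReg 2 (dEta q) := hq.dEta
  have hqx : SobolevReg 2 (dXi q) := hq.dXi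
  have hqyy : SobolevReg 1 (dEta (dEta q)) := hqy.dEta
  have hqxx : SobolevReg 1 (dXi (dXi q)) := hqx.dXi
  obtain ⟨fy, gy, fyy, gyy, h1, h2, h3, h4, -, -, h7, -⟩ := exists_second_transDeriv hu
    hq.hasPotDeriv_snd hqy.hasPotDeriv_snd (e := sliceL k planeWave)
    he (hasTransDeriv_planeWave_snd _ k) hf hg
  obtain ⟨fx, gx, fxx, gxx, i1, i2, i3, i4, -, -, -, i8⟩ := exists_second_transDeriv hu
    hq.hasPotDeriv_fst hqx.hasPotDeriv_fst (hasTransDeriv_planeWave_fst k)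
    (hasTransDeriv_zero _) hf hg
  -- In the directions of the Dirac system the abstract derivatives are known explicitly, by
  -- uniqueness of derivatives.
  have hgy : ∀ x y, gy ((), x, y) = -(1 / 2) * σ * starRingEnd ℂ (q (x, y)) * f ((), x, y) :=
    fun x y => (h3.hasDerivAt_snd () x y).unique (hpsi.dirac₂ x y)
  have hfx : ∀ x y, fx ((), x, y) = -(1 / 2) * q (x, y) * g ((), x, y) :=
    fun x y => (i1.hasDerivAt_fst () x y).unique (hpsi.dirac₁ x y)
  have hgyy : ∀ x y, gyy ((), x, y) = -(1 / 2) * σ * (starRingEnd ℂ (dEta q (x, y)) * f ((), x, y)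
      + starRingEnd ℂ (q (x, y)) * fy ((), x, y)) := fun x y => by
    refine (h4.hasDerivAt_snd () x y).unique ?_
    simp_rw [hgy]
    refine (((hasDerivAt_conj (hq.hasDerivAt_snd x y)).const_mul (-(1 / 2) * (σ : ℂ))).mul
      (h1.hasDerivAt_snd () x y)).congr_deriv ?_
    ring
  have hfxx : ∀ x y, fxx ((), x, y) = -(1 / 2) * (dXi q (x, y) * g ((), x, y)
      + q (x, y) * gx ((), x, y)) := fun x y => by
    refine (i2.hasDerivAt_fst () x y).unique ?_
    simp_rw [hfx]
    refine (((hq.hasDerivAt_fst x y).const_mul (-(1 / 2) : ℂ)).mul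
      (i3.hasDerivAt_fst () x y)).congr_deriv ?_
    ring
  refine ⟨fy, fyy, gx, gxx, ⟨hpsi.dirac₁, hpsi.dirac₂, h1.hasDerivAt_snd (),
    h2.hasDerivAt_snd (), i3.hasDerivAt_fst (), i4.hasDerivAt_fst ()⟩, fun x y => ?_, fun y => ?_,
    fun x y => ?_, fun x => ?_⟩
  · rw [h7]
    have a1 := hasDerivAt_opA hqyy.lineDominated g () x y
    have a2 := (hasDerivAt_opA hqy.lineDominated gy () x y).const_smul (2 : ℝ)
    have a3 := hasDerivAt_opA hqd gyy () x y
    refine (((a1.const_add (BC.const (1 * (Complex.I * k) * (Complex.I * k)) ((), x, y)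
      * sliceL k planeWave ((), x, y))).add a2).add a3).congr_deriv ?_
    rw [hgy, hgyy, Complex.real_smul]
    push_cast; ring
  · rw [h7]
    have a1 := tendsto_opA hqyy.lineDominated g () y
    have a2 := (tendsto_opA hqy.lineDominated gy () y).const_smul (2 : ℝ)
    have a3 := tendsto_opA hqd gyy () y
    have := ((a1.const_add (BC.const (1 * (Complex.I * k) * (Complex.I * k)) ((), 0, y)
      * sliceL k planeWave ((), 0, y))).add a2).add a3
    simp only [add_zero, smul_zero] at this
    have hc : BC.const (1 * (Complex.I * k) * (Complex.I * k)) ((), 0, y)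
        * sliceL k planeWave ((), 0, y) = -(k : ℂ) ^ 2 * Complex.exp (Complex.I * k * y) := by
      simp only [BC.const_apply, sliceL_apply, planeWave_apply]
      linear_combination (k : ℂ) ^ 2 * Complex.exp (Complex.I * k * y) * Complex.I_mul_I
    rw [← hc]
    exact this
  · rw [i8]
    have a1 := hasDerivAt_opB σ hqxx.lineDominated f () x y
    have a2 := (hasDerivAt_opB σ hqx.lineDominated fx () x y).const_smul (2 : ℝ)
    have a3 := hasDerivAt_opB σ hqd fxx () x y
    refine ((a1.add a2).add a3).congr_deriv ?_
    rw [hfx, hfxx, Complex.real_smul]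
    push_cast; ring
  · rw [i8]
    have a1 := tendsto_opB σ hqxx.lineDominated f () x
    have a2 := (tendsto_opB σ hqx.lineDominated fx () x).const_smul (2 : ℝ)
    have a3 := tendsto_opB σ hqd fxx () x
    have := (a1.add a2).add a3
    simp only [add_zero, smul_zero] at this
    exact this

/-! ### Time derivative of the spectral functions -/

theorem dXi_norm_sq {f : ℝ × ℝ → ℂ} (hf : Differentiable ℝ f) (p : ℝ × ℝ) :
    dXi (fun r => ‖f r‖ ^ 2) p = 1 / 2 * dXi (fun r => cross (f r) (f r)) p := by
  have h := hasDerivAt_cross (hasDerivAt_dXi hf p.1 p.2) (hasDerivAt_dXi hf p.1 p.2)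
  have h1 : HasDerivAt (fun s => ‖f (s, p.2)‖ ^ 2) _ p.1 :=
    (h.const_mul (1 / 2)).congr_of_eventuallyEq (Eventually.of_forall fun s => by
      dsimp only; rw [cross_self]; ring)
  rw [dXi_cross hf hf]
  exact h1.deriv

theorem BC.tendsto_mul_zero (b : BC Unit) {r : ℝ → ℂ} (γ : ℝ → ℝ × ℝ) {l : Filter ℝ}
    (hr : Tendsto r l (𝓝 0)) : Tendsto (fun s => r s * b ((), γ s)) l (𝓝 0) := by
  refine squeeze_zero_norm (fun s => ?_) (by simpa using hr.norm.mul_const ‖b‖)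
  rw [norm_mul]
  exact mul_le_mul_of_nonneg_left (b.norm_apply_le _) (norm_nonneg _)

theorem tendsto_conj_zero {r : ℝ → ℂ} {l : Filter ℝ} (hr : Tendsto r l (𝓝 0)) :
    Tendsto (fun s => starRingEnd ℂ (r s)) l (𝓝 0) := by
  simpa [Function.comp_def] using (Complex.continuous_conj.tendsto _).comp hr

section TimeDerivative

variable {σ T : ℝ} {u₁ u₂ : ℝ → ℝ} {Q : ℝ → ℝ × ℝ → ℂ} {G₁ G₂ : ℝ → ℝ × ℝ → ℝ}

theorem IsSolution.hasDerivAt_G₁ (h : IsSolution σ T u₁ u₂ Q G₁ G₂) {t : ℝ}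
    (ht : t ∈ Set.Icc 0 T) (hq : Differentiable ℝ (Q t)) (x y : ℝ) :
    HasDerivAt (fun s => (G₁ t (s, y) : ℂ))
      (-(σ / 2) * (dEta (Q t) (x, y) * starRingEnd ℂ (Q t (x, y))
        + Q t (x, y) * starRingEnd ℂ (dEta (Q t) (x, y)))) x := by
  have h1 : HasDerivAt (fun s => G₁ t (s, y)) (dXi (G₁ t) (x, y)) x :=
    (h.differentiable_G₁ t ht x y).hasDerivAt
  refine h1.ofReal_comp.congr_deriv ?_
  rw [h.eq_G₁ t ht, dEta_norm_sq hq, dEta_cross hq hq]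
  push_cast
  simp only [ofReal_cross]
  ring

theorem IsSolution.hasDerivAt_G₂ (h : IsSolution σ T u₁ u₂ Q G₁ G₂) {t : ℝ}
    (ht : t ∈ Set.Icc 0 T) (hq : Differentiable ℝ (Q t)) (x y : ℝ) :
    HasDerivAt (fun s => (G₂ t (x, s) : ℂ))
      (-(σ / 2) * (dXi (Q t) (x, y) * starRingEnd ℂ (Q t (x, y))
        + Q t (x, y) * starRingEnd ℂ (dXi (Q t) (x, y)))) y := by
  have h1 : HasDerivAt (fun s => G₂ t (x, s)) (dEta (G₂ t) (x, y)) y :=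
    (h.differentiable_G₂ t ht x y).hasDerivAt
  refine h1.ofReal_comp.congr_deriv ?_
  rw [h.eq_G₂ t ht, dXi_norm_sq hq, dXi_cross hq hq]
  push_cast
  simp only [ofReal_cross]
  ring

/-- The evolution of the spectral functions: the second equation of the Lax pair. -/
theorem IsSolution.exists_hasDerivWithinAt_psi (hσ : |σ| ≤ 1) (h : IsSolution σ T u₁ u₂ Q G₁ G₂)
    (hQ : RegularOn 3 T Q)
    (hu₁ : Continuous u₁ ∧ Integrable u₁ ∧ Integrable (kernel u₁))
    (hu₂ : Continuous u₂ ∧ Integrable u₂ ∧ Integrable (kernel u₂))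
    {t : ℝ} (ht : t ∈ Set.Icc 0 T) (k : ℝ) :
    ∃ fy fyy gx gxx w₁ w₂ : BC Unit,
      DiracJet σ (Q t) (psiOne σ (Q t) k) (psiTwo σ (Q t) k) fy fyy gx gxx ∧
      HasDerivWithinAt (fun s => psiOne σ (Q s) k) w₁ (Set.Icc 0 T) t ∧
      HasDerivWithinAt (fun s => psiTwo σ (Q s) k) w₂ (Set.Icc 0 T) t ∧
      (∀ p, w₁ ((), p) = Complex.I * (fyy ((), p) + G₁ t p * psiOne σ (Q t) k ((), p)
          + 1 / 2 * Q t p * gx ((), p) - 1 / 2 * dXi (Q t) p * psiTwo σ (Q t) k ((), p))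
        + Complex.I * k ^ 2 * psiOne σ (Q t) k ((), p)
        + superpose hu₁.2.2 k (psiFst σ (Q t)) ((), p)) ∧
      (∀ p, w₂ ((), p) = Complex.I * (-gxx ((), p) - G₂ t p * psiTwo σ (Q t) k ((), p)
          - σ / 2 * starRingEnd ℂ (Q t p) * fy ((), p)
          + σ / 2 * starRingEnd ℂ (dEta (Q t) p) * psiOne σ (Q t) k ((), p))
        + Complex.I * k ^ 2 * psiTwo σ (Q t) k ((), p)
        + superpose hu₁.2.2 k (psiSnd σ (Q t)) ((), p)) := by
  have hb₁ := exists_bound_of_kernel hu₁.1 hu₁.2.1 hu₁.2.2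
  have hb₂ := exists_bound_of_kernel hu₂.1 hu₂.2.1 hu₂.2.2
  have hq : SobolevReg 3 (Q t) := hQ.sobolevReg ht
  have hqd : LineDominated (Q t) := hq.lineDominated
  have hqx : SobolevReg 2 (dXi (Q t)) := hq.dXi
  have hqy : SobolevReg 2 (dEta (Q t)) := hq.dEta
  obtain ⟨G1, -, hG1'⟩ := h.exists_G₁ hQ hu₁.1 hb₁
  obtain ⟨G2, -, hG2'⟩ := h.exists_G₂ hQ hu₂.1 hb₂
  have hG1 := hG1' t ht
  have hG2 := hG2' t ht
  obtain ⟨fy, fyy, gx, gxx, hjet, hfyyx, hfyy, hgxxy, hgxx⟩ := exists_diracJet hσ hq k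
  have hpsi := isPsi_psi hσ hq k
  have hfam := h.lineFamily hQ ⟨hu₁.1, hb₁⟩ ⟨hu₂.1, hb₂⟩ ht
  -- The superposed pair `c`, `d` below solves the Dirac system with the boundary value
  -- −iu₁(η)e^{ikη}.
  have hC1 := congrArg (superpose hu₁.2.2 k) (psiFst_eq hσ hq)
  rw [superpose_add, superpose_opA _ _ hqd] at hC1
  have hC2 : superpose hu₁.2.2 k (psiSnd σ (Q t)) = opB σ (Q t) (superpose hu₁.2.2 k (psiFst σ (Q t))) :=
    superpose_opB hu₁.2.2 k σ hqd _
  have hpw := superpose_planeWave hu₁.1 hu₁.2.1 hu₁.2.2 k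
  set c := superpose hu₁.2.2 k (psiFst σ (Q t)) with hc
  set d := superpose hu₁.2.2 k (psiSnd σ (Q t)) with hd
  set e := superpose hu₁.2.2 k planeWave with he
  set f := psiOne σ (Q t) k with hf
  set g := psiTwo σ (Q t) k with hg
  have hqt : LineDominated (timeDeriv Q G₁ G₂ t) := hfam.dominated_deriv
  -- The pair `w₁`, `w₂` is the right-hand side of the second Lax equation, the candidate for the
  -- time derivative of ψ.
  let w₁ : BC Unit := BC.const Complex.I * (fyy + G1 t * f + BC.const (1 / 2) * BC.ofFun (Q t) * gx
    - BC.const (1 / 2) * BC.ofFun (dXi (Q t)) * g) + BC.const (Complex.I * k ^ 2) * f + c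
  let w₂ : BC Unit := BC.const Complex.I * (-gxx - G2 t * g
    - BC.const (σ / 2) * BC.ofFun (fun p => starRingEnd ℂ (Q t p)) * fy
    + BC.const (σ / 2) * BC.ofFun (fun p => starRingEnd ℂ (dEta (Q t) p)) * f)
    + BC.const (Complex.I * k ^ 2) * g + d
  have hw₁ : ∀ p, w₁ ((), p) = Complex.I * (fyy ((), p) + G₁ t p * f ((), p)
          + 1 / 2 * Q t p * gx ((), p) - 1 / 2 * dXi (Q t) p * g ((), p))
        + Complex.I * k ^ 2 * f ((), p) + c ((), p) := fun p => by
    simp only [w₁, BC.add_apply, BC.sub_apply, BC.mul_apply, BC.const_apply, hG1,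
      hq.ofFun_apply, hqx.ofFun_apply]
  have hw₂ : ∀ p, w₂ ((), p) = Complex.I * (-gxx ((), p) - G₂ t p * g ((), p)
          - σ / 2 * starRingEnd ℂ (Q t p) * fy ((), p)
          + σ / 2 * starRingEnd ℂ (dEta (Q t) p) * f ((), p))
        + Complex.I * k ^ 2 * g ((), p) + d ((), p) := fun p => by
    simp only [w₂, BC.add_apply, BC.sub_apply, BC.neg_apply, BC.mul_apply, BC.const_apply, hG2,
      hq.ofFun_conj_apply, hqy.ofFun_conj_apply]
  have hcx : ∀ x y, HasDerivAt (fun s => c ((), s, y)) (-(1 / 2) * Q t (x, y) * d ((), x, y)) x := by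
    intro x y
    rw [hC1]
    refine ((hasDerivAt_opA hqd d () x y).const_add (e ((), 0, y))).congr_of_eventuallyEq
      (Eventually.of_forall fun s => ?_)
    simp only [BC.add_apply, hpw]
  have hclim : ∀ y, Tendsto (fun s => c ((), s, y)) atBot
      (𝓝 (-Complex.I * u₁ y * Complex.exp (Complex.I * k * y))) := by
    intro y
    rw [hC1]
    have := (tendsto_opA hqd d () y).const_add (e ((), 0, y))
    rw [add_zero, hpw] at this
    refine this.congr fun s => ?_
    simp only [BC.add_apply, hpw]
  have hdy : ∀ x y, HasDerivAt (fun s => d ((), x, s))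
      (-(1 / 2) * σ * starRingEnd ℂ (Q t (x, y)) * c ((), x, y)) y := by
    intro x y
    rw [hC2]
    exact hasDerivAt_opB σ hqd c () x y
  have hdlim : ∀ x, Tendsto (fun s => d ((), x, s)) atTop (𝓝 0) := by
    intro x
    rw [hC2]
    exact tendsto_opB σ hqd c () x
  -- This is ψ₁ = e^{ikη} + Aψ₂ differentiated in time. It is checked by comparing ξ-derivatives,
  -- where it becomes the zero-curvature condition of the Lax pair, and limits as ξ → −∞.
  have key₁ : w₁ = opA (timeDeriv Q G₁ G₂ t) g + opA (Q t) w₂ := by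
    rw [← sub_eq_iff_eq_add]
    ext u x y
    have := eq_opA_of_hasDerivAt hqt g (p := ()) (y := y) (c := 0)
      (h := fun s => w₁ ((), s, y) - opA (Q t) w₂ ((), s, y)) (fun x => ?_) ?_ x
    · rw [zero_add] at this; exact this
    · simp only [hw₁]
      have D := (((((hfyyx x y).add ((h.hasDerivAt_G₁ ht hq.differentiable x y).mul (hjet.f_x x y))).add
        (((hq.hasDerivAt_fst x y).const_mul (1 / 2)).mul (hjet.g_xx x y))).sub
        (((hqx.hasDerivAt_fst x y).const_mul (1 / 2)).mul (hjet.g_x x y))).const_mul Complex.I).add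
        ((hjet.f_x x y).const_mul (Complex.I * k ^ 2)) |>.add (hcx x y)
        |>.sub (hasDerivAt_opA hqd w₂ () x y)
      refine D.congr_deriv ?_
      rw [hw₂, timeDeriv, lap]
      push_cast
      ring
    -- The limits i(−k² + u₁)e^{ikη}, ik²e^{ikη} and −iu₁e^{ikη} add up to 0.
    · simp only [hw₁]
      have L1 := hfyy y
      have L2 : Tendsto (fun s => (G₁ t (s, y) : ℂ) * f ((), s, y)) atBot
          (𝓝 (u₁ y * Complex.exp (Complex.I * k * y))) :=
        ((Complex.continuous_ofReal.tendsto _).comp (h.boundary_G₁ t ht y)).mul (hpsi.boundary₁ y)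
      have L3 := BC.tendsto_mul_zero gx (fun s => (s, y))
        (by simpa using (hq.tendsto_fst_atBot y).const_mul (1 / 2))
      have L4 := BC.tendsto_mul_zero g (fun s => (s, y))
        (by simpa using (hqx.tendsto_fst_atBot y).const_mul (1 / 2))
      have L5 := (hpsi.boundary₁ y).const_mul (Complex.I * k ^ 2)
      have L := (((((L1.add L2).add L3).sub L4).const_mul Complex.I).add L5).add (hclim y)
        |>.sub (tendsto_opA hqd w₂ () y)
      convert L using 2
      ring
  have key₂ : w₂ = opB σ (timeDeriv Q G₁ G₂ t) f + opB σ (Q t) w₁ := by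
    rw [← sub_eq_iff_eq_add]
    ext u x y
    have := eq_opB_of_hasDerivAt σ hqt f (p := ()) (x := x) (c := 0)
      (h := fun s => w₂ ((), x, s) - opB σ (Q t) w₁ ((), x, s)) (fun y => ?_) ?_ y
    · rw [zero_add] at this; exact this
    · simp only [hw₂]
      have D := (((((hgxxy x y).neg.sub ((h.hasDerivAt_G₂ ht hq.differentiable x y).mul (hjet.g_y x y))).sub
        (((hasDerivAt_conj (hq.hasDerivAt_snd x y)).const_mul (σ / 2 : ℂ)).mul (hjet.f_yy x y))).add
        (((hasDerivAt_conj (hqy.hasDerivAt_snd x y)).const_mul (σ / 2 : ℂ)).mul (hjet.f_y x y))).const_mul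
        Complex.I).add
        ((hjet.g_y x y).const_mul (Complex.I * k ^ 2)) |>.add (hdy x y)
        |>.sub (hasDerivAt_opB σ hqd w₁ () x y)
      refine D.congr_deriv ?_
      rw [hw₁, timeDeriv, lap]
      simp only [map_mul, map_add, Complex.conj_I, Complex.conj_ofReal]
      push_cast
      ring
    · simp only [hw₂]
      have L1 := hgxx x
      have L2 : Tendsto (fun s => (G₂ t (x, s) : ℂ) * g ((), x, s)) atTop (𝓝 0) := by
        refine (BC.tendsto_mul_zero (G2 t) (fun s => (x, s)) (hpsi.boundary₂ x)).congr fun s => ?_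
        rw [hG2, mul_comm]
      have L3 := BC.tendsto_mul_zero fy (fun s => (x, s))
        (by simpa using ((Complex.continuous_conj.tendsto _).comp
          (hq.tendsto_snd_atTop x)).const_mul (σ / 2 : ℂ))
      have L4 := BC.tendsto_mul_zero f (fun s => (x, s))
        (by simpa using ((Complex.continuous_conj.tendsto _).comp
          (hqy.tendsto_snd_atTop x)).const_mul (σ / 2 : ℂ))
      have L5 := (hpsi.boundary₂ x).const_mul (Complex.I * k ^ 2)
      have L := (((((L1.neg.sub L2).sub L3).add L4).const_mul Complex.I).add L5).add (hdlim x)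
        |>.sub (tendsto_opB σ hqd w₁ () x)
      convert L using 2
      ring
  -- The true time derivative exists by differentiable dependence on the potential, and it solves
  -- the same Volterra equation as `w₁`.
  obtain ⟨f', hf', hfe⟩ := hfam.exists_hasDerivWithinAt Set.ordConnected_Icc ht
    (hq.isUnit (P := Unit) hσ) (f := fun s => psiOne σ (Q s) k) (g := fun _ => sliceL k planeWave)
    (hasDerivWithinAt_const t _ _) (fun s hs => by
      rw [← psiTwo_eq (hQ.sobolevReg hs)]; exact psiOne_eq hσ (hQ.sobolevReg hs) k)
  have hfw : f' = w₁ := by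
    refine eq_of_volterra hσ hq hfe ?_
    rw [zero_add, ← psiTwo_eq hq k, add_assoc, ← map_add, ← hf, ← key₂]
    exact key₁
  rw [hfw] at hf'
  -- Since ψ₂ = Bψ₁, the second derivative is given by the product rule, and `key₂` identifies it
  -- with `w₂`.
  have hg' := (hfam.hasDerivWithinAt_opB (P := Unit) σ Set.ordConnected_Icc ht).clm_apply hf'
  refine ⟨fy, fyy, gx, gxx, w₁, w₂, hjet, hf', ?_, hw₁, hw₂⟩
  rw [key₂]
  exact hg'.congr_of_mem (fun s hs => psiTwo_eq (hQ.sobolevReg hs) k) ht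

end TimeDerivative

/-! ### Families that are differentiable in `L¹` -/

theorem BC.integrable_mul (b : BC Unit) {f : ℝ × ℝ → ℂ} (hf : Integrable f) :
    Integrable fun p => b ((), p) * f p :=
  hf.bdd_mul (c := ‖b‖) (b.continuous.comp (by fun_prop)).aestronglyMeasurable
    (Eventually.of_forall fun _ => b.norm_apply_le _)

theorem integrable_conj {f : ℝ × ℝ → ℂ} (hf : Integrable f) :
    Integrable fun p => starRingEnd ℂ (f p) :=
  (Complex.conjCLE : ℂ →L[ℝ] ℂ).integrable_comp hf

/-- A family of continuous integrable functions that is continuous at `t` in `L¹`. -/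
structure LOneFamily (S : Set ℝ) (f : ℝ → ℝ × ℝ → ℂ) (t : ℝ) : Prop where
  continuous : ∀ s ∈ S, Continuous (f s)
  integrable : ∀ s ∈ S, Integrable (f s)
  tendsto : Tendsto (fun s => ∫⁻ p, ‖f s p - f t p‖ₑ) (𝓝[S] t) (𝓝 0)

theorem RegularOn.lOneFamily {n : ℕ} {T : ℝ} {f : ℝ → ℝ × ℝ → ℂ} (h : RegularOn n T f) {t : ℝ}
    (ht : t ∈ Set.Icc 0 T) : LOneFamily (Set.Icc 0 T) f t :=
  ⟨fun _ hs => (h.sobolevReg hs).continuous, fun _ hs => (h.sobolevReg hs).integrable_self,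
    h.tendsto_lintegral ht⟩

namespace LOneFamily

variable {S : Set ℝ} {f g : ℝ → ℝ × ℝ → ℂ} {t : ℝ}

theorem add (hf : LOneFamily S f t) (hg : LOneFamily S g t) (ht : t ∈ S) :
    LOneFamily S (fun s p => f s p + g s p) t := by
  refine ⟨fun s hs => (hf.continuous s hs).add (hg.continuous s hs),
    fun s hs => (hf.integrable s hs).add (hg.integrable s hs), ?_⟩
  have h := hf.tendsto.add hg.tendsto
  rw [add_zero] at h
  refine tendsto_of_tendsto_of_tendsto_of_le_of_le' tendsto_const_nhds h
    (Eventually.of_forall fun _ => zero_le) ?_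
  filter_upwards [self_mem_nhdsWithin] with s hs
  have hm : Measurable fun p => ‖f s p - f t p‖ₑ :=
    ((hf.continuous s hs).sub (hf.continuous t ht)).enorm.measurable
  rw [← lintegral_add_left hm]
  refine lintegral_mono fun p => ?_
  rw [add_sub_add_comm]
  exact enorm_add_le _ _

/-- Split b(s)f(s) − b(t)f(t) as b(s)(f(s) − f(t)) + (b(s) − b(t))f(t), so that convergence in the
supremum norm meets convergence in L¹. -/
theorem bc_mul {b : ℝ → BC Unit} (hf : LOneFamily S f t) (hb : ContinuousWithinAt b S t)
    (ht : t ∈ S) : LOneFamily S (fun s p => b s ((), p) * f s p) t := by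
  have hbc : ∀ s, Continuous fun p : ℝ × ℝ => b s ((), p) := fun s =>
    (b s).continuous.comp (by fun_prop)
  refine ⟨fun s hs => (hbc s).mul (hf.continuous s hs),
    fun s hs => (b s).integrable_mul (hf.integrable s hs), ?_⟩
  have e1 : Tendsto (fun s => ‖b s‖ₑ) (𝓝[S] t) (𝓝 ‖b t‖ₑ) :=
    (continuous_enorm.tendsto _).comp hb
  have e2 : Tendsto (fun s => ‖b s - b t‖ₑ) (𝓝[S] t) (𝓝 0) := by
    have := (continuous_enorm.tendsto _).comp (hb.sub (continuousWithinAt_const (b := b t)))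
    have h0 : ‖b t - b t‖ₑ = 0 := by
      rw [sub_self, ← ofReal_norm, norm_zero, ENNReal.ofReal_zero]
    rw [← h0]
    exact this
  have e3 := ENNReal.Tendsto.mul e1 (Or.inr ENNReal.zero_ne_top) hf.tendsto
    (Or.inr enorm_ne_top)
  have e4 := ENNReal.Tendsto.mul_const e2 (Or.inr (hf.integrable t ht).2.ne)
  have h := e3.add e4
  simp only [mul_zero, zero_mul, add_zero] at h
  refine tendsto_of_tendsto_of_tendsto_of_le_of_le' tendsto_const_nhds h
    (Eventually.of_forall fun _ => zero_le) ?_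
  filter_upwards [self_mem_nhdsWithin] with s hs
  have hm1 : Measurable fun p => ‖f s p - f t p‖ₑ :=
    ((hf.continuous s hs).sub (hf.continuous t ht)).enorm.measurable
  rw [← lintegral_const_mul _ hm1, ← lintegral_const_mul _ (hf.continuous t ht).enorm.measurable,
    ← lintegral_add_left (hm1.const_mul _)]
  refine lintegral_mono fun p => ?_
  have : b s ((), p) * f s p - b t ((), p) * f t p
      = b s ((), p) * (f s p - f t p) + (b s - b t) ((), p) * f t p := by
    rw [BC.sub_apply]; ring
  rw [this]
  refine (enorm_add_le _ _).trans (add_le_add ?_ ?_) <;> rw [enorm_mul]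
  · exact mul_le_mul_left (enorm_le_iff_norm_le.2 ((b s).norm_apply_le _)) _
  · exact mul_le_mul_left (enorm_le_iff_norm_le.2 ((b s - b t).norm_apply_le _)) _

theorem const_mul (hf : LOneFamily S f t) (ht : t ∈ S) (c : ℂ) :
    LOneFamily S (fun s p => c * f s p) t :=
  hf.bc_mul (b := fun _ => BC.const c) continuousWithinAt_const ht

theorem conj (hf : LOneFamily S f t) : LOneFamily S (fun s p => starRingEnd ℂ (f s p)) t :=
  ⟨fun s hs => Complex.continuous_conj.comp (hf.continuous s hs),
    fun s hs => integrable_conj (hf.integrable s hs),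
    hf.tendsto.congr fun s => lintegral_congr fun p => by rw [← map_sub, enorm_conj]⟩

theorem congr (hf : LOneFamily S f t) (h : ∀ s ∈ S, g s = f s) (ht : t ∈ S) :
    LOneFamily S g t :=
  ⟨fun s hs => by rw [h s hs]; exact hf.continuous s hs,
    fun s hs => by rw [h s hs]; exact hf.integrable s hs,
    hf.tendsto.congr' (by
      filter_upwards [self_mem_nhdsWithin] with s hs
      rw [h s hs, h t ht])⟩

end LOneFamily

open Classical in
/-- The class in `L¹` of an integrable function. -/
def toLOne (f : ℝ × ℝ → ℂ) : ℝ × ℝ →₁[volume] ℂ :=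
  if h : Integrable f then h.toL1 f else 0

theorem toLOne_eq {f : ℝ × ℝ → ℂ} (h : Integrable f) : toLOne f = h.toL1 f := dif_pos h

/-- The pairing `∬ b f dξ dη` of a bounded and an integrable function. -/
def bcPairing : BC Unit →L[ℝ] (ℝ × ℝ →₁[volume] ℂ) →L[ℝ] ℂ :=
  LinearMap.mkContinuous₂ (LinearMap.mk₂ ℝ
    (fun (b : BC Unit) (f : ℝ × ℝ →₁[volume] ℂ) => ∫ p, b ((), p) * f p)
    (fun b c f => by
      rw [← integral_add (b.integrable_mul (L1.integrable_coeFn f))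
        (c.integrable_mul (L1.integrable_coeFn f))]
      simp only [BC.add_apply, add_mul])
    (fun r b f => by
      simp only [BC.smul_apply, smul_mul_assoc, integral_smul])
    (fun b f g => by
      rw [← integral_add (b.integrable_mul (L1.integrable_coeFn f))
        (b.integrable_mul (L1.integrable_coeFn g))]
      refine integral_congr_ae ?_
      filter_upwards [Lp.coeFn_add f g] with p hp
      rw [hp, Pi.add_apply, mul_add])
    (fun r b f => by
      rw [← integral_smul]
      refine integral_congr_ae ?_
      filter_upwards [Lp.coeFn_smul r f] with p hp
      rw [hp, Pi.smul_apply, mul_smul_comm])) 1 (fun b f => by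
    rw [LinearMap.mk₂_apply, one_mul, L1.norm_eq_integral_norm, ← integral_const_mul]
    refine norm_integral_le_of_norm_le ((L1.integrable_coeFn f).norm.const_mul _)
      (Eventually.of_forall fun p => ?_)
    rw [norm_mul]
    exact mul_le_mul_of_nonneg_right (b.norm_apply_le _) (norm_nonneg _))

theorem bcPairing_toLOne (b : BC Unit) {f : ℝ × ℝ → ℂ} (hf : Integrable f) :
    bcPairing b (toLOne f) = ∫ p, b ((), p) * f p := by
  rw [toLOne_eq hf]
  refine integral_congr_ae ?_
  filter_upwards [hf.coeFn_toL1] with p hp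
  rw [hp]

/-- A pointwise derivative that is continuous in L¹ is a derivative in L¹, by the mean value
inequality on the segment between the two times. -/
theorem LOneFamily.hasDerivWithinAt_toLOne {S : Set ℝ} {f f' : ℝ → ℝ × ℝ → ℂ} {t : ℝ}
    (hf : ∀ s ∈ S, Continuous (f s)) (hfi : ∀ s ∈ S, Integrable (f s)) (hf' : LOneFamily S f' t)
    (hd : ∀ s ∈ S, ∀ p, HasDerivWithinAt (fun r => f r p) (f' s p) S s)
    (hS : S.OrdConnected) (ht : t ∈ S) :
    HasDerivWithinAt (fun s => toLOne (f s)) (toLOne (f' t)) S t := by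
  rw [hasDerivWithinAt_iff_isLittleO, Asymptotics.isLittleO_iff]
  intro ε hε
  have hev := hf'.tendsto.eventually (ge_mem_nhds (ENNReal.ofReal_pos.2 hε))
  obtain ⟨δ, hδ, hsub⟩ := Metric.mem_nhdsWithin_iff.1 hev
  filter_upwards [inter_mem_nhdsWithin S (Metric.ball_mem_nhds t hδ)] with s hs
  have hI : Set.uIcc t s ⊆ S := hS.uIcc_subset ht hs.1
  have hI' : Set.uIcc t s ⊆ Metric.ball t δ := by
    rw [Real.ball_eq_Ioo] at hs ⊢
    exact Set.ordConnected_Ioo.uIcc_subset ⟨by linarith, by linarith⟩ hs.2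
  have hbound := lintegral_enorm_sub_sub_smul_le (μ := volume) hI
    (fun r hr => (hf r hr).measurable) (hf'.continuous t ht).measurable hd
    (C := ENNReal.ofReal ε) fun r hr => hsub ⟨hI' hr, hI hr⟩
  have hi := hf'.integrable t ht
  rw [toLOne_eq (hfi s hs.1), toLOne_eq (hfi t ht), toLOne_eq hi, ← Integrable.toL1_sub,
    ← Integrable.toL1_smul, ← Integrable.toL1_sub]
  have h2 : ‖Integrable.toL1 (f s - f t - (s - t) • f' t)
      (((hfi s hs.1).sub (hfi t ht)).sub (hi.smul (s - t)))‖ₑ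
      ≤ ENNReal.ofReal ε * ENNReal.ofReal |s - t| := by
    refine le_trans (le_of_eq ?_) hbound
    rw [Integrable.enorm_toL1]
    rfl
  rw [← ofReal_norm, ← ENNReal.ofReal_mul hε.le] at h2
  rw [Real.norm_eq_abs]
  exact (ENNReal.ofReal_le_ofReal_iff (by positivity)).1 h2

/-- The product rule for the bounded bilinear pairing of bounded functions with L¹. -/
theorem LOneFamily.hasDerivWithinAt_integral {S : Set ℝ} {f f' : ℝ → ℝ × ℝ → ℂ} {t : ℝ}
    (hf : ∀ s ∈ S, Continuous (f s)) (hfi : ∀ s ∈ S, Integrable (f s)) (hf' : LOneFamily S f' t)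
    (hd : ∀ s ∈ S, ∀ p, HasDerivWithinAt (fun r => f r p) (f' s p) S s)
    (hS : S.OrdConnected) (ht : t ∈ S) {b : ℝ → BC Unit} {b' : BC Unit}
    (hb : HasDerivWithinAt b b' S t) :
    HasDerivWithinAt (fun s => ∫ p, b s ((), p) * f s p)
      (∫ p, (b' ((), p) * f t p + b t ((), p) * f' t p)) S t := by
  have h1 := LOneFamily.hasDerivWithinAt_toLOne hf hfi hf' hd hS ht
  have h2 := (bcPairing.hasFDerivAt.comp_hasDerivWithinAt t hb).clm_apply h1
  refine (h2.congr_of_mem (fun s hs => ?_) ht).congr_deriv ?_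
  · exact (bcPairing_toLOne _ (hfi s hs)).symm
  · rw [integral_add (b'.integrable_mul (hfi t ht)) ((b t).integrable_mul (hf'.integrable t ht)),
      ← bcPairing_toLOne _ (hfi t ht), ← bcPairing_toLOne _ (hf'.integrable t ht)]
    rfl

/-- Integrate in ξ first. Only the derivative must be integrable over the plane, which matters since
parts of the flux are merely bounded factors with limits. -/
theorem integral_eq_zero_of_hasDerivAt_fst {h h' : ℝ × ℝ → ℂ}
    (hd : ∀ x y, HasDerivAt (fun s => h (s, y)) (h' (x, y)) x) (hi : Integrable h')
    (hbot : ∀ y, Tendsto (fun s => h (s, y)) atBot (𝓝 0))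
    (htop : ∀ y, Tendsto (fun s => h (s, y)) atTop (𝓝 0)) : ∫ p, h' p = 0 := by
  rw [Measure.volume_eq_prod] at hi ⊢
  rw [integral_prod_symm _ hi]
  refine integral_eq_zero_of_ae ?_
  filter_upwards [hi.prod_left_ae] with y hy
  rw [integral_of_hasDerivAt_of_tendsto (fun x => hd x y) hy (hbot y) (htop y), sub_zero]
  rfl

/-! ### The time derivative of the solution of the linearized equations -/

section Linearized

variable {σ T : ℝ} {u₁ u₂ : ℝ → ℝ} {Q F U : ℝ → ℝ × ℝ → ℂ} {G₁ G₂ V₁ V₂ : ℝ → ℝ × ℝ → ℝ}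

/-- The time derivative of `U`. -/
def linTimeDeriv (Q F U : ℝ → ℝ × ℝ → ℂ) (G₁ G₂ V₁ V₂ : ℝ → ℝ × ℝ → ℝ) (t : ℝ) (p : ℝ × ℝ) : ℂ :=
  F t p + Complex.I * (lap (U t) p + ((G₁ t p + G₂ t p : ℝ) : ℂ) * U t p
    + ((V₁ t p + V₂ t p : ℝ) : ℂ) * Q t p)

theorem IsLinearizedSolution.hasDerivWithinAt (h : IsLinearizedSolution σ T Q G₁ G₂ F U V₁ V₂)
    {t : ℝ} (ht : t ∈ Set.Icc 0 T) (p : ℝ × ℝ) :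
    HasDerivWithinAt (fun s => U s p) (linTimeDeriv Q F U G₁ G₂ V₁ V₂ t p) (Set.Icc 0 T) t := by
  refine (h.differentiable_time t ht p).hasDerivWithinAt.congr_deriv ?_
  unfold linTimeDeriv
  linear_combination -Complex.I * h.evolution t ht p
    + (derivWithin (fun s => U s p) (Set.Icc 0 T) t - F t p) * Complex.I_mul_I

/-- Every term of the time derivative is an L¹ function, continuous in time, times a bounded field
that is continuous in time; in the term with V₁ + V₂ the L¹ factor is Q. -/
theorem IsLinearizedSolution.lOneFamily (h : IsLinearizedSolution σ T Q G₁ G₂ F U V₁ V₂)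
    (hs : IsSolution σ T u₁ u₂ Q G₁ G₂) (hQ : RegularOn 3 T Q) (hU : RegularOn 4 T U)
    (hF : RegularOn 4 T F)
    (hu₁ : Continuous u₁ ∧ ∃ C, ∀ y, |u₁ y| ≤ C) (hu₂ : Continuous u₂ ∧ ∃ C, ∀ y, |u₂ y| ≤ C)
    {t : ℝ} (ht : t ∈ Set.Icc 0 T) :
    LOneFamily (Set.Icc 0 T) (linTimeDeriv Q F U G₁ G₂ V₁ V₂) t := by
  obtain ⟨g₁, hg₁, hG₁⟩ := hs.exists_G₁ hQ hu₁.1 hu₁.2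
  obtain ⟨g₂, hg₂, hG₂⟩ := hs.exists_G₂ hQ hu₂.1 hu₂.2
  obtain ⟨v₁, hv₁, hV₁⟩ := h.exists_V₁ hQ (hU.mono (by omega))
  obtain ⟨v₂, hv₂, hV₂⟩ := h.exists_V₂ hQ (hU.mono (by omega))
  have hxx : RegularOn 2 T fun t => dXi (dXi (U t)) := (hU.dXi).dXi
  have hyy : RegularOn 2 T fun t => dEta (dEta (U t)) := (hU.dEta).dEta
  have l1 := ((hxx.lOneFamily ht).add (hyy.lOneFamily ht) ht).add
    ((hU.lOneFamily ht).bc_mul ((hg₁ t ht).add (hg₂ t ht)) ht) ht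
  have l2 := l1.add ((hQ.lOneFamily ht).bc_mul ((hv₁ t ht).add (hv₂ t ht)) ht) ht
  refine ((hF.lOneFamily ht).add (l2.const_mul ht Complex.I) ht).congr (fun s hs => ?_) ht
  funext p
  simp only [linTimeDeriv, lap, BC.add_apply, hG₁ s hs, hG₂ s hs, hV₁ s hs, hV₂ s hs,
    Complex.ofReal_add, Pi.add_apply]

end Linearized

/-! ### The divergence structure of the evolution -/

open Complex in
/-- The derivative in `ξ` of the flux
`iσ (ū ∂_ξ(ψ₁φ₁) - ψ₁φ₁ ū_ξ) + i (ψ₂φ₂ u_ξ - u ∂_ξ(ψ₂φ₂)) - 2i v ψ₁φ₂ + iσ (qū + q̄u) ψ₂φ₁`,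
where `ψ = (a, b)`, `φ = (m, n)` and `v_ξ = -(σ/2) (qū + q̄u)_η`. -/
def fluxDeriv (σ : ℝ) (q qx qy u ux uy uxx v a b bx bxx m n mx mxx : ℂ) : ℂ :=
  I * σ * (starRingEnd ℂ u * (a * mxx - q * b * mx - 1 / 2 * (qx * b + q * bx) * m)
      - a * m * starRingEnd ℂ uxx)
    + I * (b * n * uxx - u * (bxx * n + σ * bx * starRingEnd ℂ q * m
      + σ / 2 * b * (starRingEnd ℂ qx * m + starRingEnd ℂ q * mx)))
    + I * σ * (qy * starRingEnd ℂ u + q * starRingEnd ℂ uy + starRingEnd ℂ qy * u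
      + starRingEnd ℂ q * uy) * a * n
    - 2 * I * v * (-(1 / 2) * q * b * n + σ / 2 * starRingEnd ℂ q * a * m)
    + I * σ * (qx * starRingEnd ℂ u + q * starRingEnd ℂ ux + starRingEnd ℂ qx * u
      + starRingEnd ℂ q * ux) * b * m
    + I * σ * (q * starRingEnd ℂ u + starRingEnd ℂ q * u) * (bx * m + b * mx)

section Flux

variable {σ : ℝ} {q u : ℝ × ℝ → ℂ} {v a b ay ayy bx bxx m n my myy nx nxx : BC Unit}

open Complex in
-- Group the terms by one integrable factor each, a derivative of `u`, `q`, or a conjugate; all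
-- other factors are bounded.
theorem integrable_fluxDeriv (hq : SobolevReg 3 q) (hu : SobolevReg 4 u)
    (v a b bx bxx m n my myy : BC Unit) :
    Integrable (fun p : ℝ × ℝ => fluxDeriv σ (q p) (dXi q p) (dEta q p) (u p) (dXi u p) (dEta u p)
      (dXi (dXi u) p) (v ((), p)) (a ((), p)) (b ((), p)) (bx ((), p)) (bxx ((), p))
      (m ((), p.swap)) (n ((), p.swap)) (my ((), p.swap)) (myy ((), p.swap))) := by
  have hqx : SobolevReg 2 (dXi q) := hq.dXi
  have hqy : SobolevReg 2 (dEta q) := hq.dEta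
  have iu := hu.integrable_self
  have iux := hu.dXi.integrable_self
  have iuy := hu.dEta.integrable_self
  have iuxx := hu.dXi.dXi.integrable_self
  have iq := hq.integrable_self
  let m' := swapL m
  let n' := swapL n
  let mx := swapL my
  let mxx := swapL myy
  let Q := BC.ofFun q
  let Qx := BC.ofFun (dXi q)
  let Qy := BC.ofFun (dEta q)
  let Qc := BC.ofFun (fun p => starRingEnd ℂ (q p))
  let Qxc := BC.ofFun (fun p => starRingEnd ℂ (dXi q p))
  let Qyc := BC.ofFun (fun p => starRingEnd ℂ (dEta q p))
  have h1 := (BC.const (I * σ) * (a * mxx - Q * b * mx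
      - BC.const (1 / 2) * (Qx * b + Q * bx) * m' + Qy * a * n' + Qx * b * m'
      + Q * (bx * m' + b * mx))).integrable_mul (integrable_conj iu)
  have h2 := (BC.const (-(I * σ)) * (a * m')).integrable_mul (integrable_conj iuxx)
  have h3 := (BC.const I * (b * n')).integrable_mul iuxx
  have h4 := (BC.const (-I) * (bxx * n' + BC.const σ * bx * Qc * m'
      + BC.const (σ / 2) * b * (Qxc * m' + Qc * mx))
      + BC.const (I * σ) * (Qyc * a * n' + Qxc * b * m' + Qc * (bx * m' + b * mx))).integrable_mul iu
  have h5 := (BC.const (I * σ) * Q * a * n').integrable_mul (integrable_conj iuy)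
  have h6 := (BC.const (I * σ) * Qc * a * n').integrable_mul iuy
  have h7 := (BC.const (I * σ) * Q * b * m').integrable_mul (integrable_conj iux)
  have h8 := (BC.const (I * σ) * Qc * b * m').integrable_mul iux
  -- The field `v` is only bounded, so in these two terms the integrable factor is `q`.
  have h9 := (BC.const I * v * b * n').integrable_mul iq
  have h10 := (BC.const (-(I * σ)) * v * a * m').integrable_mul (integrable_conj iq)
  refine (((((((((h1.add h2).add h3).add h4).add h5).add h6).add h7).add h8).add h9).add
    h10).congr (Eventually.of_forall fun p => ?_)
  simp only [Pi.add_apply, BC.add_apply, BC.sub_apply, BC.mul_apply, BC.const_apply,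
    swapL_apply, m', n', mx, mxx, Q, Qx, Qy, Qc, Qxc, Qyc, hq.ofFun_apply, hqx.ofFun_apply,
    hqy.ofFun_apply, hq.ofFun_conj_apply, hqx.ofFun_conj_apply, hqy.ofFun_conj_apply, fluxDeriv]
  ring

open Complex in
-- The flux vanishes at both ends of every horizontal line: all of its terms except the one in `v`
-- contain `u` or its ξ-derivative as a decaying factor.
theorem integral_fluxDeriv (hq : SobolevReg 3 q) (hu : SobolevReg 4 u)
    (hv : ∀ x y, HasDerivAt (fun s => v ((), s, y)) (-(σ / 2)
      * (dEta q (x, y) * starRingEnd ℂ (u (x, y)) + q (x, y) * starRingEnd ℂ (dEta u (x, y))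
        + starRingEnd ℂ (dEta q (x, y)) * u (x, y) + starRingEnd ℂ (q (x, y)) * dEta u (x, y))) x)
    (hv0 : ∀ y, Tendsto (fun s => v ((), s, y)) atBot (𝓝 0))
    (hψ : DiracJet σ q a b ay ayy bx bxx) (hφ : DiracJet σ (negSwap q) m n my myy nx nxx)
    (hn : ∀ x, Tendsto (fun s => n ((), x, s)) atTop (𝓝 0)) :
    ∫ p : ℝ × ℝ, fluxDeriv σ (q p) (dXi q p) (dEta q p) (u p) (dXi u p) (dEta u p)
      (dXi (dXi u) p) (v ((), p)) (a ((), p)) (b ((), p)) (bx ((), p)) (bxx ((), p))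
      (m ((), p.swap)) (n ((), p.swap)) (my ((), p.swap)) (myy ((), p.swap)) = 0 := by
  have hqx : SobolevReg 2 (dXi q) := hq.dXi
  have hux : SobolevReg 3 (dXi u) := hu.dXi
  have hlim : ∀ {l : Filter ℝ} (y : ℝ), Tendsto (fun x => q (x, y)) l (𝓝 0) →
      Tendsto (fun x => u (x, y)) l (𝓝 0) → Tendsto (fun x => dXi u (x, y)) l (𝓝 0) →
      Tendsto (fun s => v ((), s, y) * a ((), s, y) * n ((), y, s)) l (𝓝 0) →
      Tendsto (fun x => I * σ * (starRingEnd ℂ (u (x, y)) * (-(1 / 2) * q (x, y) * b ((), x, y)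
          * m ((), y, x) + a ((), x, y) * my ((), y, x))
          - a ((), x, y) * m ((), y, x) * starRingEnd ℂ (dXi u (x, y)))
        + I * (b ((), x, y) * n ((), y, x) * dXi u (x, y) - u (x, y) * (bx ((), x, y) * n ((), y, x)
          + b ((), x, y) * (σ / 2 * starRingEnd ℂ (q (x, y)) * m ((), y, x))))
        - 2 * I * (v ((), x, y) * a ((), x, y) * n ((), y, x))
        + I * σ * (q (x, y) * starRingEnd ℂ (u (x, y)) + starRingEnd ℂ (q (x, y)) * u (x, y))
          * b ((), x, y) * m ((), y, x)) l (𝓝 0) := by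
    intro l y hq0 hu0 hux0 hv1
    have c := tendsto_conj_zero hu0
    have t1 := (BC.const (I * σ) * (BC.const (-(1 / 2)) * BC.ofFun q * b * swapL m
      + a * swapL my + BC.ofFun q * b * swapL m)).tendsto_mul_zero (fun s => (s, y)) c
    have t2 := (BC.const (-(I * σ)) * a * swapL m).tendsto_mul_zero (fun s => (s, y))
      (tendsto_conj_zero hux0)
    have t3 := (BC.const I * b * swapL n).tendsto_mul_zero (fun s => (s, y)) hux0
    have t4 := (BC.const (-I) * (bx * swapL n + b * (BC.const (σ / 2)
      * BC.ofFun (fun p => starRingEnd ℂ (q p)) * swapL m))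
      + BC.const (I * σ) * BC.ofFun (fun p => starRingEnd ℂ (q p)) * b * swapL m).tendsto_mul_zero
        (fun s => (s, y)) hu0
    have t5 := hv1.const_mul (-2 * I)
    have t := (((t1.add t2).add t3).add t4).add t5
    simp only [add_zero, mul_zero] at t
    refine t.congr fun x => ?_
    simp only [BC.add_apply, BC.mul_apply, BC.const_apply, swapL_apply, hq.ofFun_apply,
      hq.ofFun_conj_apply, Prod.swap_prod_mk]
    ring
  refine integral_eq_zero_of_hasDerivAt_fst
    (h := fun p => I * σ * (starRingEnd ℂ (u p) * (-(1 / 2) * q p * b ((), p)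
          * m ((), p.swap) + a ((), p) * my ((), p.swap))
          - a ((), p) * m ((), p.swap) * starRingEnd ℂ (dXi u p))
        + I * (b ((), p) * n ((), p.swap) * dXi u p - u p * (bx ((), p) * n ((), p.swap)
          + b ((), p) * (σ / 2 * starRingEnd ℂ (q p) * m ((), p.swap))))
        - 2 * I * (v ((), p) * a ((), p) * n ((), p.swap))
        + I * σ * (q p * starRingEnd ℂ (u p) + starRingEnd ℂ (q p) * u p)
          * b ((), p) * m ((), p.swap)) (fun x y => ?_)
    (integrable_fluxDeriv hq hu _ _ _ _ _ _ _ _ _) (fun y => ?_) (fun y => ?_)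
  · dsimp only [Prod.swap_prod_mk]
    have dq := hq.hasDerivAt_fst x y
    have dqc := hasDerivAt_conj dq
    have du := hu.hasDerivAt_fst x y
    have duc := hasDerivAt_conj du
    have dux := hux.hasDerivAt_fst x y
    have duxc := hasDerivAt_conj dux
    have da := hψ.f_x x y
    have db := hψ.g_x x y
    have dbx := hψ.g_xx x y
    -- The functions `m`, `n` live in swapped coordinates, so ξ is their second variable.
    have dm := hφ.f_y y x
    have dmx := hφ.f_yy y x
    have dn := hφ.g_y y x
    have dv := hv x y
    have D := ((((duc.mul ((((dq.const_mul (-(1 / 2))).mul db).mul dm).add (da.mul dmx))).sub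
      ((da.mul dm).mul duxc)).const_mul (I * σ)).add
      ((((db.mul dn).mul dux).sub (du.mul ((dbx.mul dn).add
        (db.mul ((dqc.const_mul (σ / 2 : ℂ)).mul dm))))).const_mul I)).sub
      (((dv.mul da).mul dn).const_mul (2 * I)) |>.add
      (((((dq.mul duc).add (dqc.mul du)).const_mul (I * σ)).mul db).mul dm)
    refine D.congr_deriv ?_
    simp only [negSwap, Prod.swap_prod_mk, map_neg, fluxDeriv, Pi.mul_apply, Pi.add_apply]
    ring
  -- At −∞ the term v ψ₁φ₂ vanishes because of `v`, at +∞ because of φ₂.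
  · refine hlim y (hq.tendsto_fst_atBot y) (hu.tendsto_fst_atBot y) (hux.tendsto_fst_atBot y) ?_
    refine ((a * swapL n).tendsto_mul_zero (fun s => (s, y)) (hv0 y)).congr fun s => ?_
    simp only [BC.mul_apply, swapL_apply, Prod.swap_prod_mk]; ring
  · refine hlim y (hq.tendsto_fst_atTop y) (hu.tendsto_fst_atTop y) (hux.tendsto_fst_atTop y) ?_
    refine ((v * a).tendsto_mul_zero (fun s => (s, y)) (hn y)).congr fun s => ?_
    simp only [BC.mul_apply]; ring

end Flux

/-! ### The spectral coefficients -/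

theorem negSwap_negSwap (q : ℝ × ℝ → ℂ) : negSwap (negSwap q) = q := by
  funext p; simp [negSwap]

theorem dXi_negSwap (q : ℝ × ℝ → ℂ) (p : ℝ × ℝ) : dXi (negSwap q) p = -dEta q p.swap := by
  simp only [dXi, dEta, negSwap, Prod.swap_prod_mk, Prod.fst_swap, Prod.snd_swap, deriv.fun_neg]

theorem dEta_negSwap (q : ℝ × ℝ → ℂ) (p : ℝ × ℝ) : dEta (negSwap q) p = -dXi q p.swap := by
  simp only [dXi, dEta, negSwap, Prod.swap_prod_mk, Prod.fst_swap, Prod.snd_swap, deriv.fun_neg]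

theorem integral_comp_swap (f : ℝ × ℝ → ℂ) : ∫ p : ℝ × ℝ, f p.swap = ∫ p, f p :=
  (Measure.measurePreserving_swap (μ := (volume : Measure ℝ)) (ν := (volume : Measure ℝ))).integral_comp
    MeasurableEquiv.prodComm.measurableEmbedding f

theorem integrable_comp_swap {f : ℝ × ℝ → ℂ} (hf : Integrable f) :
    Integrable fun p : ℝ × ℝ => f p.swap :=
  ((Measure.measurePreserving_swap (μ := (volume : Measure ℝ))
    (ν := (volume : Measure ℝ))).integrable_comp_emb
    MeasurableEquiv.prodComm.measurableEmbedding).2 hf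

theorem integral_superpose_mul {χ : ℝ → ℂ} (hχ : Integrable χ) (k : ℝ) (f : BC ℝ)
    {g : ℝ × ℝ → ℂ} (hg : Integrable g) :
    ∫ p, superpose hχ k f ((), p) * g p = ∫ k', χ k' * ∫ p, f (k - k', p) * g p := by
  have := superpose_swap_integral hχ k f hg (fun p => p) continuous_id
  simp only [mul_comm (g _)] at this
  exact this.symm

theorem continuous_integral_mul (f : BC ℝ) {g : ℝ × ℝ → ℂ} (hg : Integrable g) :
    Continuous fun k => ∫ p, f (k, p) * g p :=
  continuous_of_dominated (bound := fun p => ‖f‖ * ‖g p‖)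
    (fun k => (f.continuous.comp (by fun_prop)).aestronglyMeasurable.mul hg.aestronglyMeasurable)
    (fun k => Eventually.of_forall fun p => by
      rw [norm_mul]; exact mul_le_mul_of_nonneg_right (f.norm_apply_le _) (norm_nonneg _))
    (hg.norm.const_mul _)
    (Eventually.of_forall fun p => (f.continuous.comp (by fun_prop)).mul continuous_const)

theorem integrable_mul_integral {χ : ℝ → ℂ} (hχ : Integrable χ) (k : ℝ) (f : BC ℝ)
    {g : ℝ × ℝ → ℂ} (hg : Integrable g) :
    Integrable fun k' => χ k' * ∫ p, f (k - k', p) * g p := by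
  refine hχ.mul_bdd (c := ∫ p, ‖f‖ * ‖g p‖)
    ((continuous_integral_mul f hg).comp (by fun_prop)).aestronglyMeasurable
    (Eventually.of_forall fun k' => norm_integral_le_of_norm_le (hg.norm.const_mul _)
      (Eventually.of_forall fun p => ?_))
  rw [norm_mul]
  exact mul_le_mul_of_nonneg_right (f.norm_apply_le _) (norm_nonneg _)

/-- The integrand of the spectral coefficients. -/
def specDensity (σ : ℝ) (q u : ℝ × ℝ → ℂ) (κ p : ℝ × ℝ) : ℂ :=
  psiFst σ q (κ.1, p) * psiFst σ (negSwap q) (κ.2, p.swap) * σ * starRingEnd ℂ (u p)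
    + psiSnd σ q (κ.1, p) * psiSnd σ (negSwap q) (κ.2, p.swap) * u p

/-- The spectral coefficients of `u` for the potential `q`. -/
def specHat (σ : ℝ) (q u : ℝ × ℝ → ℂ) (κ : ℝ × ℝ) : ℂ :=
  (1 / (4 * Real.pi) : ℂ) * ∫ p, specDensity σ q u κ p

/-- By uniqueness any admissible choice of spectral functions is the canonical one, which is
continuous and bounded jointly in the spectral parameter and in space. -/
theorem hat_eq_specHat {σ : ℝ} (hσ : |σ| ≤ 1) {q : ℝ × ℝ → ℂ} (hq : SobolevReg 3 q)
    (hq' : SobolevReg 3 (negSwap q)) {ψ φ : ℝ → ℝ × ℝ → ℂ × ℂ} (hψ : ∀ k, IsPsi σ q k (ψ k))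
    (hφ : ∀ l, IsPhi σ q l (φ l)) (u : ℝ × ℝ → ℂ) : hat σ ψ φ u = specHat σ q u := by
  funext κ
  rw [hat, pairing, (hψ κ.1).eq hσ hq, (hφ κ.2).eq hσ hq']
  rfl

/-- An upper bound for the spectral functions, uniform in the spectral parameters. -/
def specBound (σ : ℝ) (q : ℝ × ℝ → ℂ) : ℝ :=
  ‖psiFst σ q‖ * ‖psiFst σ (negSwap q)‖ * |σ| + ‖psiSnd σ q‖ * ‖psiSnd σ (negSwap q)‖

theorem norm_specDensity_le (σ : ℝ) (q u : ℝ × ℝ → ℂ) (κ p : ℝ × ℝ) :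
    ‖specDensity σ q u κ p‖ ≤ specBound σ q * ‖u p‖ := by
  rw [specDensity, specBound, add_mul]
  refine (norm_add_le _ _).trans (add_le_add ?_ ?_)
  · rw [norm_mul, norm_mul, norm_mul, Complex.norm_real, RCLike.norm_conj, Real.norm_eq_abs]
    gcongr <;> exact BC.norm_apply_le _ _
  · rw [norm_mul, norm_mul]
    gcongr <;> exact BC.norm_apply_le _ _

theorem continuous_specHat (σ : ℝ) (q : ℝ × ℝ → ℂ) {u : ℝ × ℝ → ℂ} (hu : Continuous u)
    (hi : Integrable u) : Continuous (specHat σ q u) := by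
  have h1 := (psiFst σ q).continuous
  have h2 := (psiFst σ (negSwap q)).continuous
  have h3 := (psiSnd σ q).continuous
  have h4 := (psiSnd σ (negSwap q)).continuous
  refine continuous_const.mul (continuous_of_dominated
    (bound := fun p => specBound σ q * ‖u p‖) (fun κ => ?_)
    (fun κ => Eventually.of_forall fun p => norm_specDensity_le σ q u κ p) (hi.norm.const_mul _)
    (Eventually.of_forall fun p => ?_))
  · refine Continuous.aestronglyMeasurable ?_
    unfold specDensity
    fun_prop
  · unfold specDensity
    fun_prop

theorem norm_specHat_le (σ : ℝ) (q : ℝ × ℝ → ℂ) {u : ℝ × ℝ → ℂ} (hi : Integrable u) (κ : ℝ × ℝ) :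
    ‖specHat σ q u κ‖ ≤ specBound σ q * ∫ p, ‖u p‖ := by
  have h1 : ‖∫ p, specDensity σ q u κ p‖ ≤ specBound σ q * ∫ p, ‖u p‖ := by
    rw [← integral_const_mul]
    exact norm_integral_le_of_norm_le (hi.norm.const_mul _)
      (Eventually.of_forall fun p => norm_specDensity_le σ q u κ p)
  have h2 : ‖(1 / (4 * Real.pi) : ℂ)‖ ≤ 1 := by
    rw [norm_div, norm_one, norm_mul, Complex.norm_real, Real.norm_eq_abs, abs_of_pos Real.pi_pos,
      div_le_one (by simp [Real.pi_pos])]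
    simp only [RCLike.norm_ofNat]
    linarith [Real.pi_gt_three]
  rw [specHat, norm_mul]
  exact (mul_le_of_le_one_left (norm_nonneg _) h2).trans h1

theorem integrable_specHat_fst (σ : ℝ) (q : ℝ × ℝ → ℂ) {u : ℝ × ℝ → ℂ} (hu : Continuous u)
    (hi : Integrable u) {χ : ℝ → ℂ} (hχ : Integrable χ) (k l : ℝ) :
    Integrable fun k' => specHat σ q u (k - k', l) * χ k' :=
  hχ.bdd_mul (c := specBound σ q * ∫ p, ‖u p‖)
    ((continuous_specHat σ q hu hi).comp (by fun_prop)).aestronglyMeasurable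
    (Eventually.of_forall fun _ => norm_specHat_le σ q hi _)

theorem integrable_specHat_snd (σ : ℝ) (q : ℝ × ℝ → ℂ) {u : ℝ × ℝ → ℂ} (hu : Continuous u)
    (hi : Integrable u) {χ : ℝ → ℂ} (hχ : Integrable χ) (k l : ℝ) :
    Integrable fun l' => specHat σ q u (k, l - l') * χ l' :=
  hχ.bdd_mul (c := specBound σ q * ∫ p, ‖u p‖)
    ((continuous_specHat σ q hu hi).comp (by fun_prop)).aestronglyMeasurable
    (Eventually.of_forall fun _ => norm_specHat_le σ q hi _)

/-- Fubini turns a superposition of ψ over k into a convolution of the coefficients in k. -/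
theorem integral_superpose_fst (σ : ℝ) (q : ℝ × ℝ → ℂ) {u : ℝ × ℝ → ℂ}
    (hi : Integrable u) {χ : ℝ → ℂ} (hχ : Integrable χ) (k l : ℝ) :
    (1 / (4 * Real.pi) : ℂ) * ∫ p, (superpose hχ k (psiFst σ q) ((), p)
        * (psiOne σ (negSwap q) l ((), p.swap) * σ * starRingEnd ℂ (u p))
      + superpose hχ k (psiSnd σ q) ((), p) * (psiTwo σ (negSwap q) l ((), p.swap) * u p))
      = ∫ k', specHat σ q u (k - k', l) * χ k' := by
  have i1 : Integrable fun p => psiOne σ (negSwap q) l ((), p.swap) * σ * starRingEnd ℂ (u p) :=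
    (swapL (psiOne σ (negSwap q) l) * BC.const σ).integrable_mul (integrable_conj hi)
  have i2 : Integrable fun p => psiTwo σ (negSwap q) l ((), p.swap) * u p :=
    (swapL (psiTwo σ (negSwap q) l)).integrable_mul hi
  rw [integral_add ((superpose hχ k (psiFst σ q)).integrable_mul i1)
    ((superpose hχ k (psiSnd σ q)).integrable_mul i2), integral_superpose_mul hχ k _ i1,
    integral_superpose_mul hχ k _ i2, ← integral_add (integrable_mul_integral hχ k _ i1)
      (integrable_mul_integral hχ k _ i2), ← integral_const_mul]
  refine integral_congr_ae (Eventually.of_forall fun k' => ?_)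
  dsimp only
  have j1 : Integrable fun p => psiFst σ q (k - k', p)
      * (psiOne σ (negSwap q) l ((), p.swap) * σ * starRingEnd ℂ (u p)) :=
    (sliceL (k - k') (psiFst σ q)).integrable_mul i1
  have j2 : Integrable fun p => psiSnd σ q (k - k', p)
      * (psiTwo σ (negSwap q) l ((), p.swap) * u p) :=
    (sliceL (k - k') (psiSnd σ q)).integrable_mul i2
  rw [← mul_add, ← integral_add j1 j2, specHat, mul_comm (χ k'), ← mul_assoc]
  congr 2
  refine integral_congr_ae (Eventually.of_forall fun p => ?_)
  change psiFst σ q (k - k', p) * (psiFst σ (negSwap q) (l, p.swap) * _ * _)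
    + psiSnd σ q (k - k', p) * (psiSnd σ (negSwap q) (l, p.swap) * _) = specDensity σ q u _ p
  rw [specDensity]
  ring

/-- The density is linear in `u` and conjugate `u`, hence the sign; the swap exchanges ψ and φ. This
transfers the convolution formula from k to l. -/
theorem specHat_negSwap (σ : ℝ) (q u : ℝ × ℝ → ℂ) (k l : ℝ) :
    specHat σ (negSwap q) (negSwap u) (l, k) = -specHat σ q u (k, l) := by
  rw [specHat, specHat, ← mul_neg, ← integral_neg, ← integral_comp_swap]
  congr 1
  refine integral_congr_ae (Eventually.of_forall fun p => ?_)
  simp only [specDensity, negSwap_negSwap]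
  simp only [negSwap, Prod.swap_swap, map_neg]
  ring

theorem integral_superpose_snd (σ : ℝ) (q : ℝ × ℝ → ℂ) {u : ℝ × ℝ → ℂ}
    (hi : Integrable u) {χ : ℝ → ℂ} (hχ : Integrable χ) (k l : ℝ) :
    (1 / (4 * Real.pi) : ℂ) * ∫ p, (psiOne σ q k ((), p)
        * superpose hχ l (psiFst σ (negSwap q)) ((), p.swap) * σ * starRingEnd ℂ (u p)
      + psiTwo σ q k ((), p) * superpose hχ l (psiSnd σ (negSwap q)) ((), p.swap) * u p)
      = ∫ l', specHat σ q u (k, l - l') * χ l' := by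
  have h := integral_superpose_fst σ (negSwap q) (u := negSwap u) (integrable_comp_swap hi).neg
    hχ l k
  simp only [specHat_negSwap, neg_mul, integral_neg] at h
  rw [← neg_inj, ← h, ← mul_neg, ← integral_neg, ← integral_comp_swap]
  congr 1
  refine integral_congr_ae (Eventually.of_forall fun p => ?_)
  simp only [negSwap_negSwap]
  simp only [negSwap, Prod.swap_swap, map_neg]
  ring

/-! ### Evolution of the spectral coefficients -/

theorem BC.integral_add_integral (b b' c c' : BC Unit) {f f' g g' : ℝ × ℝ → ℂ} (hf : Integrable f)
    (hf' : Integrable f') (hg : Integrable g) (hg' : Integrable g') :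
    (∫ p, (b ((), p) * f p + b' ((), p) * f' p)) + ∫ p, (c ((), p) * g p + c' ((), p) * g' p)
      = ∫ p, (b ((), p) * f p + b' ((), p) * f' p + (c ((), p) * g p + c' ((), p) * g' p)) :=
  (integral_add ((b.integrable_mul hf).add (b'.integrable_mul hf'))
    ((c.integrable_mul hg).add (c'.integrable_mul hg'))).symm

theorem integral_combination {y a b d e e' : ℝ × ℝ → ℂ} (c : ℂ) (hy : Integrable y)
    (ha : Integrable a) (hb : Integrable b) (hd : Integrable d) (he : Integrable e)
    (he' : Integrable e') :
    ∫ p, (c * y p + a p + b p + d p + e p - e' p)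
      = c * (∫ p, y p) + (∫ p, a p) + (∫ p, b p) + (∫ p, d p) + (∫ p, e p) - ∫ p, e' p := by
  have h1 : Integrable fun p => c * y p + a p := (hy.const_mul c).add ha
  have h2 : Integrable fun p => c * y p + a p + b p := h1.add hb
  have h3 : Integrable fun p => c * y p + a p + b p + d p := h2.add hd
  have h4 : Integrable fun p => c * y p + a p + b p + d p + e p := h3.add he
  rw [integral_sub h4 he', integral_add h3 he, integral_add h2 hd, integral_add h1 hb,
    integral_add (hy.const_mul c) ha, integral_const_mul]

section Evolution

variable {σ T : ℝ} {u₁ u₂ : ℝ → ℝ} {Q F U : ℝ → ℝ × ℝ → ℂ} {G₁ G₂ V₁ V₂ : ℝ → ℝ × ℝ → ℝ}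

theorem IsLinearizedSolution.hasDerivAt_V₁ (h : IsLinearizedSolution σ T Q G₁ G₂ F U V₁ V₂) {t : ℝ}
    (ht : t ∈ Set.Icc 0 T) (hq : Differentiable ℝ (Q t)) (hu : Differentiable ℝ (U t)) (x y : ℝ) :
    HasDerivAt (fun s => (V₁ t (s, y) : ℂ)) (-(σ / 2)
      * (dEta (Q t) (x, y) * starRingEnd ℂ (U t (x, y))
        + Q t (x, y) * starRingEnd ℂ (dEta (U t) (x, y))
        + starRingEnd ℂ (dEta (Q t) (x, y)) * U t (x, y)
        + starRingEnd ℂ (Q t (x, y)) * dEta (U t) (x, y))) x := by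
  have h1 : HasDerivAt (fun s => V₁ t (s, y)) (dXi (V₁ t) (x, y)) x :=
    (h.differentiable_V₁ t ht x y).hasDerivAt
  refine h1.ofReal_comp.congr_deriv ?_
  rw [h.eq_V₁ t ht, dEta_cross hq hu]
  push_cast
  simp only [ofReal_cross]
  ring

theorem IsLinearizedSolution.integral_fluxDeriv (h : IsLinearizedSolution σ T Q G₁ G₂ F U V₁ V₂)
    (hQ : RegularOn 3 T Q) (hU : RegularOn 4 T U) {t : ℝ} (ht : t ∈ Set.Icc 0 T)
    {a b ay ayy bx bxx m n my myy nx nxx : BC Unit}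
    (hψ : DiracJet σ (Q t) a b ay ayy bx bxx)
    (hφ : DiracJet σ (negSwap (Q t)) m n my myy nx nxx)
    (hn : ∀ x, Tendsto (fun s => n ((), x, s)) atTop (𝓝 0)) :
    Integrable (fun p : ℝ × ℝ => fluxDeriv σ (Q t p) (dXi (Q t) p) (dEta (Q t) p) (U t p)
      (dXi (U t) p) (dEta (U t) p) (dXi (dXi (U t)) p) (V₁ t p) (a ((), p)) (b ((), p))
      (bx ((), p)) (bxx ((), p)) (m ((), p.swap)) (n ((), p.swap)) (my ((), p.swap))
      (myy ((), p.swap))) ∧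
    ∫ p : ℝ × ℝ, fluxDeriv σ (Q t p) (dXi (Q t) p) (dEta (Q t) p) (U t p)
      (dXi (U t) p) (dEta (U t) p) (dXi (dXi (U t)) p) (V₁ t p) (a ((), p)) (b ((), p))
      (bx ((), p)) (bxx ((), p)) (m ((), p.swap)) (n ((), p.swap)) (my ((), p.swap))
      (myy ((), p.swap)) = 0 := by
  obtain ⟨v, -, hv⟩ := h.exists_V₁ hQ (hU.mono (by omega))
  have hq : SobolevReg 3 (Q t) := hQ.sobolevReg ht
  have hu : SobolevReg 4 (U t) := hU.sobolevReg ht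
  have hvt := hv t ht
  refine ⟨?_, ?_⟩
  · have := integrable_fluxDeriv (σ := σ) hq hu (v t) a b bx bxx m n my myy
    simpa only [hvt] using this
  · have := DS1.integral_fluxDeriv (v := v t) hq hu (fun x y => by
      simp only [hvt]
      exact h.hasDerivAt_V₁ ht hq.differentiable hu.differentiable x y) (fun y => by
      simp only [hvt]
      simpa [Function.comp_def] using
        (Complex.continuous_ofReal.tendsto _).comp (h.boundary_V₁ t ht y)) hψ hφ hn
    simpa only [hvt] using this

/-- The product rule for the pairing, the Lax equations for ψ and φ, and the linearized equation for
U leave the stated terms plus a divergence with integral 0. -/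
theorem IsLinearizedSolution.hasDerivWithinAt_specHat (hσ : |σ| ≤ 1)
    (h : IsLinearizedSolution σ T Q G₁ G₂ F U V₁ V₂)
    (hs : IsSolution σ T u₁ u₂ Q G₁ G₂) (hQ : RegularOn 3 T Q) (hU : RegularOn 4 T U)
    (hF : RegularOn 4 T F)
    (hu₁ : Continuous u₁ ∧ Integrable u₁ ∧ Integrable (kernel u₁))
    (hu₂ : Continuous u₂ ∧ Integrable u₂ ∧ Integrable (kernel u₂))
    {t : ℝ} (ht : t ∈ Set.Icc 0 T) (k l : ℝ) :
    HasDerivWithinAt (fun s => specHat σ (Q s) (U s) (k, l))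
      (Complex.I * ((k : ℂ) ^ 2 + (l : ℂ) ^ 2) * specHat σ (Q t) (U t) (k, l)
        + (∫ k', specHat σ (Q t) (U t) (k - k', l) * kernel u₁ k')
        + (∫ l', specHat σ (Q t) (U t) (k, l - l') * kernel u₂ l')
        + specHat σ (Q t) (F t) (k, l)) (Set.Icc 0 T) t := by
  have hb₁ := exists_bound_of_kernel hu₁.1 hu₁.2.1 hu₁.2.2
  have hb₂ := exists_bound_of_kernel hu₂.1 hu₂.2.1 hu₂.2.2
  have hQ' : RegularOn 3 T (fun t => negSwap (Q t)) := hQ.neg_swap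
  have hU' : RegularOn 4 T (fun t => negSwap (U t)) := hU.neg_swap
  obtain ⟨ay, ayy, bx, bxx, w₁, w₂, hψ, hw₁, hw₂, ew₁, ew₂⟩ :=
    hs.exists_hasDerivWithinAt_psi hσ hQ hu₁ hu₂ ht k
  obtain ⟨my, myy, nx, nxx, z₁, z₂, hφ, hz₁, hz₂, ez₁, ez₂⟩ :=
    hs.swap.exists_hasDerivWithinAt_psi hσ hQ' hu₂ hu₁ ht l
  have hb0 := (isPsi_psi hσ (hQ.sobolevReg ht) k).boundary₂
  have hn0 := (isPsi_psi hσ (hQ'.sobolevReg ht) l).boundary₂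
  obtain ⟨iE, hE⟩ := h.integral_fluxDeriv hQ hU ht hψ hφ hn0
  -- The η-part of the divergence is the ξ-part of the swapped problem, with ψ and φ exchanged. It
  -- enters below with a minus sign, because the spectral density is odd under the symmetry.
  obtain ⟨iE', hE'⟩ := h.swap.integral_fluxDeriv hQ' hU' ht hφ
    (by rw [negSwap_negSwap]; exact hψ) hb0
  replace iE' := integrable_comp_swap iE'
  rw [← integral_comp_swap] at hE'
  have hfam := h.lOneFamily hs hQ hU hF ⟨hu₁.1, hb₁⟩ ⟨hu₂.1, hb₂⟩ ht
  have cU : ∀ s ∈ Set.Icc 0 T, Continuous (U s) := fun s hs => (hU.sobolevReg hs).continuous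
  have iU : ∀ s ∈ Set.Icc 0 T, Integrable (U s) := fun s hs => (hU.sobolevReg hs).integrable_self
  have iF : Integrable (F t) := (hF.sobolevReg ht).integrable_self
  -- Time derivatives of the bounded weights σψ₁φ₁ and ψ₂φ₂, in the supremum norm.
  have B1 := (HasDerivWithinAt.mul hw₁ (swapL.hasFDerivAt.comp_hasDerivWithinAt t hz₁)).const_mul
    (BC.const σ)
  have B2 := HasDerivWithinAt.mul hw₂ (swapL.hasFDerivAt.comp_hasDerivWithinAt t hz₂)
  have D1 := LOneFamily.hasDerivWithinAt_integral
    (f := fun s p => starRingEnd ℂ (U s p)) (fun s hs => Complex.continuous_conj.comp (cU s hs))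
    (fun s hs => integrable_conj (iU s hs)) hfam.conj
    (fun s hs p => (Complex.conjCLE : ℂ →L[ℝ] ℂ).hasFDerivAt.comp_hasDerivWithinAt s
      (h.hasDerivWithinAt hs p)) Set.ordConnected_Icc ht B1
  have D2 := LOneFamily.hasDerivWithinAt_integral cU iU hfam
    (fun s hs p => h.hasDerivWithinAt hs p) Set.ordConnected_Icc ht B2
  refine (((D1.add D2).const_mul (1 / (4 * Real.pi) : ℂ)).congr_of_mem (fun s hs => ?_)
    ht).congr_deriv ?_
  · simp only [specHat, Pi.add_apply]
    rw [← integral_add (BC.integrable_mul _ (integrable_conj (iU s hs)))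
      (BC.integrable_mul _ (iU s hs))]
    congr 1
    refine integral_congr_ae (Eventually.of_forall fun p => ?_)
    simp only [BC.mul_apply, BC.const_apply, Function.comp_apply, swapL_apply, Pi.mul_apply]
    change specDensity σ (Q s) (U s) (k, l) p = σ * (psiFst σ (Q s) (k, p)
      * psiFst σ (negSwap (Q s)) (l, p.swap)) * _ + psiSnd σ (Q s) (k, p)
      * psiSnd σ (negSwap (Q s)) (l, p.swap) * _
    rw [specDensity]; ring
  · have cU' := integrable_conj (iU t ht)
    have I1 := integral_superpose_fst σ (Q t) (iU t ht) hu₁.2.2 k l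
    have I2 := integral_superpose_snd σ (Q t) (iU t ht) hu₂.2.2 k l
    set a := psiOne σ (Q t) k
    set b := psiTwo σ (Q t) k
    set m := psiOne σ (negSwap (Q t)) l
    set n := psiTwo σ (negSwap (Q t)) l
    have iY : Integrable fun p : ℝ × ℝ => a ((), p) * m ((), p.swap) * σ * starRingEnd ℂ (U t p)
        + b ((), p) * n ((), p.swap) * U t p :=
      ((a * swapL m * BC.const σ).integrable_mul cU').add ((b * swapL n).integrable_mul (iU t ht))
    have iG : Integrable fun p : ℝ × ℝ => a ((), p) * m ((), p.swap) * σ * starRingEnd ℂ (F t p)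
        + b ((), p) * n ((), p.swap) * F t p :=
      ((a * swapL m * BC.const σ).integrable_mul (integrable_conj iF)).add
        ((b * swapL n).integrable_mul iF)
    have i1 : Integrable fun p : ℝ × ℝ => superpose hu₁.2.2 k (psiFst σ (Q t)) ((), p)
          * (m ((), p.swap) * σ * starRingEnd ℂ (U t p))
        + superpose hu₁.2.2 k (psiSnd σ (Q t)) ((), p) * (n ((), p.swap) * U t p) :=
      (BC.integrable_mul _ ((swapL m * BC.const σ).integrable_mul cU')).add
        (BC.integrable_mul _ ((swapL n).integrable_mul (iU t ht)))
    have i2 : Integrable fun p : ℝ × ℝ => a ((), p)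
          * superpose hu₂.2.2 l (psiFst σ (negSwap (Q t))) ((), p.swap) * σ * starRingEnd ℂ (U t p)
        + b ((), p) * superpose hu₂.2.2 l (psiSnd σ (negSwap (Q t))) ((), p.swap) * U t p :=
      ((a * swapL (superpose hu₂.2.2 l (psiFst σ (negSwap (Q t))))
        * BC.const σ).integrable_mul cU').add
        ((b * swapL (superpose hu₂.2.2 l (psiSnd σ (negSwap (Q t))))).integrable_mul (iU t ht))
    have eY : specHat σ (Q t) (U t) (k, l) = (1 / (4 * Real.pi) : ℂ) * ∫ p : ℝ × ℝ,
        (a ((), p) * m ((), p.swap) * σ * starRingEnd ℂ (U t p)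
          + b ((), p) * n ((), p.swap) * U t p) := rfl
    have eG : specHat σ (Q t) (F t) (k, l) = (1 / (4 * Real.pi) : ℂ) * ∫ p : ℝ × ℝ,
        (a ((), p) * m ((), p.swap) * σ * starRingEnd ℂ (F t p)
          + b ((), p) * n ((), p.swap) * F t p) := rfl
    rw [← I1, ← I2, eY, eG, BC.integral_add_integral _ _ _ _ cU'
      (integrable_conj (hfam.integrable t ht)) (iU t ht) (hfam.integrable t ht)]
    have hxx : dXi (dXi (negSwap (U t))) = negSwap (dEta (dEta (U t))) := by
      rw [show dXi (negSwap (U t)) = negSwap (dEta (U t)) from funext (dXi_negSwap _)]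
      exact funext (dXi_negSwap _)
    have hc := integral_combination (Complex.I * ((k : ℂ) ^ 2 + (l : ℂ) ^ 2)) iY i1 i2 iG iE iE'
    rw [hE, hE'] at hc
    rw [integral_congr_ae (Eventually.of_forall fun p => ?_), hc]
    · ring
    -- The pointwise identity that exhibits the divergence. The derivatives of QŪ + Q̄U occur in
    -- both fluxes and cancel in their difference.
    · simp only [BC.mul_apply, BC.add_apply, BC.const_apply, Function.comp_apply, swapL_apply,
        Pi.mul_apply, linTimeDeriv, lap, map_mul, map_add, Complex.conj_I, Complex.conj_ofReal,
        ew₁, ew₂, ez₁, ez₂, fluxDeriv, hxx, dXi_negSwap, dEta_negSwap]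
      simp only [negSwap, swapR, Prod.swap_swap, map_neg]
      push_cast
      ring

end Evolution

/-! ### Bounds that are uniform in time -/

section UniformBounds

variable {σ T : ℝ} {u₁ u₂ : ℝ → ℝ} {Q : ℝ → ℝ × ℝ → ℂ} {G₁ G₂ : ℝ → ℝ × ℝ → ℝ}

/-- Differentiability in time holds uniformly in the spectral parameter too, because the plane wave
does not depend on time and no space derivative is taken. -/
theorem IsSolution.continuousOn_psi (hσ : |σ| ≤ 1) (h : IsSolution σ T u₁ u₂ Q G₁ G₂)
    (hQ : RegularOn 3 T Q)
    (hu₁ : Continuous u₁ ∧ ∃ C, ∀ y, |u₁ y| ≤ C) (hu₂ : Continuous u₂ ∧ ∃ C, ∀ y, |u₂ y| ≤ C) :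
    ContinuousOn (fun s => psiFst σ (Q s)) (Set.Icc 0 T) ∧
      ContinuousOn (fun s => psiSnd σ (Q s)) (Set.Icc 0 T) := by
  have key : ∀ t ∈ Set.Icc 0 T, ∃ f', HasDerivWithinAt (fun s => psiFst σ (Q s)) f'
      (Set.Icc 0 T) t := fun t ht => by
    obtain ⟨f', hf', -⟩ := (h.lineFamily hQ hu₁ hu₂ ht).exists_hasDerivWithinAt
      Set.ordConnected_Icc ht ((hQ.sobolevReg ht).isUnit (P := ℝ) hσ)
      (f := fun s => psiFst σ (Q s)) (g := fun _ => planeWave)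
      (hasDerivWithinAt_const t _ _) (fun s hs => psiFst_eq hσ (hQ.sobolevReg hs))
    exact ⟨f', hf'⟩
  refine ⟨fun t ht => ?_, fun t ht => ?_⟩ <;> obtain ⟨f', hf'⟩ := key t ht
  · exact hf'.continuousWithinAt
  · exact (((h.lineFamily hQ hu₁ hu₂ ht).hasDerivWithinAt_opB (P := ℝ) σ Set.ordConnected_Icc
      ht).clm_apply hf').continuousWithinAt

theorem RegularOn.continuousOn_integral_norm {n : ℕ} {U : ℝ → ℝ × ℝ → ℂ} (hU : RegularOn n T U) :
    ContinuousOn (fun s => ∫ p, ‖U s p‖) (Set.Icc 0 T) := by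
  intro t ht
  have hi : ∀ s ∈ Set.Icc 0 T, Integrable (U s) := fun s hs => (hU.sobolevReg hs).integrable_self
  refine tendsto_iff_norm_sub_tendsto_zero.2 (squeeze_zero' (Eventually.of_forall fun _ =>
    norm_nonneg _) ?_ (hU.continuous_L1 t ht 0 0 (by omega)))
  filter_upwards [self_mem_nhdsWithin] with s hs
  rw [← integral_sub (hi s hs).norm (hi t ht).norm]
  refine norm_integral_le_of_norm_le ((hi s hs).sub (hi t ht)).norm
    (Eventually.of_forall fun p => ?_)
  exact abs_norm_sub_norm_le _ _

/-- The bound at each time is continuous in time, hence bounded on the compact interval. -/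
theorem IsSolution.exists_bound_specHat (hσ : |σ| ≤ 1) (h : IsSolution σ T u₁ u₂ Q G₁ G₂)
    (hQ : RegularOn 3 T Q)
    (hu₁ : Continuous u₁ ∧ ∃ C, ∀ y, |u₁ y| ≤ C) (hu₂ : Continuous u₂ ∧ ∃ C, ∀ y, |u₂ y| ≤ C)
    {n : ℕ} {U : ℝ → ℝ × ℝ → ℂ} (hU : RegularOn n T U) :
    ∃ C : ℝ, 0 ≤ C ∧ ∀ s ∈ Set.Icc 0 T, ∀ κ, ‖specHat σ (Q s) (U s) κ‖ ≤ C := by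
  obtain ⟨c1, c2⟩ := h.continuousOn_psi hσ hQ hu₁ hu₂
  have hQ' : RegularOn 3 T (fun t => negSwap (Q t)) := hQ.neg_swap
  obtain ⟨c3, c4⟩ := h.swap.continuousOn_psi hσ hQ' hu₂ hu₁
  have hc : ContinuousOn (fun s => specBound σ (Q s) * ∫ p, ‖U s p‖) (Set.Icc 0 T) := by
    refine ContinuousOn.mul ?_ hU.continuousOn_integral_norm
    exact ((c1.norm.mul c3.norm).mul continuousOn_const).add (c2.norm.mul c4.norm)
  obtain ⟨C, hC⟩ := isCompact_Icc.exists_bound_of_continuousOn hc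
  refine ⟨max C 0, le_max_right _ _, fun s hs κ => ?_⟩
  exact ((norm_specHat_le σ (Q s) (hU.sobolevReg hs).integrable_self κ).trans
    (le_abs_self _)).trans ((hC s hs).trans (le_max_left _ _))

end UniformBounds

/-! ### Differentiation under the integral sign on an interval -/

/-- The mean value inequality on the convex set bounds the slopes by `G`, and dominated convergence
applies to them. Working within `S` covers one-sided derivatives at end points. -/
theorem hasDerivWithinAt_integral_of_dominated {α : Type*} [MeasurableSpace α] {μ : Measure α}
    {S : Set ℝ} (hS : Convex ℝ S) {t : ℝ} (ht : t ∈ S) {f f' : ℝ → α → ℂ} {G : α → ℝ}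
    (hf : ∀ s ∈ S, Integrable (f s) μ)
    (hd : ∀ x, ∀ s ∈ S, HasDerivWithinAt (fun r => f r x) (f' s x) S s)
    (hG : Integrable G μ) (hb : ∀ᵐ x ∂μ, ∀ s ∈ S, ‖f' s x‖ ≤ G x) :
    HasDerivWithinAt (fun s => ∫ x, f s x ∂μ) (∫ x, f' t x ∂μ) S t := by
  rw [hasDerivWithinAt_iff_tendsto_slope]
  have hlim : Tendsto (fun s => ∫ x, slope (fun r => f r x) t s ∂μ) (𝓝[S \ {t}] t)
      (𝓝 (∫ x, f' t x ∂μ)) := by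
    refine tendsto_integral_filter_of_dominated_convergence G ?_ ?_ hG ?_
    · filter_upwards [self_mem_nhdsWithin] with s hs
      exact (((hf s hs.1).sub (hf t ht)).smul ((s - t)⁻¹ : ℝ)).aestronglyMeasurable
    · filter_upwards [self_mem_nhdsWithin] with s hs
      filter_upwards [hb] with x hx
      have h1 := hS.norm_image_sub_le_of_norm_hasDerivWithin_le (fun r hr => hd x r hr) hx ht hs.1
      have hne : 0 < ‖s - t‖ := norm_pos_iff.2 (sub_ne_zero.2 hs.2)
      rw [slope_def_module, norm_smul, norm_inv, inv_mul_le_iff₀ hne, mul_comm]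
      exact h1
    · exact Eventually.of_forall fun x => hasDerivWithinAt_iff_tendsto_slope.1 (hd x t ht)
  refine hlim.congr' ?_
  filter_upwards [self_mem_nhdsWithin] with s hs
  simp only [slope_def_module]
  rw [integral_smul, integral_sub (hf s hs.1) (hf t ht)]

/-! ### Convolution along a direction -/

section Convolution

variable {χ : ℝ → ℂ} {v : ℝ × ℝ}

/-- `∫ f(κ - k'v) χ(k') dk'`. -/
def convAlong (χ : ℝ → ℂ) (v : ℝ × ℝ) (f : ℝ × ℝ → ℂ) (κ : ℝ × ℝ) : ℂ :=
  ∫ k', f (κ - k' • v) * χ k'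

/-- The shear by which convolution along a direction is moved to the other factor. -/
theorem measurePreserving_shift (v : ℝ × ℝ) :
    MeasurePreserving (fun z : ℝ × (ℝ × ℝ) => (z.1, z.2 + z.1 • v)) (volume.prod volume)
      (volume.prod volume) :=
  (MeasurePreserving.id volume).skew_product (g := fun a κ => κ + a • v) (by fun_prop)
    (Eventually.of_forall fun a => (measurePreserving_add_right volume (a • v)).map_eq)

theorem continuous_convAlong (hχ : Integrable χ) (v : ℝ × ℝ) {f : ℝ × ℝ → ℂ} (hf : Continuous f)
    {C : ℝ} (hC : ∀ κ, ‖f κ‖ ≤ C) : Continuous (convAlong χ v f) :=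
  continuous_of_dominated (bound := fun k' => C * ‖χ k'‖)
    (fun κ => (hf.comp (by fun_prop)).aestronglyMeasurable.mul hχ.aestronglyMeasurable)
    (fun κ => Eventually.of_forall fun k' => by
      rw [norm_mul]; exact mul_le_mul_of_nonneg_right (hC _) (norm_nonneg _))
    (hχ.norm.const_mul _)
    (Eventually.of_forall fun k' => (hf.comp (by fun_prop)).mul continuous_const)

theorem norm_convAlong_le (hχ : Integrable χ) (v : ℝ × ℝ) {f : ℝ × ℝ → ℂ}
    {C : ℝ} (hC : ∀ κ, ‖f κ‖ ≤ C) (κ : ℝ × ℝ) : ‖convAlong χ v f κ‖ ≤ C * ∫ k', ‖χ k'‖ := by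
  rw [← integral_const_mul]
  refine norm_integral_le_of_norm_le (hχ.norm.const_mul _) (Eventually.of_forall fun k' => ?_)
  rw [norm_mul]; exact mul_le_mul_of_nonneg_right (hC _) (norm_nonneg _)

theorem integrable_shift {E : Type*} [NormedRing E] {χ : ℝ → E} (hχ : Integrable χ) (v : ℝ × ℝ)
    {g : ℝ × ℝ → E} (hg : Integrable g) :
    Integrable (fun z : ℝ × (ℝ × ℝ) => χ z.1 * g (z.2 - z.1 • v)) (volume.prod volume) := by
  have := (measurePreserving_shift (-v)).integrable_comp_of_integrable (hχ.mul_prod hg)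
  refine this.congr (Eventually.of_forall fun z => ?_)
  simp only [Function.comp_apply, smul_neg, sub_eq_add_neg]

/-- Joint integrability is taken as hypothesis because it is used with a bounded `f` and integrable
`Θ` in the weak form, and with an integrable `f` and a wave for `Θ` in the pointwise form. -/
theorem integrable_mul_shift {f Θ : ℝ × ℝ → ℂ}
    (H : Integrable (fun z : ℝ × (ℝ × ℝ) => χ z.1 * (f (z.2 - z.1 • v) * Θ z.2))
      (volume.prod volume)) :
    Integrable (fun z : ℝ × (ℝ × ℝ) => χ z.1 * (f z.2 * Θ (z.2 + z.1 • v)))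
      (volume.prod volume) := by
  refine ((measurePreserving_shift v).integrable_comp_of_integrable H).congr
    (Eventually.of_forall fun z => ?_)
  simp only [Function.comp_apply, add_sub_cancel_right]

theorem integrable_mul_integral_shift {f Θ : ℝ × ℝ → ℂ}
    (H : Integrable (fun z : ℝ × (ℝ × ℝ) => χ z.1 * (f (z.2 - z.1 • v) * Θ z.2))
      (volume.prod volume)) : Integrable fun κ => f κ * ∫ k', χ k' * Θ (κ + k' • v) := by
  refine (integrable_mul_shift H).integral_prod_right.congr (Eventually.of_forall fun κ => ?_)
  dsimp only
  rw [← integral_const_mul]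
  refine integral_congr_ae (Eventually.of_forall fun k' => ?_)
  dsimp only; ring

/-- Convolution along `v` is dual to the superposition of translates along `v`. -/
theorem integral_convAlong_mul {f Θ : ℝ × ℝ → ℂ}
    (H : Integrable (fun z : ℝ × (ℝ × ℝ) => χ z.1 * (f (z.2 - z.1 • v) * Θ z.2))
      (volume.prod volume)) :
    ∫ κ, convAlong χ v f κ * Θ κ = ∫ κ, f κ * ∫ k', χ k' * Θ (κ + k' • v) := by
  calc ∫ κ, convAlong χ v f κ * Θ κ
      = ∫ κ, ∫ k', χ k' * (f (κ - k' • v) * Θ κ) := by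
        refine integral_congr_ae (Eventually.of_forall fun κ => ?_)
        simp only [convAlong]
        rw [← integral_mul_const]
        refine integral_congr_ae (Eventually.of_forall fun k' => ?_)
        dsimp only; ring
    _ = ∫ k', ∫ κ, χ k' * (f (κ - k' • v) * Θ κ) := (integral_integral_swap H).symm
    _ = ∫ k', ∫ κ, χ k' * (f κ * Θ (κ + k' • v)) := by
        refine integral_congr_ae (Eventually.of_forall fun k' => ?_)
        dsimp only
        rw [← integral_add_right_eq_self _ (k' • v)]
        simp only [add_sub_cancel_right]
    _ = ∫ κ, ∫ k', χ k' * (f κ * Θ (κ + k' • v)) := integral_integral_swap (integrable_mul_shift H)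
    _ = _ := by
        refine integral_congr_ae (Eventually.of_forall fun κ => ?_)
        dsimp only
        rw [← integral_const_mul]
        refine integral_congr_ae (Eventually.of_forall fun k' => ?_)
        dsimp only; ring

end Convolution

/-! ### The inverse Fourier transform of the spectral coefficients -/

/-- The exponential `exp(-ikη - ilξ)`. -/
def wave (κ p : ℝ × ℝ) : ℂ :=
  Complex.exp (-(Complex.I * κ.1 * p.2) - Complex.I * κ.2 * p.1)

theorem tilde_eq (g : ℝ × ℝ → ℂ) (p : ℝ × ℝ) :
    tilde g p = (1 / (2 * Real.pi) : ℂ) * ∫ κ, g κ * wave κ p := rfl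

theorem wave_comm (κ p : ℝ × ℝ) : wave κ p = wave p κ := by
  unfold wave; congr 1; ring

theorem norm_wave (κ p : ℝ × ℝ) : ‖wave κ p‖ = 1 := by
  have : -(Complex.I * κ.1 * p.2) - Complex.I * κ.2 * p.1
      = ((-(κ.1 * p.2) - κ.2 * p.1 : ℝ) : ℂ) * Complex.I := by push_cast; ring
  rw [wave, this, Complex.norm_exp_ofReal_mul_I]

theorem continuous_wave {α : Type*} [TopologicalSpace α] {f g : α → ℝ × ℝ} (hf : Continuous f)
    (hg : Continuous g) : Continuous fun a => wave (f a) (g a) := by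
  unfold wave; fun_prop

theorem wave_add (κ κ' p : ℝ × ℝ) : wave (κ + κ') p = wave κ p * wave κ' p := by
  unfold wave
  rw [← Complex.exp_add]
  congr 1
  simp only [Prod.fst_add, Prod.snd_add]
  push_cast; ring

theorem integrable_mul_wave {g : ℝ × ℝ → ℂ} (hg : Integrable g) (p : ℝ × ℝ) :
    Integrable fun κ => g κ * wave κ p :=
  hg.mul_bdd (c := 1) (continuous_wave continuous_id continuous_const).aestronglyMeasurable
    (Eventually.of_forall fun _ => (norm_wave _ _).le)

theorem norm_tilde_le (g : ℝ × ℝ → ℂ) (p : ℝ × ℝ) : ‖tilde g p‖ ≤ ∫ κ, ‖g κ‖ := by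
  have h2 : ‖(1 / (2 * Real.pi) : ℂ)‖ ≤ 1 := by
    rw [norm_div, norm_one, norm_mul, Complex.norm_real, Real.norm_eq_abs, abs_of_pos Real.pi_pos,
      div_le_one (by simp [Real.pi_pos])]
    simp only [RCLike.norm_ofNat]
    linarith [Real.pi_gt_three]
  rw [tilde_eq, norm_mul]
  refine (mul_le_of_le_one_left (norm_nonneg _) h2).trans
    ((norm_integral_le_integral_norm _).trans_eq ?_)
  simp only [norm_mul, norm_wave, mul_one]

theorem continuous_tilde {g : ℝ × ℝ → ℂ} (hg : Integrable g) : Continuous (tilde g) :=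
  continuous_const.mul (continuous_of_dominated (bound := fun κ => ‖g κ‖)
    (fun p => (integrable_mul_wave hg p).aestronglyMeasurable)
    (fun p => Eventually.of_forall fun κ => by rw [norm_mul]; exact (mul_le_mul_of_nonneg_left
      (norm_wave κ p).le (norm_nonneg _)).trans_eq (mul_one _)) hg.norm
    (Eventually.of_forall fun κ => continuous_const.mul (continuous_wave continuous_const continuous_id)))

theorem tilde_add {f g : ℝ × ℝ → ℂ} (hf : Integrable f) (hg : Integrable g) (p : ℝ × ℝ) :
    tilde (fun κ => f κ + g κ) p = tilde f p + tilde g p := by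
  simp only [tilde_eq, add_mul]
  rw [integral_add (integrable_mul_wave hf p) (integrable_mul_wave hg p), mul_add]

theorem tilde_const_mul (c : ℂ) (g : ℝ × ℝ → ℂ) (p : ℝ × ℝ) :
    tilde (fun κ => c * g κ) p = c * tilde g p := by
  simp only [tilde_eq, mul_assoc c]
  rw [integral_const_mul]; ring

theorem tilde_comp_swap (g : ℝ × ℝ → ℂ) (p : ℝ × ℝ) :
    tilde (fun κ => g κ.swap) p = tilde g p.swap := by
  simp only [tilde_eq]
  rw [← integral_comp_swap fun κ => g κ * wave κ p.swap]
  congr 1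
  refine integral_congr_ae (Eventually.of_forall fun κ => ?_)
  simp only [wave, Prod.fst_swap, Prod.snd_swap]
  congr 2; ring

theorem hasDerivAt_wave (κ : ℝ × ℝ) (x y : ℝ) :
    HasDerivAt (fun s : ℝ => wave κ (s, y)) (-(Complex.I * κ.2) * wave κ (x, y)) x := by
  have h1 : HasDerivAt (fun s : ℝ => -(Complex.I * κ.1 * y) - Complex.I * κ.2 * (s : ℂ))
      (-(Complex.I * κ.2)) x := by
    simpa using ((Complex.ofRealCLM.hasDerivAt (x := x)).const_mul
      (Complex.I * (κ.2 : ℂ))).const_sub (-(Complex.I * κ.1 * y))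
  refine h1.cexp.congr_deriv ?_
  rw [mul_comm]; rfl

/-! #### Multiplication by a potential -/

section Potential

variable {χ : ℝ → ℂ} {v : ℝ × ℝ} {w : ℝ × ℝ → ℂ}

theorem integral_wave_shift (hw : ∀ p, ∫ k', χ k' * wave (k' • v) p = w p) (κ p : ℝ × ℝ) :
    ∫ k', χ k' * wave (κ + k' • v) p = w p * wave κ p := by
  rw [← hw p, ← integral_mul_const]
  refine integral_congr_ae (Eventually.of_forall fun k' => ?_)
  simp only [wave_add]; ring

/-- The potential is a superposition of waves in the direction `v`, and multiplication by a wave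
translates the transform. -/
theorem tilde_mul_potential (hχ : Integrable χ) (hw : ∀ p, ∫ k', χ k' * wave (k' • v) p = w p)
    {θ : ℝ × ℝ → ℂ} (hθ : Integrable θ) (κ : ℝ × ℝ) :
    tilde (fun p => w p * θ p) κ = ∫ k', χ k' * tilde θ (κ + k' • v) := by
  have H : Integrable (fun z : (ℝ × ℝ) × ℝ => θ z.1 * (χ z.2 * wave (κ + z.2 • v) z.1))
      (volume.prod volume) := by
    have := (hθ.mul_prod hχ).mul_bdd (c := 1)
      (g := fun z : (ℝ × ℝ) × ℝ => wave (κ + z.2 • v) z.1)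
      (continuous_wave (by fun_prop) (by fun_prop)).aestronglyMeasurable
      (Eventually.of_forall fun _ => (norm_wave _ _).le)
    refine this.congr (Eventually.of_forall fun z => ?_)
    dsimp only; ring
  calc tilde (fun p => w p * θ p) κ
      = (1 / (2 * Real.pi) : ℂ) * ∫ p, ∫ k', θ p * (χ k' * wave (κ + k' • v) p) := by
        rw [tilde_eq]
        congr 1
        refine integral_congr_ae (Eventually.of_forall fun p => ?_)
        dsimp only
        rw [integral_const_mul, integral_wave_shift hw, wave_comm]; ring
    _ = (1 / (2 * Real.pi) : ℂ) * ∫ k', ∫ p, θ p * (χ k' * wave (κ + k' • v) p) := by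
        rw [integral_integral_swap H]
    _ = _ := by
        rw [← integral_const_mul]
        refine integral_congr_ae (Eventually.of_forall fun k' => ?_)
        simp only [tilde_eq, ← integral_const_mul]
        refine integral_congr_ae (Eventually.of_forall fun p => ?_)
        dsimp only
        rw [wave_comm p]; ring

end Potential

theorem integral_kernel_wave_fst {u : ℝ → ℝ} (hu : Continuous u ∧ Integrable u ∧ Integrable (kernel u))
    (p : ℝ × ℝ) : ∫ k', kernel u k' * wave (k' • ((1 : ℝ), (0 : ℝ))) p = -Complex.I * u p.2 := by
  rw [← integral_kernel_mul_exp hu.1 hu.2.1 hu.2.2]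
  refine integral_congr_ae (Eventually.of_forall fun k' => ?_)
  simp [wave]

theorem integral_kernel_wave_snd {u : ℝ → ℝ} (hu : Continuous u ∧ Integrable u ∧ Integrable (kernel u))
    (p : ℝ × ℝ) : ∫ k', kernel u k' * wave (k' • ((0 : ℝ), (1 : ℝ))) p = -Complex.I * u p.1 := by
  rw [← integral_kernel_mul_exp hu.1 hu.2.1 hu.2.2]
  refine integral_congr_ae (Eventually.of_forall fun k' => ?_)
  simp [wave]

/-! #### Test functions -/

/-- Integration by parts: the ξ-derivative of `f` times the wave integrates to 0, as `f` decays
along each line and the wave has modulus 1. -/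
theorem tilde_dXi {f : ℝ × ℝ → ℂ} (hf : SobolevReg 2 f) (κ : ℝ × ℝ) :
    tilde (dXi f) κ = Complex.I * κ.2 * tilde f κ := by
  have i1 := integrable_mul_wave hf.integrable_dXi κ
  have i2 := integrable_mul_wave hf.integrable_self κ
  have hz : ∫ p, (dXi f p * wave p κ - Complex.I * κ.2 * (f p * wave p κ)) = 0 := by
    refine integral_eq_zero_of_hasDerivAt_fst (h := fun p => f p * wave p κ) (fun x y => ?_)
      (i1.sub (i2.const_mul _)) (fun y => ?_) (fun y => ?_)
    · simp only [wave_comm _ κ]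
      refine ((hf.hasDerivAt_fst x y).mul (hasDerivAt_wave κ x y)).congr_deriv ?_
      ring
    · refine squeeze_zero_norm (fun x => ?_) (tendsto_norm_zero.comp (hf.tendsto_fst_atBot y))
      rw [norm_mul, norm_wave, mul_one]; rfl
    · refine squeeze_zero_norm (fun x => ?_) (tendsto_norm_zero.comp (hf.tendsto_fst_atTop y))
      rw [norm_mul, norm_wave, mul_one]; rfl
  rw [integral_sub i1 (i2.const_mul _), integral_const_mul, sub_eq_zero] at hz
  rw [tilde_eq, tilde_eq, hz]; ring

theorem integral_eq_zero_of_hasDerivAt_snd {h h' : ℝ × ℝ → ℂ}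
    (hd : ∀ x y, HasDerivAt (fun s => h (x, s)) (h' (x, y)) y) (hi : Integrable h')
    (hbot : ∀ x, Tendsto (fun s => h (x, s)) atBot (𝓝 0))
    (htop : ∀ x, Tendsto (fun s => h (x, s)) atTop (𝓝 0)) : ∫ p, h' p = 0 := by
  rw [← integral_comp_swap]
  exact integral_eq_zero_of_hasDerivAt_fst (h := fun p => h p.swap) (fun x y => hd y x)
    (integrable_comp_swap hi) hbot htop

theorem hasDerivAt_wave_snd (κ : ℝ × ℝ) (x y : ℝ) :
    HasDerivAt (fun s : ℝ => wave κ (x, s)) (-(Complex.I * κ.1) * wave κ (x, y)) y := by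
  have h : ∀ a b, wave κ (a, b) = wave κ.swap (b, a) := fun a b => by
    simp only [wave, Prod.fst_swap, Prod.snd_swap]; congr 1; ring
  simp only [h]
  exact hasDerivAt_wave κ.swap y x

theorem tilde_dEta {f : ℝ × ℝ → ℂ} (hf : SobolevReg 2 f) (κ : ℝ × ℝ) :
    tilde (dEta f) κ = Complex.I * κ.1 * tilde f κ := by
  have i1 := integrable_mul_wave hf.integrable_dEta κ
  have i2 := integrable_mul_wave hf.integrable_self κ
  have hz : ∫ p, (dEta f p * wave p κ - Complex.I * κ.1 * (f p * wave p κ)) = 0 := by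
    refine integral_eq_zero_of_hasDerivAt_snd (h := fun p => f p * wave p κ) (fun x y => ?_)
      (i1.sub (i2.const_mul _)) (fun x => ?_) (fun x => ?_)
    · simp only [wave_comm _ κ]
      refine ((hf.hasDerivAt_snd x y).mul (hasDerivAt_wave_snd κ x y)).congr_deriv ?_
      ring
    · refine squeeze_zero_norm (fun y => ?_) (tendsto_norm_zero.comp (hf.tendsto_snd_atBot x))
      rw [norm_mul, norm_wave, mul_one]; rfl
    · refine squeeze_zero_norm (fun y => ?_) (tendsto_norm_zero.comp (hf.tendsto_snd_atTop x))
      rw [norm_mul, norm_wave, mul_one]; rfl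
  rw [integral_sub i1 (i2.const_mul _), integral_const_mul, sub_eq_zero] at hz
  rw [tilde_eq, tilde_eq, hz]; ring

theorem tilde_dXi_dXi {f : ℝ × ℝ → ℂ} (hf : SobolevReg 3 f) (κ : ℝ × ℝ) :
    tilde (dXi (dXi f)) κ = -(κ.2 : ℂ) ^ 2 * tilde f κ := by
  rw [tilde_dXi hf.dXi, tilde_dXi (hf.mono (by omega))]
  linear_combination (κ.2 : ℂ) ^ 2 * tilde f κ * Complex.I_mul_I

theorem tilde_dEta_dEta {f : ℝ × ℝ → ℂ} (hf : SobolevReg 3 f) (κ : ℝ × ℝ) :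
    tilde (dEta (dEta f)) κ = -(κ.1 : ℂ) ^ 2 * tilde f κ := by
  rw [tilde_dEta hf.dEta, tilde_dEta (hf.mono (by omega))]
  linear_combination (κ.1 : ℂ) ^ 2 * tilde f κ * Complex.I_mul_I

theorem tilde_lap {f : ℝ × ℝ → ℂ} (hf : SobolevReg 3 f) (κ : ℝ × ℝ) :
    tilde (lap f) κ = -((κ.1 : ℂ) ^ 2 + (κ.2 : ℂ) ^ 2) * tilde f κ := by
  have h := tilde_add (f := dXi (dXi f)) (g := dEta (dEta f)) hf.dXi.dXi.integrable_self
    hf.dEta.dEta.integrable_self κ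
  rw [tilde_dXi_dXi hf, tilde_dEta_dEta hf] at h
  refine h.trans ?_
  ring

theorem exists_schwartz_dXi (θ : SchwartzMap (ℝ × ℝ) ℂ) :
    ∃ θ' : SchwartzMap (ℝ × ℝ) ℂ, ⇑θ' = dXi θ := by
  refine ⟨LineDeriv.lineDerivOp ((1 : ℝ), (0 : ℝ)) θ, funext fun p => ?_⟩
  rw [SchwartzMap.lineDerivOp_apply_eq_fderiv]
  have h1 : HasDerivAt (fun x : ℝ => (x, p.2)) ((1 : ℝ), (0 : ℝ)) p.1 :=
    (hasDerivAt_id _).prodMk (hasDerivAt_const _ _)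
  exact (θ.differentiableAt.hasFDerivAt.comp_hasDerivAt p.1 h1).deriv.symm

theorem exists_schwartz_dEta (θ : SchwartzMap (ℝ × ℝ) ℂ) :
    ∃ θ' : SchwartzMap (ℝ × ℝ) ℂ, ⇑θ' = dEta θ := by
  refine ⟨LineDeriv.lineDerivOp ((0 : ℝ), (1 : ℝ)) θ, funext fun p => ?_⟩
  rw [SchwartzMap.lineDerivOp_apply_eq_fderiv]
  have h1 : HasDerivAt (fun y : ℝ => (p.1, y)) ((0 : ℝ), (1 : ℝ)) p.2 :=
    (hasDerivAt_const _ _).prodMk (hasDerivAt_id _)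
  exact (θ.differentiableAt.hasFDerivAt.comp_hasDerivAt p.2 h1).deriv.symm

theorem sobolevReg_schwartz (n : ℕ) (θ : SchwartzMap (ℝ × ℝ) ℂ) : SobolevReg n θ := by
  have h1 : ∀ (b : ℕ) (θ : SchwartzMap (ℝ × ℝ) ℂ),
      ∃ θ' : SchwartzMap (ℝ × ℝ) ℂ, ⇑θ' = dEta^[b] θ := by
    intro b
    induction b with
    | zero => exact fun θ => ⟨θ, rfl⟩
    | succ b ih =>
      intro θ
      obtain ⟨θ', hθ'⟩ := exists_schwartz_dEta θ
      rw [Function.iterate_succ_apply, ← hθ']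
      exact ih θ'
  have h2 : ∀ (a : ℕ) (θ : SchwartzMap (ℝ × ℝ) ℂ),
      ∃ θ' : SchwartzMap (ℝ × ℝ) ℂ, ⇑θ' = dXi^[a] θ := by
    intro a
    induction a with
    | zero => exact fun θ => ⟨θ, rfl⟩
    | succ a ih =>
      intro θ
      obtain ⟨θ', hθ'⟩ := exists_schwartz_dXi θ
      rw [Function.iterate_succ_apply, ← hθ']
      exact ih θ'
  refine ⟨θ.smooth _, fun a b _ => ?_⟩
  obtain ⟨θ₁, hθ₁⟩ := h1 b θ
  obtain ⟨θ₂, hθ₂⟩ := h2 a θ₁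
  rw [dMulti, ← hθ₁, ← hθ₂]
  exact θ₂.integrable

/-- Apply (1 − ∂_ξ²)(1 − ∂_η²), which preserves the Schwartz space. -/
theorem exists_schwartz_weight (θ : SchwartzMap (ℝ × ℝ) ℂ) : ∃ θ' : SchwartzMap (ℝ × ℝ) ℂ,
    ∀ κ, tilde θ' κ = (1 + (κ.1 : ℂ) ^ 2) * (1 + (κ.2 : ℂ) ^ 2) * tilde θ κ := by
  have key : ∀ (θ θ₂ : SchwartzMap (ℝ × ℝ) ℂ) (κ : ℝ × ℝ),
      tilde (θ - θ₂ : SchwartzMap (ℝ × ℝ) ℂ) κ = tilde θ κ - tilde θ₂ κ := fun θ θ₂ κ => by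
    have h := tilde_add (f := θ) (g := fun p => -1 * θ₂ p) θ.integrable
      (θ₂.integrable.const_mul _) κ
    rw [tilde_const_mul] at h
    rw [sub_eq_add_neg (tilde θ κ), ← neg_one_mul (tilde θ₂ κ), ← h]
    congr 1
    funext p
    simp [sub_eq_add_neg]
  obtain ⟨a₁, ha₁⟩ := exists_schwartz_dXi θ
  obtain ⟨a₂, ha₂⟩ := exists_schwartz_dXi a₁
  obtain ⟨b₁, hb₁⟩ := exists_schwartz_dEta (θ - a₂)
  obtain ⟨b₂, hb₂⟩ := exists_schwartz_dEta b₁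
  refine ⟨(θ - a₂) - b₂, fun κ => ?_⟩
  have e1 : tilde a₂ κ = -(κ.2 : ℂ) ^ 2 * tilde θ κ := by
    rw [ha₂, ha₁, tilde_dXi_dXi (sobolevReg_schwartz 3 θ)]
  have e2 : tilde b₂ κ = -(κ.1 : ℂ) ^ 2 * tilde (θ - a₂ : SchwartzMap (ℝ × ℝ) ℂ) κ := by
    rw [hb₂, hb₁, tilde_dEta_dEta (sobolevReg_schwartz 3 _)]
  rw [key, e2, key, e1]
  ring

/-- The product weight is used twice: one copy dominates 1 + k² + l², and the other leaves the
integrable majorant 1/((1 + k²)(1 + l²)). -/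
theorem integrable_weight_mul_tilde (θ : SchwartzMap (ℝ × ℝ) ℂ) :
    Integrable fun κ : ℝ × ℝ => (1 + κ.1 ^ 2 + κ.2 ^ 2) * ‖tilde θ κ‖ := by
  obtain ⟨θ₁, hθ₁⟩ := exists_schwartz_weight θ
  obtain ⟨θ₂, hθ₂⟩ := exists_schwartz_weight θ₁
  have hb : Integrable fun κ : ℝ × ℝ => (1 + κ.1 ^ 2)⁻¹ * (1 + κ.2 ^ 2)⁻¹ :=
    integrable_inv_one_add_sq.mul_prod integrable_inv_one_add_sq
  refine (hb.const_mul (∫ p, ‖θ₂ p‖)).mono'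
    ((by fun_prop : Continuous fun κ : ℝ × ℝ => 1 + κ.1 ^ 2 + κ.2 ^ 2).mul
      (continuous_tilde θ.integrable).norm).aestronglyMeasurable
    (Eventually.of_forall fun κ => ?_)
  have h1 : 0 < 1 + κ.1 ^ 2 := by positivity
  have h2 : 0 < 1 + κ.2 ^ 2 := by positivity
  have hn : ∀ x : ℝ, ‖(1 + (x : ℂ) ^ 2)‖ = 1 + x ^ 2 := fun x => by
    rw [show (1 + (x : ℂ) ^ 2) = ((1 + x ^ 2 : ℝ) : ℂ) by push_cast; rfl, Complex.norm_real,
      Real.norm_eq_abs, abs_of_pos (by positivity)]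
  have h3 := norm_tilde_le θ₂ κ
  rw [hθ₂, hθ₁, norm_mul, norm_mul, norm_mul, norm_mul, hn, hn] at h3
  rw [Real.norm_eq_abs, abs_of_nonneg (by positivity), ← mul_inv, ← div_eq_mul_inv,
    le_div_iff₀ (by positivity)]
  refine le_trans ?_ h3
  have h4 : 1 + κ.1 ^ 2 + κ.2 ^ 2 ≤ (1 + κ.1 ^ 2) * (1 + κ.2 ^ 2) := by
    nlinarith [mul_nonneg (sq_nonneg κ.1) (sq_nonneg κ.2)]
  calc (1 + κ.1 ^ 2 + κ.2 ^ 2) * ‖tilde θ κ‖ * ((1 + κ.1 ^ 2) * (1 + κ.2 ^ 2))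
      ≤ ((1 + κ.1 ^ 2) * (1 + κ.2 ^ 2)) * ‖tilde θ κ‖ * ((1 + κ.1 ^ 2) * (1 + κ.2 ^ 2)) := by
        gcongr
    _ = _ := by ring

/-! #### Regularity of the transform -/

theorem hasDerivAt_tilde_fst {g : ℝ × ℝ → ℂ} (hg : Integrable g)
    (hg' : Integrable fun κ : ℝ × ℝ => (κ.2 : ℂ) * g κ) (x y : ℝ) :
    HasDerivAt (fun s => tilde g (s, y)) (tilde (fun κ => -(Complex.I * κ.2) * g κ) (x, y)) x := by
  have hi : Integrable fun κ : ℝ × ℝ => -(Complex.I * κ.2) * g κ := by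
    refine (hg'.const_mul (-Complex.I)).congr (Eventually.of_forall fun κ => ?_)
    dsimp only; ring
  have h := hasDerivAt_integral_of_dominated_loc_of_deriv_le (μ := (volume : Measure (ℝ × ℝ)))
    (x₀ := x) (s := Set.univ)
    (F := fun s κ => g κ * wave κ (s, y)) (F' := fun s κ => -(Complex.I * κ.2) * g κ * wave κ (s, y))
    (bound := fun κ => ‖-(Complex.I * κ.2) * g κ‖) univ_mem
    (Eventually.of_forall fun s => (integrable_mul_wave hg _).aestronglyMeasurable)
    (integrable_mul_wave hg _) (integrable_mul_wave hi _).aestronglyMeasurable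
    (Eventually.of_forall fun κ s _ => by rw [norm_mul _ (wave _ _), norm_wave, mul_one])
    hi.norm (Eventually.of_forall fun κ s _ => by
      refine ((hasDerivAt_wave κ s y).const_mul (g κ)).congr_deriv ?_
      ring)
  exact h.2.const_mul _

theorem hasDerivAt_tilde_snd {g : ℝ × ℝ → ℂ} (hg : Integrable g)
    (hg' : Integrable fun κ : ℝ × ℝ => (κ.1 : ℂ) * g κ) (x y : ℝ) :
    HasDerivAt (fun s => tilde g (x, s)) (tilde (fun κ => -(Complex.I * κ.1) * g κ) (x, y)) y := by
  have h := hasDerivAt_tilde_fst (g := fun κ => g κ.swap) (integrable_comp_swap hg)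
    (integrable_comp_swap hg') y x
  simp only [tilde_comp_swap, Prod.swap_prod_mk] at h
  refine h.congr_deriv ?_
  exact tilde_comp_swap (fun κ => -(Complex.I * κ.1) * g κ) (y, x)

section Weighted

variable {g : ℝ × ℝ → ℂ}

theorem integrable_mul_of_weight (hm : AEStronglyMeasurable g)
    (hg : Integrable fun κ : ℝ × ℝ => (1 + κ.1 ^ 2 + κ.2 ^ 2) * ‖g κ‖)
    {c : ℝ × ℝ → ℂ} (hc : Continuous c)
    (hb : ∀ κ, ‖c κ‖ ≤ 1 + κ.1 ^ 2 + κ.2 ^ 2) : Integrable fun κ => c κ * g κ :=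
  hg.mono' (hc.aestronglyMeasurable.mul hm) (Eventually.of_forall fun κ => by
    rw [norm_mul]; exact mul_le_mul_of_nonneg_right (hb κ) (norm_nonneg _))

theorem lap_tilde (hm : AEStronglyMeasurable g)
    (hg : Integrable fun κ : ℝ × ℝ => (1 + κ.1 ^ 2 + κ.2 ^ 2) * ‖g κ‖) (p : ℝ × ℝ) :
    lap (tilde g) p = tilde (fun κ => -((κ.1 : ℂ) ^ 2 + (κ.2 : ℂ) ^ 2) * g κ) p := by
  have hsq : ∀ a b : ℝ, |a| ≤ 1 + a ^ 2 + b ^ 2 := fun a b => by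
    rw [abs_le]; constructor <;> nlinarith [sq_nonneg (a - 1), sq_nonneg (a + 1), sq_nonneg b]
  have i0 : Integrable g := by
    have := integrable_mul_of_weight hm hg (c := fun _ => 1) continuous_const (fun κ => by
      rw [norm_one]; nlinarith [sq_nonneg κ.1, sq_nonneg κ.2])
    simpa using this
  have i1 : Integrable fun κ : ℝ × ℝ => (κ.1 : ℂ) * g κ :=
    integrable_mul_of_weight hm hg (by fun_prop) (fun κ => by
      rw [Complex.norm_real]; exact hsq _ _)
  have i2 : Integrable fun κ : ℝ × ℝ => (κ.2 : ℂ) * g κ :=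
    integrable_mul_of_weight hm hg (by fun_prop) (fun κ => by
      rw [Complex.norm_real]; exact (hsq κ.2 κ.1).trans_eq (by ring))
  have i11 : Integrable fun κ : ℝ × ℝ => (κ.1 : ℂ) ^ 2 * g κ :=
    integrable_mul_of_weight hm hg (by fun_prop) (fun κ => by
      rw [norm_pow, Complex.norm_real, Real.norm_eq_abs, sq_abs]; nlinarith [sq_nonneg κ.2])
  have i22 : Integrable fun κ : ℝ × ℝ => (κ.2 : ℂ) ^ 2 * g κ :=
    integrable_mul_of_weight hm hg (by fun_prop) (fun κ => by
      rw [norm_pow, Complex.norm_real, Real.norm_eq_abs, sq_abs]; nlinarith [sq_nonneg κ.1])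
  have ex : dXi (tilde g) = tilde (fun κ => -(Complex.I * κ.2) * g κ) :=
    funext fun p => (hasDerivAt_tilde_fst i0 i2 p.1 p.2).deriv
  have ey : dEta (tilde g) = tilde (fun κ => -(Complex.I * κ.1) * g κ) :=
    funext fun p => (hasDerivAt_tilde_snd i0 i1 p.1 p.2).deriv
  have jx : Integrable fun κ : ℝ × ℝ => -(Complex.I * κ.2) * g κ :=
    (i2.const_mul (-Complex.I)).congr (Eventually.of_forall fun κ => by dsimp only; ring)
  have jy : Integrable fun κ : ℝ × ℝ => -(Complex.I * κ.1) * g κ :=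
    (i1.const_mul (-Complex.I)).congr (Eventually.of_forall fun κ => by dsimp only; ring)
  have exx : dXi (tilde fun κ => -(Complex.I * κ.2) * g κ) p = _ :=
    (hasDerivAt_tilde_fst jx ((i22.const_mul (-Complex.I)).congr
      (Eventually.of_forall fun κ => by dsimp only; ring)) p.1 p.2).deriv
  have eyy : dEta (tilde fun κ => -(Complex.I * κ.1) * g κ) p = _ :=
    (hasDerivAt_tilde_snd jy ((i11.const_mul (-Complex.I)).congr
      (Eventually.of_forall fun κ => by dsimp only; ring)) p.1 p.2).deriv
  rw [lap, ex, ey, exx, eyy, ← tilde_add]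
  · congr 1
    funext κ
    linear_combination ((κ.1 : ℂ) ^ 2 + (κ.2 : ℂ) ^ 2) * g κ * Complex.I_mul_I
  · refine i22.neg.congr (Eventually.of_forall fun κ => ?_)
    simp only [Pi.neg_apply]
    linear_combination -(κ.2 : ℂ) ^ 2 * g κ * Complex.I_mul_I
  · refine i11.neg.congr (Eventually.of_forall fun κ => ?_)
    simp only [Pi.neg_apply]
    linear_combination -(κ.1 : ℂ) ^ 2 * g κ * Complex.I_mul_I

theorem contDiff_tilde (hm : AEStronglyMeasurable g)
    (hg : Integrable fun κ : ℝ × ℝ => (1 + κ.1 ^ 2 + κ.2 ^ 2) * ‖g κ‖) : ContDiff ℝ 2 (tilde g) := by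
  -- The form (kη + lξ)/2π expresses the transform as a general Fourier integral; the coordinates
  -- are crossed, and the factor compensates the 2π in `Real.fourierChar`.
  let L : ℝ × ℝ →L[ℝ] ℝ × ℝ →L[ℝ] ℝ := (2 * Real.pi)⁻¹ •
    ((ContinuousLinearMap.mul ℝ ℝ).bilinearComp (ContinuousLinearMap.fst ℝ ℝ ℝ)
      (ContinuousLinearMap.snd ℝ ℝ ℝ)
    + (ContinuousLinearMap.mul ℝ ℝ).bilinearComp (ContinuousLinearMap.snd ℝ ℝ ℝ)
      (ContinuousLinearMap.fst ℝ ℝ ℝ))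
  have h := VectorFourier.contDiff_fourierIntegral (μ := (volume : Measure (ℝ × ℝ))) L (f := g)
    (N := 2) (fun n hn => by
      refine hg.mono' ((continuous_norm.pow n).aestronglyMeasurable.mul hm.norm)
        (Eventually.of_forall fun κ => ?_)
      rw [norm_mul, norm_norm, norm_pow, norm_norm]
      refine mul_le_mul_of_nonneg_right ?_ (norm_nonneg _)
      have h1 : ‖κ‖ ^ 2 ≤ κ.1 ^ 2 + κ.2 ^ 2 := by
        rw [Prod.norm_def, Real.norm_eq_abs, Real.norm_eq_abs]
        rcases max_cases |κ.1| |κ.2| with h | h <;> rw [h.1, sq_abs] <;>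
          nlinarith [sq_nonneg κ.1, sq_nonneg κ.2]
      have hn2 : n ≤ 2 := by exact_mod_cast hn
      interval_cases n <;> nlinarith [norm_nonneg κ, sq_nonneg (‖κ‖ - 1)])
  have he : tilde g = fun p => (1 / (2 * Real.pi) : ℂ)
      * VectorFourier.fourierIntegral Real.fourierChar volume L.toLinearMap₁₂ g p := by
    funext p
    rw [tilde_eq, VectorFourier.fourierIntegral]
    congr 1
    refine integral_congr_ae (Eventually.of_forall fun κ => ?_)
    dsimp only
    rw [mul_comm, Circle.smul_def, Real.fourierChar_apply, smul_eq_mul, wave]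
    congr 2
    simp only [L, ContinuousLinearMap.toLinearMap₁₂_apply]
    change _ = ((2 * Real.pi * -((2 * Real.pi)⁻¹ * (κ.1 * p.2 + κ.2 * p.1)) : ℝ) : ℂ) * Complex.I
    have hpi : (Real.pi : ℂ) ≠ 0 := by exact_mod_cast Real.pi_ne_zero
    push_cast
    field_simp
    ring
  rw [he]
  exact contDiff_const.mul h

end Weighted

/-! ### The linear Schrödinger equation -/

/-- By duality the convolution moves to the wave, where it acts as multiplication by `w`. -/
theorem integral_convAlong_wave {χ : ℝ → ℂ} {v : ℝ × ℝ} {w f : ℝ × ℝ → ℂ} (hχ : Integrable χ)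
    (hw : ∀ p, ∫ k', χ k' * wave (k' • v) p = w p) (hf : Integrable f) (p : ℝ × ℝ) :
    ∫ κ, convAlong χ v f κ * wave κ p = w p * ∫ κ, f κ * wave κ p := by
  have H : Integrable (fun z : ℝ × (ℝ × ℝ) => χ z.1 * (f (z.2 - z.1 • v) * wave z.2 p))
      (volume.prod volume) := by
    refine ((integrable_shift hχ v hf).mul_bdd (c := 1) (g := fun z : ℝ × (ℝ × ℝ) => wave z.2 p)
      (continuous_wave continuous_snd continuous_const).aestronglyMeasurable
      (Eventually.of_forall fun z => (norm_wave _ _).le)).congr (Eventually.of_forall fun z => ?_)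
    dsimp only; ring
  rw [integral_convAlong_mul (Θ := fun κ => wave κ p) H, ← integral_const_mul]
  refine integral_congr_ae (Eventually.of_forall fun κ => ?_)
  dsimp only
  rw [integral_wave_shift hw]; ring

/-- The evolution equation of the spectral coefficients, with the boundedness that makes its
terms meaningful. -/
structure SpectralEvolution (T : ℝ) (χ₁ χ₂ : ℝ → ℂ) (Uh Fh : ℝ → ℝ × ℝ → ℂ) : Prop where
  integrable₁ : Integrable χ₁
  integrable₂ : Integrable χ₂
  continuous_U : ∀ s ∈ Set.Icc 0 T, Continuous (Uh s)
  continuous_F : ∀ s ∈ Set.Icc 0 T, Continuous (Fh s)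
  bound_U : ∃ C : ℝ, 0 ≤ C ∧ ∀ s ∈ Set.Icc 0 T, ∀ κ, ‖Uh s κ‖ ≤ C
  bound_F : ∃ C : ℝ, 0 ≤ C ∧ ∀ s ∈ Set.Icc 0 T, ∀ κ, ‖Fh s κ‖ ≤ C
  evolution : ∀ s ∈ Set.Icc 0 T, ∀ κ : ℝ × ℝ, HasDerivWithinAt (fun r => Uh r κ)
    (Complex.I * ((κ.1 : ℂ) ^ 2 + (κ.2 : ℂ) ^ 2) * Uh s κ + convAlong χ₁ (1, 0) (Uh s) κ
      + convAlong χ₂ (0, 1) (Uh s) κ + Fh s κ) (Set.Icc 0 T) s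

namespace SpectralEvolution

variable {T : ℝ} {χ₁ χ₂ : ℝ → ℂ} {Uh Fh : ℝ → ℝ × ℝ → ℂ}

/-- Common to both forms of the Schrödinger equation: `W` is the transform of a test function in one
and a wave in the other. The convolutions are dominated almost everywhere only, as the second case
requires. -/
theorem hasDerivWithinAt_integral (h : SpectralEvolution T χ₁ χ₂ Uh Fh) {W : ℝ × ℝ → ℂ}
    (hW : Continuous W) {g h₁ h₂ : ℝ × ℝ → ℝ} (hg : Integrable g)
    (hgU : ∀ s ∈ Set.Icc 0 T, ∀ κ, (1 + κ.1 ^ 2 + κ.2 ^ 2) * ‖Uh s κ‖ * ‖W κ‖ ≤ g κ)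
    (hgF : ∀ s ∈ Set.Icc 0 T, ∀ κ, ‖Fh s κ‖ * ‖W κ‖ ≤ g κ)
    (hh₁ : Integrable h₁) (hb₁ : ∀ᵐ κ, ∀ s ∈ Set.Icc 0 T,
      ‖convAlong χ₁ (1, 0) (Uh s) κ‖ * ‖W κ‖ ≤ h₁ κ)
    (hh₂ : Integrable h₂) (hb₂ : ∀ᵐ κ, ∀ s ∈ Set.Icc 0 T,
      ‖convAlong χ₂ (0, 1) (Uh s) κ‖ * ‖W κ‖ ≤ h₂ κ) {t : ℝ} (ht : t ∈ Set.Icc 0 T) :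
    HasDerivWithinAt (fun s => ∫ κ, Uh s κ * W κ)
      (Complex.I * (∫ κ : ℝ × ℝ, ((κ.1 : ℂ) ^ 2 + (κ.2 : ℂ) ^ 2) * Uh t κ * W κ)
        + (∫ κ, convAlong χ₁ (1, 0) (Uh t) κ * W κ) + (∫ κ, convAlong χ₂ (0, 1) (Uh t) κ * W κ)
        + ∫ κ, Fh t κ * W κ) (Set.Icc 0 T) t := by
  obtain ⟨C, -, hC⟩ := h.bound_U
  have hsq : ∀ κ : ℝ × ℝ, ‖((κ.1 : ℂ) ^ 2 + (κ.2 : ℂ) ^ 2)‖ = κ.1 ^ 2 + κ.2 ^ 2 := fun κ => by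
    rw [show ((κ.1 : ℂ) ^ 2 + (κ.2 : ℂ) ^ 2) = ((κ.1 ^ 2 + κ.2 ^ 2 : ℝ) : ℂ) by push_cast; rfl,
      Complex.norm_real, Real.norm_eq_abs, abs_of_nonneg (by positivity)]
  have n1 : ∀ s ∈ Set.Icc 0 T, ∀ κ : ℝ × ℝ, ‖Uh s κ * W κ‖ ≤ g κ := fun s hs κ => by
    refine le_trans ?_ (hgU s hs κ)
    rw [norm_mul]
    refine mul_le_mul_of_nonneg_right (le_mul_of_one_le_left (norm_nonneg _) ?_) (norm_nonneg _)
    nlinarith [sq_nonneg κ.1, sq_nonneg κ.2]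
  have n2 : ∀ s ∈ Set.Icc 0 T, ∀ κ : ℝ × ℝ,
      ‖((κ.1 : ℂ) ^ 2 + (κ.2 : ℂ) ^ 2) * Uh s κ * W κ‖ ≤ g κ := fun s hs κ => by
    refine le_trans ?_ (hgU s hs κ)
    rw [norm_mul, norm_mul, hsq]
    gcongr
    linarith
  have n3 : ∀ s ∈ Set.Icc 0 T, ∀ κ : ℝ × ℝ, ‖Fh s κ * W κ‖ ≤ g κ := fun s hs κ =>
    (norm_mul _ _).trans_le (hgF s hs κ)
  have n4 : ∀ᵐ κ, ∀ s ∈ Set.Icc 0 T, ‖convAlong χ₁ (1, 0) (Uh s) κ * W κ‖ ≤ h₁ κ := by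
    simpa only [norm_mul] using hb₁
  have n5 : ∀ᵐ κ, ∀ s ∈ Set.Icc 0 T, ‖convAlong χ₂ (0, 1) (Uh s) κ * W κ‖ ≤ h₂ κ := by
    simpa only [norm_mul] using hb₂
  have cU := h.continuous_U t ht
  have i1 : ∀ s ∈ Set.Icc 0 T, Integrable fun κ => Uh s κ * W κ := fun s hs =>
    hg.mono' ((h.continuous_U s hs).mul hW).aestronglyMeasurable
      (Eventually.of_forall (n1 s hs))
  have i2 : Integrable fun κ : ℝ × ℝ => ((κ.1 : ℂ) ^ 2 + (κ.2 : ℂ) ^ 2) * Uh t κ * W κ :=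
    hg.mono' (((by fun_prop : Continuous fun κ : ℝ × ℝ => (κ.1 : ℂ) ^ 2 + (κ.2 : ℂ) ^ 2).mul
      cU).mul hW).aestronglyMeasurable (Eventually.of_forall (n2 t ht))
  have i3 : Integrable fun κ => Fh t κ * W κ :=
    hg.mono' ((h.continuous_F t ht).mul hW).aestronglyMeasurable (Eventually.of_forall (n3 t ht))
  have i4 : Integrable fun κ => convAlong χ₁ (1, 0) (Uh t) κ * W κ :=
    hh₁.mono' ((continuous_convAlong h.integrable₁ _ cU (hC t ht)).mul hW).aestronglyMeasurable
      (n4.mono fun κ hκ => hκ t ht)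
  have i5 : Integrable fun κ => convAlong χ₂ (0, 1) (Uh t) κ * W κ :=
    hh₂.mono' ((continuous_convAlong h.integrable₂ _ cU (hC t ht)).mul hW).aestronglyMeasurable
      (n5.mono fun κ hκ => hκ t ht)
  have D := hasDerivWithinAt_integral_of_dominated (convex_Icc 0 T) ht i1
    (f' := fun s κ => Complex.I * (((κ.1 : ℂ) ^ 2 + (κ.2 : ℂ) ^ 2) * Uh s κ * W κ)
      + convAlong χ₁ (1, 0) (Uh s) κ * W κ + convAlong χ₂ (0, 1) (Uh s) κ * W κ + Fh s κ * W κ)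
    (G := fun κ => g κ + h₁ κ + h₂ κ + g κ)
    (fun κ s hs => ((h.evolution s hs κ).mul_const (W κ)).congr_deriv (by ring))
    (((hg.add hh₁).add hh₂).add hg) (by
      filter_upwards [n4, n5] with κ h4 h5 s hs
      refine (norm_add_le _ _).trans (add_le_add ((norm_add_le _ _).trans (add_le_add
        ((norm_add_le _ _).trans (add_le_add ?_ (h4 s hs))) (h5 s hs))) (n3 s hs κ))
      rw [norm_mul, Complex.norm_I, one_mul]
      exact n2 s hs κ)
  refine D.congr_deriv ?_
  have j1 : Integrable fun κ : ℝ × ℝ => Complex.I * (((κ.1 : ℂ) ^ 2 + (κ.2 : ℂ) ^ 2) * Uh t κ * W κ)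
      + convAlong χ₁ (1, 0) (Uh t) κ * W κ := (i2.const_mul _).add i4
  have j2 : Integrable fun κ : ℝ × ℝ => Complex.I * (((κ.1 : ℂ) ^ 2 + (κ.2 : ℂ) ^ 2) * Uh t κ * W κ)
      + convAlong χ₁ (1, 0) (Uh t) κ * W κ + convAlong χ₂ (0, 1) (Uh t) κ * W κ := j1.add i5
  rw [integral_add j2 i3, integral_add j1 i5, integral_add (i2.const_mul _) i4,
    integral_const_mul]

variable {u₁ u₂ : ℝ → ℝ}

/-- The transform of the test function is integrable against 1 + k² + l², and the coefficients are
bounded uniformly in time, so differentiation under the integral is allowed. -/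
theorem hasDerivWithinAt_tildeDistr (h : SpectralEvolution T (kernel u₁) (kernel u₂) Uh Fh)
    (hu₁ : Continuous u₁ ∧ Integrable u₁ ∧ Integrable (kernel u₁))
    (hu₂ : Continuous u₂ ∧ Integrable u₂ ∧ Integrable (kernel u₂))
    (θ : SchwartzMap (ℝ × ℝ) ℂ) {t : ℝ} (ht : t ∈ Set.Icc 0 T) :
    HasDerivWithinAt (fun s => tildeDistr (Uh s) θ)
      (-Complex.I * (tildeDistr (Uh t) (lap θ)
          + tildeDistr (Uh t) (fun p => ((u₂ p.1 + u₁ p.2 : ℝ) : ℂ) * θ p))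
        + tildeDistr (Fh t) θ) (Set.Icc 0 T) t := by
  obtain ⟨C, hC0, hC⟩ := h.bound_U
  obtain ⟨C', hC0', hC'⟩ := h.bound_F
  have hΘ := continuous_tilde θ.integrable
  have iw := integrable_weight_mul_tilde θ
  have one_le : ∀ κ : ℝ × ℝ, 1 ≤ 1 + κ.1 ^ 2 + κ.2 ^ 2 := fun κ => by
    nlinarith [sq_nonneg κ.1, sq_nonneg κ.2]
  have iΘ : Integrable (tilde θ) := iw.mono' hΘ.aestronglyMeasurable
    (Eventually.of_forall fun κ => le_mul_of_one_le_left (norm_nonneg _) (one_le κ))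
  have D := h.hasDerivWithinAt_integral hΘ (iw.const_mul (C + C')) (fun s hs κ => by
      rw [mul_right_comm, mul_comm]
      refine mul_le_mul_of_nonneg_right ((hC s hs κ).trans (by linarith)) ?_
      have := one_le κ
      positivity) (fun s hs κ => by
      refine mul_le_mul ((hC' s hs κ).trans (by linarith)) ?_ (norm_nonneg _) (by positivity)
      exact le_mul_of_one_le_left (norm_nonneg _) (one_le κ))
    (iΘ.norm.const_mul (C * ∫ k', ‖kernel u₁ k'‖))
    (Eventually.of_forall fun κ s hs => mul_le_mul_of_nonneg_right
      (norm_convAlong_le h.integrable₁ _ (hC s hs) κ) (norm_nonneg _))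
    (iΘ.norm.const_mul (C * ∫ k', ‖kernel u₂ k'‖))
    (Eventually.of_forall fun κ s hs => mul_le_mul_of_nonneg_right
      (norm_convAlong_le h.integrable₂ _ (hC s hs) κ) (norm_nonneg _)) ht
  refine D.congr_deriv ?_
  have cU := h.continuous_U t ht
  have hH : ∀ {χ : ℝ → ℂ} (v : ℝ × ℝ), Integrable χ → Integrable (fun z : ℝ × (ℝ × ℝ) =>
      χ z.1 * (Uh t (z.2 - z.1 • v) * tilde θ z.2)) (volume.prod volume) := fun v hχ => by
    refine ((hχ.mul_prod iΘ).mul_bdd (c := C) (g := fun z : ℝ × (ℝ × ℝ) => Uh t (z.2 - z.1 • v))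
      (cU.comp (by fun_prop)).aestronglyMeasurable
      (Eventually.of_forall fun z => hC t ht _)).congr (Eventually.of_forall fun z => ?_)
    dsimp only; ring
  have H₁ := hH (1, 0) h.integrable₁
  have H₂ := hH (0, 1) h.integrable₂
  have J₁ := integrable_mul_integral_shift H₁
  have J₂ := integrable_mul_integral_shift H₂
  have e₁ := tilde_mul_potential h.integrable₁ (integral_kernel_wave_fst hu₁) θ.integrable
  have e₂ := tilde_mul_potential h.integrable₂ (integral_kernel_wave_snd hu₂) θ.integrable
  rw [integral_convAlong_mul H₁, integral_convAlong_mul H₂]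
  simp only [← e₁, ← e₂] at J₁ J₂ ⊢
  have hlap : tildeDistr (Uh t) (lap θ)
      = -∫ κ : ℝ × ℝ, ((κ.1 : ℂ) ^ 2 + (κ.2 : ℂ) ^ 2) * Uh t κ * tilde θ κ := by
    rw [tildeDistr, ← integral_neg]
    refine integral_congr_ae (Eventually.of_forall fun κ => ?_)
    simp only [tilde_lap (sobolevReg_schwartz 3 θ)]
    ring
  -- The two convolutions, moved to the test function, are the transforms of −iu₁θ and −iu₂θ.
  have hpot : -Complex.I * tildeDistr (Uh t) (fun p => ((u₂ p.1 + u₁ p.2 : ℝ) : ℂ) * θ p)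
      = (∫ κ, Uh t κ * tilde (fun p => -Complex.I * u₁ p.2 * θ p) κ)
        + ∫ κ, Uh t κ * tilde (fun p => -Complex.I * u₂ p.1 * θ p) κ := by
    rw [← integral_add J₁ J₂, tildeDistr, ← integral_const_mul]
    refine integral_congr_ae (Eventually.of_forall fun κ => ?_)
    dsimp only
    have ib : ∀ {w : ℝ × ℝ → ℂ}, Continuous w → (∃ C, ∀ p, ‖w p‖ ≤ C) →
        Integrable fun p => w p * θ p := fun hw ⟨B, hB⟩ =>
      θ.integrable.bdd_mul (c := B) hw.aestronglyMeasurable (Eventually.of_forall hB)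
    have c₁ := hu₁.1
    have c₂ := hu₂.1
    obtain ⟨B₁, hB₁⟩ := exists_bound_of_kernel hu₁.1 hu₁.2.1 hu₁.2.2
    obtain ⟨B₂, hB₂⟩ := exists_bound_of_kernel hu₂.1 hu₂.2.1 hu₂.2.2
    rw [← mul_add, ← tilde_add (ib (by fun_prop) ⟨B₁, fun p => by
        rw [norm_mul, norm_neg, Complex.norm_I, one_mul, Complex.norm_real]; exact hB₁ _⟩)
      (ib (by fun_prop) ⟨B₂, fun p => by
        rw [norm_mul, norm_neg, Complex.norm_I, one_mul, Complex.norm_real]; exact hB₂ _⟩),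
      mul_left_comm, ← tilde_const_mul]
    congr 2
    funext p
    push_cast; ring
  rw [mul_add, hpot, hlap]
  simp only [tildeDistr]
  ring

/-- The wave does not decay, so the domination has to come from `g` instead of the test function. -/
theorem hasDerivWithinAt_tilde (h : SpectralEvolution T (kernel u₁) (kernel u₂) Uh Fh)
    (hu₁ : Continuous u₁ ∧ Integrable u₁ ∧ Integrable (kernel u₁))
    (hu₂ : Continuous u₂ ∧ Integrable u₂ ∧ Integrable (kernel u₂))
    {g : ℝ × ℝ → ℝ} (hg : Integrable g)
    (hgU : ∀ t ∈ Set.Icc 0 T, ∀ κ : ℝ × ℝ, (1 + κ.1 ^ 2 + κ.2 ^ 2) * ‖Uh t κ‖ ≤ g κ)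
    (hgF : ∀ t ∈ Set.Icc 0 T, ∀ κ : ℝ × ℝ, ‖Fh t κ‖ ≤ g κ)
    {t : ℝ} (ht : t ∈ Set.Icc 0 T) : ContDiff ℝ 2 (tilde (Uh t)) ∧ ∀ p : ℝ × ℝ,
      HasDerivWithinAt (fun s => tilde (Uh s) p)
        (-Complex.I * (lap (tilde (Uh t)) p
            + ((u₂ p.1 + u₁ p.2 : ℝ) : ℂ) * tilde (Uh t) p)
          + tilde (Fh t) p) (Set.Icc 0 T) t := by
  have cU := h.continuous_U t ht
  have hm := cU.aestronglyMeasurable (μ := volume)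
  have one_le : ∀ κ : ℝ × ℝ, 1 ≤ 1 + κ.1 ^ 2 + κ.2 ^ 2 := fun κ => by
    nlinarith [sq_nonneg κ.1, sq_nonneg κ.2]
  have hU : ∀ s ∈ Set.Icc 0 T, ∀ κ, ‖Uh s κ‖ ≤ g κ := fun s hs κ =>
    (le_mul_of_one_le_left (norm_nonneg _) (one_le κ)).trans (hgU s hs κ)
  have iU : Integrable (Uh t) := hg.mono' hm (Eventually.of_forall (hU t ht))
  have iw : Integrable fun κ : ℝ × ℝ => (1 + κ.1 ^ 2 + κ.2 ^ 2) * ‖Uh t κ‖ :=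
    hg.mono' ((by fun_prop : Continuous fun κ : ℝ × ℝ => 1 + κ.1 ^ 2 + κ.2 ^ 2).mul
      cU.norm).aestronglyMeasurable (Eventually.of_forall fun κ => by
        have := one_le κ
        rw [Real.norm_eq_abs, abs_of_nonneg (by positivity)]; exact hgU t ht κ)
  refine ⟨contDiff_tilde hm iw, fun p => ?_⟩
  -- The convolution is dominated by that of |χ| with `g`, which is integrable; the defining
  -- integral converges for almost every κ.
  have hconv : ∀ {χ : ℝ → ℂ} (v : ℝ × ℝ), Integrable χ →
      Integrable (fun κ => ∫ k', ‖χ k'‖ * g (κ - k' • v)) ∧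
      ∀ᵐ κ, ∀ s ∈ Set.Icc 0 T, ‖convAlong χ v (Uh s) κ‖ * ‖wave κ p‖
        ≤ ∫ k', ‖χ k'‖ * g (κ - k' • v) := fun {χ} v hχ => by
    have hi := integrable_shift hχ.norm v hg
    refine ⟨hi.integral_prod_right, ?_⟩
    filter_upwards [hi.prod_left_ae] with κ hκ s hs
    rw [norm_wave, mul_one]
    refine norm_integral_le_of_norm_le hκ (Eventually.of_forall fun k' => ?_)
    rw [norm_mul, mul_comm]
    exact mul_le_mul_of_nonneg_left (hU s hs _) (norm_nonneg _)
  obtain ⟨a₁, b₁⟩ := hconv (1, 0) h.integrable₁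
  obtain ⟨a₂, b₂⟩ := hconv (0, 1) h.integrable₂
  have D := h.hasDerivWithinAt_integral (W := fun κ => wave κ p)
    (continuous_wave continuous_id continuous_const) hg
    (fun s hs κ => by rw [norm_wave, mul_one]; exact hgU s hs κ)
    (fun s hs κ => by rw [norm_wave, mul_one]; exact hgF s hs κ) a₁ b₁ a₂ b₂ ht
  have D' : HasDerivWithinAt (fun s => tilde (Uh s) p) _ (Set.Icc 0 T) t :=
    D.const_mul (1 / (2 * Real.pi) : ℂ)
  refine D'.congr_deriv ?_
  have r' : tilde (fun κ => -((κ.1 : ℂ) ^ 2 + (κ.2 : ℂ) ^ 2) * Uh t κ) p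
      = -((1 / (2 * Real.pi) : ℂ)
        * ∫ κ : ℝ × ℝ, ((κ.1 : ℂ) ^ 2 + (κ.2 : ℂ) ^ 2) * Uh t κ * wave κ p) := by
    rw [tilde_eq, ← mul_neg, ← integral_neg]
    simp only [neg_mul]
  rw [integral_convAlong_wave h.integrable₁ (integral_kernel_wave_fst hu₁) iU,
    integral_convAlong_wave h.integrable₂ (integral_kernel_wave_snd hu₂) iU, lap_tilde hm iw, r',
    tilde_eq (Uh t), tilde_eq (Fh t)]
  push_cast
  ring

end SpectralEvolution

end DS1

end

/-! ### Assembly of the theorem -/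

theorem theorem3 (σ T₀ : ℝ) (hσ : σ = 1 ∨ σ = -1) (hT₀ : 0 < T₀)
    (u₁ u₂ : ℝ → ℝ)
    (hu₁ : Continuous u₁ ∧ Integrable u₁ ∧ Integrable (DS1.kernel u₁))
    (hu₂ : Continuous u₂ ∧ Integrable u₂ ∧ Integrable (DS1.kernel u₂))
    (Q F U : ℝ → ℝ × ℝ → ℂ) (G₁ G₂ V₁ V₂ : ℝ → ℝ × ℝ → ℝ)
    (hQ : DS1.IsSolution σ T₀ u₁ u₂ Q G₁ G₂) (hQreg : DS1.RegularOn 3 T₀ Q)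
    (hU : DS1.IsLinearizedSolution σ T₀ Q G₁ G₂ F U V₁ V₂)
    (hUreg : DS1.RegularOn 4 T₀ U) (hFreg : DS1.RegularOn 4 T₀ F) :
    -- the functions `ψ` and `φ` that define the spectral coefficients exist and are unique
    (∀ t ∈ Set.Icc 0 T₀, ∀ k : ℝ, ∃! ψ, DS1.IsPsi σ (Q t) k ψ) ∧
    (∀ t ∈ Set.Icc 0 T₀, ∀ l : ℝ, ∃! φ, DS1.IsPhi σ (Q t) l φ) ∧
    ∀ ψ φ : ℝ → ℝ → ℝ × ℝ → ℂ × ℂ,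
      (∀ t ∈ Set.Icc 0 T₀, ∀ k, DS1.IsPsi σ (Q t) k (ψ t k)) →
      (∀ t ∈ Set.Icc 0 T₀, ∀ l, DS1.IsPhi σ (Q t) l (φ t l)) →
      ∀ Uhat Fhat : ℝ → ℝ × ℝ → ℂ,
        (Uhat = fun t => DS1.hat σ (ψ t) (φ t) (U t)) →
        (Fhat = fun t => DS1.hat σ (ψ t) (φ t) (F t)) →
        -- the evolution of the spectral coefficients
        (∀ t ∈ Set.Icc 0 T₀, ∀ k l : ℝ,
          Integrable (fun k' => Uhat t (k - k', l) * DS1.kernel u₁ k') ∧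
          Integrable (fun l' => Uhat t (k, l - l') * DS1.kernel u₂ l') ∧
          HasDerivWithinAt (fun s => Uhat s (k, l))
            (Complex.I * ((k : ℂ) ^ 2 + (l : ℂ) ^ 2) * Uhat t (k, l)
              + (∫ k', Uhat t (k - k', l) * DS1.kernel u₁ k')
              + (∫ l', Uhat t (k, l - l') * DS1.kernel u₂ l')
              + Fhat t (k, l)) (Set.Icc 0 T₀) t) ∧
        -- the linear Schrödinger equation for the Fourier transform, as a distribution
        (∀ θ : SchwartzMap (ℝ × ℝ) ℂ, ∀ t ∈ Set.Icc 0 T₀,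
          HasDerivWithinAt (fun s => DS1.tildeDistr (Uhat s) θ)
            (-Complex.I * (DS1.tildeDistr (Uhat t) (DS1.lap θ)
                + DS1.tildeDistr (Uhat t) (fun p => ((u₂ p.1 + u₁ p.2 : ℝ) : ℂ) * θ p))
              + DS1.tildeDistr (Fhat t) θ) (Set.Icc 0 T₀) t) ∧
        -- and pointwise, whenever the Fourier integrals converge well enough
        (∀ g : ℝ × ℝ → ℝ, Integrable g →
          (∀ t ∈ Set.Icc 0 T₀, ∀ κ : ℝ × ℝ, (1 + κ.1 ^ 2 + κ.2 ^ 2) * ‖Uhat t κ‖ ≤ g κ) →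
          (∀ t ∈ Set.Icc 0 T₀, ∀ κ : ℝ × ℝ, ‖Fhat t κ‖ ≤ g κ) →
          ∀ t ∈ Set.Icc 0 T₀, ContDiff ℝ 2 (DS1.tilde (Uhat t)) ∧ ∀ p : ℝ × ℝ,
            HasDerivWithinAt (fun s => DS1.tilde (Uhat s) p)
              (-Complex.I * (DS1.lap (DS1.tilde (Uhat t)) p
                  + ((u₂ p.1 + u₁ p.2 : ℝ) : ℂ) * DS1.tilde (Uhat t) p)
                + DS1.tilde (Fhat t) p) (Set.Icc 0 T₀) t) := by
  -- The size of σ enters only through the norm estimate of the Volterra operator; the algebraic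
  -- identities hold for every real σ.
  have hσ' : |σ| ≤ 1 := by rcases hσ with h | h <;> simp [h]
  have hQreg' : DS1.RegularOn 3 T₀ (fun t => DS1.negSwap (Q t)) := hQreg.neg_swap
  have hb₁ := DS1.exists_bound_of_kernel hu₁.1 hu₁.2.1 hu₁.2.2
  have hb₂ := DS1.exists_bound_of_kernel hu₂.1 hu₂.2.1 hu₂.2.2
  refine ⟨fun t ht k => DS1.existsUnique_isPsi hσ' (hQreg.sobolevReg ht) k,
    fun t ht l => DS1.existsUnique_isPhi hσ' (hQreg'.sobolevReg ht) l, ?_⟩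
  intro ψ φ hψ hφ Uhat Fhat hUhat hFhat
  -- The given ψ and φ are prescribed for times in the interval only, so the identification is
  -- restricted to these times; derivatives within the interval see no others.
  have eU : ∀ t ∈ Set.Icc 0 T₀, Uhat t = DS1.specHat σ (Q t) (U t) := fun t ht => by
    rw [hUhat]
    exact DS1.hat_eq_specHat hσ' (hQreg.sobolevReg ht) (hQreg'.sobolevReg ht) (hψ t ht) (hφ t ht) _
  have eF : ∀ t ∈ Set.Icc 0 T₀, Fhat t = DS1.specHat σ (Q t) (F t) := fun t ht => by
    rw [hFhat]
    exact DS1.hat_eq_specHat hσ' (hQreg.sobolevReg ht) (hQreg'.sobolevReg ht) (hψ t ht) (hφ t ht) _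
  have rU := fun t ht => hUreg.sobolevReg (t := t) ht
  have rF := fun t ht => hFreg.sobolevReg (t := t) ht
  have hev : ∀ t ∈ Set.Icc 0 T₀, ∀ k l : ℝ, HasDerivWithinAt (fun s => Uhat s (k, l))
      (Complex.I * ((k : ℂ) ^ 2 + (l : ℂ) ^ 2) * Uhat t (k, l)
        + (∫ k', Uhat t (k - k', l) * DS1.kernel u₁ k')
        + (∫ l', Uhat t (k, l - l') * DS1.kernel u₂ l')
        + Fhat t (k, l)) (Set.Icc 0 T₀) t := fun t ht k l => by
    rw [eU t ht, eF t ht]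
    exact (hU.hasDerivWithinAt_specHat hσ' hQ hQreg hUreg hFreg hu₁ hu₂ ht k l).congr_of_mem
      (fun s hs => by rw [eU s hs]) ht
  have hspec : DS1.SpectralEvolution T₀ (DS1.kernel u₁) (DS1.kernel u₂) Uhat Fhat := by
    refine ⟨hu₁.2.2, hu₂.2.2, fun s hs => ?_, fun s hs => ?_, ?_, ?_, fun s hs κ => ?_⟩
    · rw [eU s hs]
      exact DS1.continuous_specHat σ (Q s) (rU s hs).continuous (rU s hs).integrable_self
    · rw [eF s hs]
      exact DS1.continuous_specHat σ (Q s) (rF s hs).continuous (rF s hs).integrable_self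
    · obtain ⟨C, hC0, hC⟩ := hQ.exists_bound_specHat hσ' hQreg ⟨hu₁.1, hb₁⟩ ⟨hu₂.1, hb₂⟩ hUreg
      exact ⟨C, hC0, fun s hs κ => by rw [eU s hs]; exact hC s hs κ⟩
    · obtain ⟨C, hC0, hC⟩ := hQ.exists_bound_specHat hσ' hQreg ⟨hu₁.1, hb₁⟩ ⟨hu₂.1, hb₂⟩ hFreg
      exact ⟨C, hC0, fun s hs κ => by rw [eF s hs]; exact hC s hs κ⟩
    · refine (hev s hs κ.1 κ.2).congr_deriv ?_
      simp only [DS1.convAlong, Prod.smul_mk, smul_eq_mul, mul_one, mul_zero, Prod.sub_def,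
        sub_zero]
  refine ⟨fun t ht k l => ⟨?_, ?_, hev t ht k l⟩,
    fun θ t ht => hspec.hasDerivWithinAt_tildeDistr hu₁ hu₂ θ ht,
    fun g hg hgU hgF t ht => hspec.hasDerivWithinAt_tilde hu₁ hu₂ hg hgU hgF ht⟩
  · rw [eU t ht]
    exact DS1.integrable_specHat_fst σ (Q t) (rU t ht).continuous (rU t ht).integrable_self
      hu₁.2.2 k l
  · rw [eU t ht]
    exact DS1.integrable_specHat_snd σ (Q t) (rU t ht).continuous (rU t ht).integrable_self
      hu₂.2.2 k l
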